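/- **Setting.** Let $X,\varepsilon_1,\varepsilon_2$ be independent real random variables, $\varepsilon_1,\varepsilon_2$ distributed as $\varepsilon$, let $Y=(Y_1,Y_2)=(X+\varepsilon_1,X+\varepsilon_2)$, and let $Y_j=(Y_{j,1},Y_{j,2})$, $j=1,\dots,n$ ($n\ge1$), be independent copies of $Y$. Write $\phi_X,\phi_\varepsilon$ for the characteristic functions of $X,\varepsilon$, $\psi(u_1,u_2)=\mathbb E[e^{i(u_1Y_1+u_2Y_2)}]$ and $\phi_Y(z)=\psi(0,z)$. Assume: * (A1) $X$ and $\varepsilon$ have square integrable Lebesgue densities $f_X$, $f_\varepsilon$; * (A2) $\phi_X$ and $\phi_\varepsilon$ vanish nowhere; * (A3) $\mathbb E[\varepsilon]=0$; * (A4) for some constant $C_X>0$, $|\phi_X(u)|\le C_X|\phi_X(v)|$ for all $0\le v\le u$; * (A5) for some constant $C_\varepsilon>0$, $|\phi_\varepsilon(u)|\le C_\varepsilon|\phi_\varepsilon(v)|$ for all $0\le v\le u$. Let $K\in L^2(\mathbb R)$ be a real kernel whose Fourier transform $\mathcal FK(u)=\int e^{iux}K(x)\,dx$ (in the sense of Plancherel)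 vanishes almost everywhere outside $[-1,1]$, let $h>0$ and $K_h(x)=\frac1hK(x/h)$. **Estimator.** Put $\hat\psi(u_1,u_2)=\frac1n\sum_j e^{i(u_1Y_{j,1}+u_2Y_{j,2})}$ and $\partial_1\hat\psi(u_1,u_2)=\frac1n\sum_j iY_{j,1}e^{i(u_1Y_{j,1}+u_2Y_{j,2})}$. For $z\in\mathbb C\setminus\{0\}$ let $\rho_n(z)=z/\min\{n^{1/2}|z|,1\}$, and in the integral below put $1/\rho_n(0)=0$. Define $$\hat\phi^{\rm mod}_X(u)=\exp\int_0^u\frac{\partial_1\hat\psi(0,z)}{\rho_n(\hat\psi(0,z))}\,dz,\qquad \hat\phi_X(u)=\frac{\hat\phi_X^{\rm mod}(u)}{\max\{1,|\hat\phi_X^{\rm mod}(u)|\}},\qquad \hat\phi_\varepsilon(u)=\frac{\hat\psi(0,u)}{\rho_n(\hat\phi_X(u))},$$ $$\hat f_{\varepsilon,h}(x)=\frac1{2\pi}\int e^{-iux}\,\hat\phi_\varepsilon(u)\,\mathcal FK_h(u)\,du .$$ **Notation.** For $p\in\mathbb N$ and $u>0$ let, with values in $[0,\infty]$, $$G(X,\varepsilon,p,u)=\big(\|\phi_X''\phi_\varepsilon\|_{L^1}+\mathbb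 E[\varepsilon^2]\,\|\phi_X\phi_\varepsilon\|_{L^1}+\|\phi_X'\phi_\varepsilon\|_{L^2}^2\big)^p+\Big(\int_0^u\Big|\tfrac{\partial}{\partial u_1}\log\psi(0,x)\Big|^2dx\Big)^p+\frac{\mathbb E[|Y_1|^{2p}]\,1_{\{p\ge2\}}\,u^p}{n^{p-1}}+\mathbb E[|Y_1|^{2p}]^{1/2}.$$ **Theorem.** Let $q\ge2$ be an integer. There is a constant $C>0$ depending only on $q$ such that, whenever the above holds and $\mathbb E[|Y_1|^{4q}]<\infty$, $$\begin{aligned}\mathbb E\,\|f_\varepsilon-\hat f_{\varepsilon,h}\|_{L^2}^2\le{}&2\,\|f_\varepsilon-K_h*f_\varepsilon\|_{L^2}^2+C\,C_\varepsilon^2\,\|\mathcal FK\|_\infty^2\Big[\frac{G(X,\varepsilon,1,1/h)}{n}\int_{-1/h}^{1/h}\int_0^{|u|}\frac{dz}{|\phi_X(z)|^2}\,du\\ &+\frac{G(X,\varepsilon,q,1/h)}{n^{q-1}}\int_{-1/h}^{1/h}\frac1{|\phi_X(u)|^2}\Big(\int_0^{|u|}\frac{dz}{|\phi_X(z)|^2}\Big)\Big(\int_0^{|u|}\frac{dz}{|\phi_Y(z)|^2}\Big)^{q-1}du\\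 &+\frac{G(X,\varepsilon,2,1/h)^{1/2}}{n^2}\int_{-1/h}^{1/h}\frac1{|\phi_X(u)|^2}\Big(\int_0^{|u|}\frac{dz}{|\phi_Y(z)|^2}\Big)du\\ &+\frac{G(X,\varepsilon,2q,1/h)^{1/2}}{n^q}\int_{-1/h}^{1/h}\frac1{|\phi_X(u)|^4}\Big(\int_0^{|u|}\frac{dz}{|\phi_Y(z)|^2}\Big)^{q}du+\frac1{n^2}\int_{-1/h}^{1/h}\frac{du}{|\phi_X(u)|^4}\Big].\end{aligned}$$ Here $\|\mathcal FK\|_\infty\in[0,\infty]$ is the essential supremum of $|\mathcal FK|$ (it equals $1$ for the sinc kernel $\mathcal FK=1_{[-1,1]}$), and the right-hand side is read in $[0,\infty]$ with $0\cdot\infty=0$. -/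

import Mathlib

open MeasureTheory ProbabilityTheory Complex
open scoped ENNReal FourierTransform

noncomputable section

namespace RepeatedDeconv

/-! ### The model -/

/-- `f` is a square integrable Lebesgue density of the distribution `μ`. -/
structure IsSqIntegrableDensity (f : ℝ → ℝ) (μ : Measure ℝ) : Prop where
  measurable : Measurable f
  nonneg : ∀ x, 0 ≤ f x
  memLp : MemLp f 2 volume
  withDensity : μ = volume.withDensity fun x => ENNReal.ofReal (f x)

/-- The law of `Y = (X + ε₁, X + ε₂)` where `X ∼ μX`, `ε₁, ε₂ ∼ με` are independent. -/
def lawY (μX με : Measure ℝ) : Measure (ℝ × ℝ) :=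
  (μX.prod (με.prod με)).map fun p => (p.1 + p.2.1, p.1 + p.2.2)

/-- `Y 0, …, Y (n-1)` are independent copies of `(X + ε₁, X + ε₂)`. -/
structure IsSample {Ω : Type*} [MeasurableSpace Ω] (P : Measure Ω) (μX με : Measure ℝ) {n : ℕ}
    (Y : Fin n → Ω → ℝ × ℝ) : Prop where
  measurable : ∀ j, Measurable (Y j)
  indep : iIndepFun Y P
  law : ∀ j, P.map (Y j) = lawY μX με

/-- `|φ(u)| ≤ C |φ(v)|` whenever `0 ≤ v ≤ u`. -/
def QuasiDecreasing (φ : ℝ → ℂ) (C : ℝ) : Prop :=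
  ∀ u v : ℝ, 0 ≤ v → v ≤ u → ‖φ u‖ ≤ C * ‖φ v‖

/-- The characteristic function `ψ(u₁, u₂)` of `Y = (Y₁, Y₂)`. -/
def psi (μX με : Measure ℝ) (u₁ u₂ : ℝ) : ℂ :=
  ∫ y, exp (I * (u₁ * y.1 + u₂ * y.2)) ∂(lawY μX με)

/-- `φ_Y(z) = ψ(0, z)`. -/
def phiY (μX με : Measure ℝ) (z : ℝ) : ℂ := psi μX με 0 z

/-! ### The estimator, as a function of the data `y` -/

/-- The empirical characteristic function `ψ̂(u₁, u₂)`. -/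
def psiHat {n : ℕ} (y : Fin n → ℝ × ℝ) (u₁ u₂ : ℝ) : ℂ :=
  (1 / (n : ℂ)) * ∑ j, exp (I * (u₁ * (y j).1 + u₂ * (y j).2))

/-- The partial derivative of `ψ̂` in its first argument. -/
def dpsiHat {n : ℕ} (y : Fin n → ℝ × ℝ) (u₁ u₂ : ℝ) : ℂ :=
  (1 / (n : ℂ)) * ∑ j, I * (y j).1 * exp (I * (u₁ * (y j).1 + u₂ * (y j).2))

/-- `z / min (√n |z|, 1)`: the modulus is raised to at least `n ^ (-1/2)`, the argument is kept
(and `0` is sent to `0`). -/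
def regularize (n : ℕ) (z : ℂ) : ℂ := z / ((min (Real.sqrt n * ‖z‖) 1 : ℝ) : ℂ)

/-- `ψ̃(0, u)`. -/
def psiTilde {n : ℕ} (y : Fin n → ℝ × ℝ) (u : ℝ) : ℂ := regularize n (psiHat y 0 u)

/-- The modified estimator of `φ_X` before truncation. -/
def phiMod {n : ℕ} (y : Fin n → ℝ × ℝ) (u : ℝ) : ℂ :=
  exp (∫ z in (0 : ℝ)..u, dpsiHat y 0 z / psiTilde y z)

/-- The estimator `φ̂_X`. -/
def phiHatX {n : ℕ} (y : Fin n → ℝ × ℝ) (u : ℝ) : ℂ :=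
  phiMod y u / ((max 1 ‖phiMod y u‖ : ℝ) : ℂ)

/-- `φ̃_X`. -/
def phiTildeX {n : ℕ} (y : Fin n → ℝ × ℝ) (u : ℝ) : ℂ := regularize n (phiHatX y u)

/-- The estimator `φ̂_ε`. -/
def phiHatEps {n : ℕ} (y : Fin n → ℝ × ℝ) (u : ℝ) : ℂ := psiHat y 0 u / phiTildeX y u

open Classical in
/-- The Fourier transform `u ↦ ∫ e^{iux} g(x) dx` of a square integrable function `g`, in the
sense of Plancherel. (Mathlib's `𝓕` has the kernel `e^{-2πiux}`.) -/
def fourierL2 (g : ℝ → ℝ) (u : ℝ) : ℂ :=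
  if hg : MemLp (fun x => (g x : ℂ)) 2 (volume : Measure ℝ) then
    (𝓕 (hg.toLp _) : Lp ℂ 2 (volume : Measure ℝ)) (-(u / (2 * Real.pi)))
  else 0

/-- The rescaled kernel `K_h(x) = (1/h) K(x/h)`. -/
def scaleKernel (K : ℝ → ℝ) (h : ℝ) (x : ℝ) : ℝ := 1 / h * K (x / h)

/-- The estimator `f̂_{ε,h}` of the density of the errors. -/
def fHatEps {n : ℕ} (K : ℝ → ℝ) (h : ℝ) (y : Fin n → ℝ × ℝ) (x : ℝ) : ℂ :=
  1 / (2 * Real.pi) *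
    ∫ u : ℝ, exp (-(I * u * x)) * phiHatEps y u * fourierL2 (scaleKernel K h) u

/-- The convolution `K_h * f`. -/
def smooth (K : ℝ → ℝ) (h : ℝ) (f : ℝ → ℝ) : ℝ → ℝ :=
  convolution (scaleKernel K h) f (ContinuousLinearMap.mul ℝ ℝ) volume

/-! ### The quantities in the risk bound (with values in `[0, ∞]`) -/

/-- `∫_0^{|u|} |φ(z)|^{-2} dz`. -/
def intInvSq (φ : ℝ → ℂ) (u : ℝ) : ℝ≥0∞ := ∫⁻ z in Set.Icc 0 |u|, (‖φ z‖ₑ ^ 2)⁻¹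

/-- `E |Y₁|^m`. -/
def momentY (μX με : Measure ℝ) (m : ℕ) : ℝ≥0∞ := ∫⁻ y, ‖y.1‖ₑ ^ m ∂(lawY μX με)

/-- `G(X, ε, p, u)` for the sample size `n`. -/
def G (μX με : Measure ℝ) (n p : ℕ) (u : ℝ) : ℝ≥0∞ :=
  (eLpNorm (fun z => iteratedDeriv 2 (charFun μX) z * charFun με z) 1 volume
      + (∫⁻ e, ‖e‖ₑ ^ 2 ∂με) * eLpNorm (fun z => charFun μX z * charFun με z) 1 volume
      + eLpNorm (fun z => deriv (charFun μX) z * charFun με z) 2 volume ^ 2) ^ p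
    + (∫⁻ x in Set.Icc 0 |u|, ‖logDeriv (fun u₁ : ℝ => psi μX με u₁ x) 0‖ₑ ^ 2) ^ p
    + (if 2 ≤ p then momentY μX με (2 * p) * ENNReal.ofReal u ^ p / (n : ℝ≥0∞) ^ (p - 1) else 0)
    + momentY μX με (2 * p) ^ (1 / 2 : ℝ)

end RepeatedDeconv

end

open RepeatedDeconv

universe u v

set_option linter.unusedSectionVars false

/-! ### The Fourier transform on `L²` -/

/-! The risk is moved to the Fourier side. `K_h * f_ε` and the estimator are both inverse Fourier
integrals, of `φ_ε · FK_h` and `φ̂_ε · FK_h`, so Plancherel bounds their squared distance by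
`‖FK‖_∞²` times the integral of `|φ̂_ε(u) - φ_ε(u)|²` over `[-1/h, 1/h]`. With `(a + b)² ≤ 2a² +
2b²` for the bias, it remains to bound `E |φ̂_ε(u) - φ_ε(u)|²` for fixed `u`. By conjugation
symmetry `u ≥ 0` suffices.

Since `E ε = 0`, the derivative of `log ψ` in its first argument at `(0, z)` is `φ_X'(z)/φ_X(z)`,
and `φ_X` is the exponential of the primitive of this function. Hence the untruncated estimator
equals `φ_X exp Δ` with `Δ(u) = ∫_0^u (∂₁ψ̂/ψ̃ - φ_X'/φ_X)` (`phiMod_eq`). Writing `D` for the error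
of `∂₁ψ̂` and `Q` for that of `1/ψ̃`, the integrand is `D/φ_Y + (φ_X'/φ_X) φ_Y Q + D Q`. The first
integral is a centred mean of independent variables. Rosenthal's inequality applies, and its
variance is controlled by the `L¹` norm of a covariance kernel. The other two rest on `E (|φ_Y|²
|Q|)^{2p} ≤ C n^{-p}`. Together they give `E fluct ≤ C n^{-p} (∫ |φ_Y|^{-2})^p G(p)`
(`exists_lintegral_fluct_le`).

Three regimes then cover everything, with `S = ψ̂(0,u) - φ_Y(u)`. If `√n |φ_X(u)| < 3`, the
regularization keeps the mean squared error bounded, and a constant is at most a multiple of `n^{-2}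
|φ_X|^{-4}`. If `√n |φ_X(u)| ≥ 3` and `|Δ| ≤ 1`, regularization is inactive and the error is at most
`3 |S|/|φ_X| + 12 |Δ| |φ_ε|`. Here quasi-monotonicity of `φ_ε` turns `|φ_ε(u)|² ∫ |φ_Y|^{-2}` into
`C_ε² ∫ |φ_X|^{-2}`. If `|Δ| > 1`, the crude bound by multiples of `n |S|²` and `n |φ_X φ_ε|²` is
multiplied, as in Markov's inequality, by a high power of the fluctuation. This produces the terms
of order `q` and `2q`, and the need for `4q` moments. -/

theorem integral_smul_fourier_toLp {f : ℝ → ℂ} (hf : MemLp f 2 volume) {g : ℝ → ℝ}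
    (hg : ContDiff ℝ (⊤ : ℕ∞) g) (hgc : HasCompactSupport g) :
    ∫ x, g x • (𝓕 (hf.toLp f) : Lp ℂ 2 (volume : Measure ℝ)) x
      = ∫ x, 𝓕 (fun y => (g y : ℂ)) x * f x := by
  have hg₁ : HasCompactSupport (Complex.ofRealCLM ∘ g) := hgc.comp_left rfl
  have hg₂ : ContDiff ℝ (⊤ : ℕ∞) (Complex.ofRealCLM ∘ g) := by fun_prop
  have h := congrArg (fun T => T (hg₁.toSchwartzMap hg₂))
    (Lp.fourier_toTemperedDistribution_eq (hf.toLp f))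
  simp only [TemperedDistribution.fourier_apply, Lp.toTemperedDistribution_apply,
    SchwartzMap.fourier_coe] at h
  calc _ = _ := ?_
    _ = _ := h.symm
    _ = _ := ?_
  · refine integral_congr_ae (Filter.Eventually.of_forall fun x => ?_)
    simp
  · refine integral_congr_ae ?_
    filter_upwards [hf.coeFn_toLp] with x hx
    rw [hx, smul_eq_mul]
    rfl

/-- Both sides have the same integrals against smooth compactly supported functions: the transform
moves onto the test function, by duality of tempered distributions for the `L²` transform and by
Fubini for the integral one. -/
theorem fourier_toLp_ae_eq {f : ℝ → ℂ} (hf1 : Integrable f) (hf2 : MemLp f 2 volume) :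
    (𝓕 (hf2.toLp f) : Lp ℂ 2 (volume : Measure ℝ)) =ᵐ[volume] 𝓕 f := by
  have hcont : Continuous (𝓕 f) :=
    VectorFourier.fourierIntegral_continuous Real.continuous_fourierChar
      (by fun_prop) hf1
  refine ae_eq_of_integral_contDiff_smul_eq ((Lp.memLp _).locallyIntegrable (by norm_num))
    hcont.locallyIntegrable fun g hg hgc => ?_
  rw [integral_smul_fourier_toLp hf2 hg hgc]
  have hgi : Integrable (fun y => (g y : ℂ)) :=
    (hg.continuous.integrable_of_hasCompactSupport hgc).ofReal
  have := VectorFourier.integral_fourierIntegral_smul_eq_flip (L := innerₗ ℝ)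
    (μ := (volume : Measure ℝ)) (ν := volume)
    Real.continuous_fourierChar (by fun_prop) hgi hf1
  rw [flip_innerₗ] at this
  simpa [FourierTransform.fourier] using this

theorem eLpNorm_fourier_eq {f : ℝ → ℂ} (hf1 : Integrable f) (hf2 : MemLp f 2 volume) :
    eLpNorm (𝓕 f) 2 volume = eLpNorm f 2 volume := by
  rw [← eLpNorm_congr_ae (fourier_toLp_ae_eq hf1 hf2), ← eLpNorm_congr_ae hf2.coeFn_toLp]
  have := Lp.norm_fourier_eq (hf2.toLp f)
  rw [Lp.norm_def, Lp.norm_def] at this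
  exact (ENNReal.toReal_eq_toReal_iff' (Lp.eLpNorm_ne_top _) (Lp.eLpNorm_ne_top _)).1 this

theorem memLp_ofReal {K : ℝ → ℝ} {p : ℝ≥0∞} (hK : MemLp K p volume) :
    MemLp (fun x => (K x : ℂ)) p volume := hK.ofReal

theorem memLp_scaleKernel {K : ℝ → ℝ} (hK : MemLp K 2 volume) {h : ℝ} (hh : 0 < h) :
    MemLp (scaleKernel K h) 2 volume := by
  have h1 : MemLp (fun x => K (h⁻¹ * x)) 2 volume := by
    have h2 : MemLp K 2 (Measure.map (fun x : ℝ => h⁻¹ * x) volume) := by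
      rw [Real.map_volume_mul_left (inv_ne_zero hh.ne')]
      exact hK.smul_measure ENNReal.ofReal_ne_top
    exact h2.comp_of_map (by fun_prop)
  have := h1.const_mul (1 / h)
  refine this.ae_eq (Filter.Eventually.of_forall fun x => ?_)
  simp [scaleKernel, div_eq_inv_mul]

theorem fourierL2_of_memLp {g : ℝ → ℝ} (hg : MemLp (fun x => (g x : ℂ)) 2 volume) (u : ℝ) :
    fourierL2 g u =
      (𝓕 (hg.toLp _) : Lp ℂ 2 (volume : Measure ℝ)) (-(u / (2 * Real.pi))) := by
  rw [fourierL2, dif_pos hg]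

/-- Null sets are preserved by linear changes of variables. -/
theorem ae_comp_mul_left {p : ℝ → Prop} (hp : ∀ᵐ x : ℝ, p x) {c : ℝ} (hc : c ≠ 0) :
    ∀ᵐ x : ℝ, p (c * x) := by
  have : Measure.QuasiMeasurePreserving (fun x : ℝ => c * x) volume volume := by
    refine ⟨by fun_prop, ?_⟩
    rw [Real.map_volume_mul_left hc]
    exact Measure.smul_absolutelyContinuous
  exact this.ae hp

theorem memLp_comp_mul_left {f : ℝ → ℂ} (hf : MemLp f 2 volume) {c : ℝ} (hc : c ≠ 0) :
    MemLp (fun x => f (c * x)) 2 volume := by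
  have h2 : MemLp f 2 (Measure.map (fun x : ℝ => c * x) volume) := by
    rw [Real.map_volume_mul_left hc]
    exact hf.smul_measure ENNReal.ofReal_ne_top
  exact h2.comp_of_map (by fun_prop)

theorem fourier_comp_div {g : ℝ → ℂ} {h : ℝ} (hh : 0 < h) (x : ℝ) :
    𝓕 (fun y => g (h⁻¹ * y)) x = h * 𝓕 g (h * x) := by
  rw [Real.fourier_eq, Real.fourier_eq]
  have := Measure.integral_comp_mul_left
    (fun v : ℝ => (Real.fourierChar (-inner ℝ v (h * x)) : Circle) • g v) h⁻¹
  rw [inv_inv, abs_of_pos hh] at this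
  rw [← Complex.real_smul, ← this]
  refine integral_congr_ae (Filter.Eventually.of_forall fun v => ?_)
  simp only [RCLike.inner_apply, conj_trivial]
  congr 3
  field_simp

/-- For a kernel that is only in `L²` no change of variables is available inside a Fourier integral,
so the scaling is carried out on test functions, whose transforms are genuine integrals. -/
theorem fourierL2_scaleKernel {K : ℝ → ℝ} (hK : MemLp K 2 volume) {h : ℝ} (hh : 0 < h) :
    ∀ᵐ u, fourierL2 (scaleKernel K h) u = fourierL2 K (h * u) := by
  have hKc := memLp_ofReal hK
  have hSc := memLp_ofReal (memLp_scaleKernel hK hh)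
  have key : ∀ᵐ v, (𝓕 (hSc.toLp _) : Lp ℂ 2 (volume : Measure ℝ)) v
      = (𝓕 (hKc.toLp _) : Lp ℂ 2 (volume : Measure ℝ)) (h * v) := by
    refine ae_eq_of_integral_contDiff_smul_eq ((Lp.memLp _).locallyIntegrable (by norm_num))
      ((memLp_comp_mul_left (Lp.memLp _) hh.ne').locallyIntegrable (by norm_num))
      fun g hg hgc => ?_
    rw [integral_smul_fourier_toLp hSc hg hgc]
    have hg' : ContDiff ℝ (⊤ : ℕ∞) (fun y => g (h⁻¹ * y)) := by fun_prop
    have hgc' : HasCompactSupport (fun y => g (h⁻¹ * y)) :=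
      hgc.comp_homeomorph (Homeomorph.mulLeft₀ h⁻¹ (inv_ne_zero hh.ne'))
    have h1 := integral_smul_fourier_toLp hKc hg' hgc'
    have h2 := Measure.integral_comp_mul_left
      (fun v : ℝ => g (h⁻¹ * v) • (𝓕 (hKc.toLp _) : Lp ℂ 2 (volume : Measure ℝ)) v) h
    simp only [inv_mul_cancel_left₀ hh.ne'] at h2
    rw [h2, h1]
    have h3 := Measure.integral_comp_mul_left
      (fun x : ℝ => 𝓕 (fun y => (g y : ℂ)) (h * x) * (K x : ℂ)) h⁻¹
    rw [inv_inv, abs_of_pos hh] at h3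
    rw [abs_of_pos (inv_pos.2 hh)]
    simp_rw [fourier_comp_div (g := fun y => (g y : ℂ)) hh, mul_assoc]
    rw [integral_const_mul]
    have h4 : ∀ x, 𝓕 (fun y => (g y : ℂ)) x * ((scaleKernel K h x : ℝ) : ℂ)
        = (h : ℂ)⁻¹ * (𝓕 (fun y => (g y : ℂ)) (h * (h⁻¹ * x)) * (K (h⁻¹ * x) : ℂ)) := by
      intro x
      rw [mul_inv_cancel_left₀ hh.ne']
      simp only [scaleKernel, div_eq_inv_mul]
      push_cast
      ring
    simp_rw [h4]
    rw [integral_const_mul, h3]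
    simp only [Complex.real_smul]
    have : (h : ℂ) ≠ 0 := by exact_mod_cast hh.ne'
    push_cast
    field_simp
  have h2pi : -(2 * Real.pi)⁻¹ ≠ 0 := neg_ne_zero.2 (inv_ne_zero Real.two_pi_pos.ne')
  filter_upwards [ae_comp_mul_left key h2pi] with u hu
  rw [fourierL2_of_memLp hSc, fourierL2_of_memLp hKc]
  convert hu using 2
  · ring
  · ring

theorem memLp_fourierL2 {K : ℝ → ℝ} (hK : MemLp K 2 volume) :
    MemLp (fourierL2 K) 2 volume := by
  have hKc := memLp_ofReal hK
  have h2pi : -(2 * Real.pi)⁻¹ ≠ 0 := neg_ne_zero.2 (inv_ne_zero Real.two_pi_pos.ne')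
  refine (memLp_comp_mul_left (Lp.memLp (𝓕 (hKc.toLp _))) h2pi).ae_eq
    (Filter.Eventually.of_forall fun u => ?_)
  rw [fourierL2_of_memLp hKc]
  congr 1
  ring

/-- Parseval's identity for `k` and the reflected translate `t ↦ f (x - t)`. It represents the
convolution at every point `x`, not only almost everywhere. -/
theorem integral_mul_reflect_eq_fourier {k f : ℝ → ℝ} (hk : MemLp k 2 volume)
    (hf1 : Integrable f) (hf2 : MemLp f 2 volume) (x : ℝ) :
    ((∫ t, k t * f (x - t) : ℝ) : ℂ) =
      𝓕 (fun v : ℝ => (∫ t : ℝ, exp (I * (2 * Real.pi * v : ℝ) * t) * f t)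
        * fourierL2 k (2 * Real.pi * v)) x := by
  have hkc := memLp_ofReal hk
  have ha1 : Integrable (fun t => (f (x - t) : ℂ)) := (hf1.comp_sub_left x).ofReal
  have hmp : MeasurePreserving (fun t : ℝ => x - t) volume volume :=
    Measure.measurePreserving_sub_left volume x
  have ha2 : MemLp (fun t => (f (x - t) : ℂ)) 2 volume :=
    memLp_ofReal (hf2.comp_measurePreserving hmp)
  have h := Lp.inner_fourier_eq (ha2.toLp _) (hkc.toLp _)
  rw [L2.inner_def, L2.inner_def] at h
  have e1 : ∫ t, inner ℂ ((ha2.toLp _) t) ((hkc.toLp _) t) = ((∫ t, k t * f (x - t) : ℝ) : ℂ) := by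
    rw [← integral_complex_ofReal]
    refine integral_congr_ae ?_
    filter_upwards [ha2.coeFn_toLp, hkc.coeFn_toLp] with t h1 h2
    rw [h1, h2]
    simp
  -- The substitution `v ↦ -v` accounts for the opposite signs in the exponents of `fourierL2` and
  -- of `𝓕`.
  rw [← e1, ← h, Real.fourier_eq, ← integral_neg_eq_self]
  refine integral_congr_ae ?_
  have hneg : Measure.QuasiMeasurePreserving (fun t : ℝ => -t) volume volume :=
    (Measure.measurePreserving_neg volume).quasiMeasurePreserving
  filter_upwards [hneg.ae (fourier_toLp_ae_eq ha1 ha2)] with v hv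
  rw [hv, fourierL2_of_memLp hkc]
  have e2 : -(2 * Real.pi * v / (2 * Real.pi)) = -v := by
    field_simp
  rw [e2, Real.fourier_eq]
  have e3 : (starRingEnd ℂ) (∫ t : ℝ, (Real.fourierChar (-inner ℝ t (-v)) : Circle) •
      (f (x - t) : ℂ)) = exp ((2 * Real.pi * -(x * v) : ℝ) * I)
        * ∫ t : ℝ, exp (I * (2 * Real.pi * v : ℝ) * t) * f t := by
    rw [← integral_conj, ← integral_sub_left_eq_self _ volume x, ← integral_const_mul]
    refine integral_congr_ae (Filter.Eventually.of_forall fun t => ?_)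
    simp only [Circle.smul_def, Real.fourierChar_apply, smul_eq_mul, map_mul, conj_ofReal,
      ← exp_conj, conj_I, sub_sub_cancel, RCLike.inner_apply, conj_trivial]
    rw [← mul_assoc, ← Complex.exp_add]
    congr 2
    push_cast
    ring
  rw [RCLike.inner_apply, e3]
  simp only [Circle.smul_def, Real.fourierChar_apply, smul_eq_mul, RCLike.inner_apply,
    conj_trivial]
  ring_nf

theorem integral_exp_neg_eq_fourier (w : ℝ → ℂ) (x : ℝ) :
    1 / (2 * Real.pi) * ∫ u : ℝ, exp (-(I * u * x)) * w u =
      𝓕 (fun v : ℝ => w (2 * Real.pi * v)) x := by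
  rw [Real.fourier_eq]
  have := Measure.integral_comp_mul_left (fun u : ℝ => exp (-(I * u * x)) * w u) (2 * Real.pi)
  rw [abs_of_pos (inv_pos.2 Real.two_pi_pos), Complex.real_smul] at this
  push_cast at this
  rw [one_div, ← this]
  refine integral_congr_ae (Filter.Eventually.of_forall fun v => ?_)
  simp only [Circle.smul_def, Real.fourierChar_apply, smul_eq_mul, RCLike.inner_apply,
    conj_trivial]
  congr 2
  push_cast
  ring

/-- Plancherel's identity for the difference between a smoothed density and a Fourier inversion
estimator. -/
theorem eLpNorm_smooth_sub_inversion_sq_le {k f : ℝ → ℝ} (hk : MemLp k 2 volume)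
    (hf1 : Integrable f) (hf2 : MemLp f 2 volume) {a : ℝ}
    (hsupp : ∀ᵐ u, u ∉ Set.Icc (-a) a → fourierL2 k u = 0) {φ g : ℝ → ℂ}
    (hφ : ∀ u : ℝ, φ u = ∫ t : ℝ, exp (I * u * t) * f t) (hφm : Measurable φ)
    (hgm : Measurable g) {M : ℝ} (hφM : ∀ u, ‖φ u‖ ≤ M) (hgM : ∀ u, ‖g u‖ ≤ M) :
    eLpNorm (fun x : ℝ => ((∫ t, k t * f (x - t) : ℝ) : ℂ)
        - 1 / (2 * Real.pi) * ∫ u : ℝ, exp (-(I * u * x)) * g u * fourierL2 k u) 2 volume ^ 2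
      ≤ ∫⁻ u in Set.Icc (-a) a, ‖g u - φ u‖ₑ ^ 2 * ‖fourierL2 k u‖ₑ ^ 2 := by
  have hk2 := memLp_fourierL2 hk
  have hpi : (2 * Real.pi) ≠ 0 := Real.two_pi_pos.ne'
  have hI : ∀ w : ℝ → ℂ, Measurable w → (∀ u, ‖w u‖ ≤ M) →
      Integrable (fun u => w u * fourierL2 k u) ∧ MemLp (fun u => w u * fourierL2 k u) 2 volume := by
    intro w hw hwM
    have h2 : MemLp (fun u => w u * fourierL2 k u) 2 volume := by
      refine hk2.of_le_mul (c := M) (hw.aestronglyMeasurable.mul hk2.1)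
        (Filter.Eventually.of_forall fun u => ?_)
      rw [norm_mul]
      exact mul_le_mul_of_nonneg_right (hwM u) (norm_nonneg _)
    refine ⟨?_, h2⟩
    -- The compact support makes the square integrable product integrable, which puts it in `L¹ ∩
    -- L²`, where both descriptions of the Fourier transform agree.
    have h3 : IntegrableOn (fun u => w u * fourierL2 k u) (Set.Icc (-a) a) := by
      have : MemLp (fun u => w u * fourierL2 k u) 2 (volume.restrict (Set.Icc (-a) a)) :=
        h2.restrict _
      have hfin : IsFiniteMeasure (volume.restrict (Set.Icc (-a) a)) := ⟨by simp⟩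
      exact this.integrable (by norm_num)
    rw [← integrable_indicator_iff measurableSet_Icc] at h3
    refine h3.congr ?_
    filter_upwards [hsupp] with u hu
    by_cases h : u ∈ Set.Icc (-a) a
    · simp [h]
    · simp [h, hu h]
  obtain ⟨hφ1, hφ2⟩ := hI φ hφm hφM
  obtain ⟨hg1, hg2⟩ := hI g hgm hgM
  have hdiff1 : Integrable (fun v : ℝ => (φ (2 * Real.pi * v) - g (2 * Real.pi * v))
      * fourierL2 k (2 * Real.pi * v)) := by
    have := (hφ1.sub hg1).comp_mul_left' hpi
    refine this.congr (Filter.Eventually.of_forall fun v => ?_)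
    simp [sub_mul]
  have hdiff2 : MemLp (fun v : ℝ => (φ (2 * Real.pi * v) - g (2 * Real.pi * v))
      * fourierL2 k (2 * Real.pi * v)) 2 volume := by
    have := memLp_comp_mul_left (hφ2.sub hg2) hpi
    refine this.ae_eq (Filter.Eventually.of_forall fun v => ?_)
    simp [sub_mul]
  have hfun : (fun x : ℝ => ((∫ t, k t * f (x - t) : ℝ) : ℂ)
        - 1 / (2 * Real.pi) * ∫ u : ℝ, exp (-(I * u * x)) * g u * fourierL2 k u)
      = 𝓕 (fun v : ℝ => (φ (2 * Real.pi * v) - g (2 * Real.pi * v))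
          * fourierL2 k (2 * Real.pi * v)) := by
    funext x
    rw [integral_mul_reflect_eq_fourier hk hf1 hf2]
    simp_rw [mul_assoc (exp _) (g _) _]
    rw [integral_exp_neg_eq_fourier (fun u => g u * fourierL2 k u)]
    simp_rw [← hφ]
    rw [Real.fourier_eq, Real.fourier_eq, Real.fourier_eq, ← integral_sub]
    · refine integral_congr_ae (Filter.Eventually.of_forall fun v => ?_)
      simp [sub_mul, smul_sub]
    · exact (Real.fourierIntegral_convergent_iff x).2 (hφ1.comp_mul_left' hpi)
    · exact (Real.fourierIntegral_convergent_iff x).2 (hg1.comp_mul_left' hpi)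
  rw [hfun, eLpNorm_fourier_eq hdiff1 hdiff2,
    eLpNorm_eq_lintegral_rpow_enorm_toReal (by norm_num) (by norm_num)]
  simp only [ENNReal.toReal_ofNat, ENNReal.rpow_ofNat]
  rw [← ENNReal.rpow_natCast, ← ENNReal.rpow_mul]
  norm_num
  set W : ℝ → ℝ≥0∞ := fun u => ‖(φ u - g u) * fourierL2 k u‖ₑ ^ 2 with hW
  have hWm : AEMeasurable W volume :=
    (((hφ2.sub hg2).1.enorm.pow_const 2)).congr
      (Filter.Eventually.of_forall fun v => by simp [hW, sub_mul])
  have hmap := lintegral_map' (μ := (volume : Measure ℝ)) (f := W)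
    (g := fun v : ℝ => 2 * Real.pi * v) (by
      rw [Real.map_volume_mul_left hpi]; exact hWm.smul_measure _) (by fun_prop)
  rw [Real.map_volume_mul_left hpi, lintegral_smul_measure] at hmap
  calc _ = ∫⁻ v, W (2 * Real.pi * v) := by simp [hW]
    _ = ENNReal.ofReal |(2 * Real.pi)⁻¹| • ∫⁻ u, W u := hmap.symm
    -- The Plancherel factor `1/(2π)` is at most `1` and is given away.
    _ ≤ 1 * ∫⁻ u, W u := by
        rw [smul_eq_mul]
        gcongr
        rw [← ENNReal.ofReal_one]
        apply ENNReal.ofReal_le_ofReal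
        rw [abs_of_pos (by positivity)]
        apply inv_le_one_of_one_le₀
        linarith [Real.pi_gt_three]
    _ = ∫⁻ u, (Set.Icc (-a) a).indicator W u := by
        rw [one_mul]
        refine lintegral_congr_ae ?_
        filter_upwards [hsupp] with u hu
        by_cases h : u ∈ Set.Icc (-a) a
        · simp [h]
        · simp [h, hu h, hW]
    _ = _ := by
        rw [lintegral_indicator measurableSet_Icc]
        refine lintegral_congr fun u => ?_
        simp only [hW, enorm_mul, mul_pow]
        rw [enorm_sub_rev]

/-! ### Rosenthal's inequality for even moments -/

/-- In the binomial expansion the leading and the linear term in `x` are kept exactly. Each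
remaining term contains `x` at least twice, so it is dominated by `s^(2p) x²` or by `x^(2p+2)`,
according to which of `|s|`, `|x|` is larger. The binomial coefficients add up to at most
`2^(2p+2)`. -/
theorem add_pow_le_of_even (s x : ℝ) (p : ℕ) :
    (s + x) ^ (2 * p + 2) ≤ s ^ (2 * p + 2) + (2 * p + 2 : ℕ) * (s ^ (2 * p + 1) * x)
      + 2 ^ (2 * p + 2) * (s ^ (2 * p) * x ^ 2 + x ^ (2 * p + 2)) := by
  have hA : 0 ≤ s ^ (2 * p) * x ^ 2 + x ^ (2 * p + 2) := by
    have h1 : 0 ≤ s ^ (2 * p) := (even_two_mul p).pow_nonneg s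
    have h2 : 0 ≤ x ^ (2 * p + 2) := Even.pow_nonneg ⟨p + 1, by ring⟩ x
    positivity
  have hterm : ∀ k ∈ Finset.range (2 * p + 1),
      s ^ k * x ^ (2 * p + 2 - k) * ((2 * p + 2).choose k : ℝ)
        ≤ ((2 * p + 2).choose k : ℝ) * (s ^ (2 * p) * x ^ 2 + x ^ (2 * p + 2)) := by
    intro k hk
    have hk' : k ≤ 2 * p := by simpa [Nat.lt_succ_iff] using hk
    rw [mul_comm]
    refine mul_le_mul_of_nonneg_left ?_ (Nat.cast_nonneg _)
    have e1 : s ^ (2 * p) = |s| ^ (2 * p) := ((even_two_mul p).pow_abs s).symm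
    have e2 : x ^ 2 = |x| ^ 2 := (sq_abs x).symm
    have e3 : x ^ (2 * p + 2) = |x| ^ (2 * p + 2) :=
      (Even.pow_abs ⟨p + 1, by ring⟩ x).symm
    have h0 : s ^ k * x ^ (2 * p + 2 - k) ≤ |s| ^ k * |x| ^ (2 * p + 2 - k) := by
      rw [← abs_pow, ← abs_pow, ← abs_mul]
      exact le_abs_self _
    refine h0.trans ?_
    rw [e1, e2, e3]
    have hs := abs_nonneg s
    have hx := abs_nonneg x
    rcases le_total |x| |s| with h | h
    · have : |s| ^ k * |x| ^ (2 * p + 2 - k) ≤ |s| ^ (2 * p) * |x| ^ 2 := by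
        have e : 2 * p + 2 - k = (2 * p - k) + 2 := by omega
        rw [e, pow_add, ← mul_assoc]
        refine mul_le_mul_of_nonneg_right ?_ (by positivity)
        calc |s| ^ k * |x| ^ (2 * p - k) ≤ |s| ^ k * |s| ^ (2 * p - k) := by gcongr
          _ = _ := by rw [← pow_add]; congr 1; omega
      have h2 : 0 ≤ |x| ^ (2 * p + 2) := by positivity
      linarith
    · have : |s| ^ k * |x| ^ (2 * p + 2 - k) ≤ |x| ^ (2 * p + 2) := by
        calc |s| ^ k * |x| ^ (2 * p + 2 - k) ≤ |x| ^ k * |x| ^ (2 * p + 2 - k) := by gcongr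
          _ = _ := by rw [← pow_add]; congr 1; omega
      have h2 : 0 ≤ |s| ^ (2 * p) * |x| ^ 2 := by positivity
      linarith
  have hsum := Finset.sum_le_sum hterm
  rw [← Finset.sum_mul] at hsum
  have hch : ∑ k ∈ Finset.range (2 * p + 1), ((2 * p + 2).choose k : ℝ) ≤ 2 ^ (2 * p + 2) := by
    have := Nat.sum_range_choose (2 * p + 2)
    have h' : ∑ k ∈ Finset.range (2 * p + 1), (2 * p + 2).choose k ≤ 2 ^ (2 * p + 2) := by
      rw [← this]
      exact Finset.sum_le_sum_of_subset (Finset.range_mono (by omega))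
    exact_mod_cast h'
  have hfin := hsum.trans (mul_le_mul_of_nonneg_right hch hA)
  rw [add_pow, Finset.sum_range_succ, Finset.sum_range_succ]
  have e1 : 2 * p + 2 - (2 * p + 1) = 1 := by omega
  rw [e1, Nat.choose_self, Nat.choose_succ_self_right, Nat.sub_self]
  simp only [pow_one, pow_zero, mul_one, Nat.cast_one]
  nlinarith [hfin]

theorem integrable_pow_of_memLp {Ω : Type*} [MeasurableSpace Ω] {P : Measure Ω}
    [IsProbabilityMeasure P] {X : Ω → ℝ} {m k : ℕ} (hX : MemLp X m P) (hk : k ≤ m) :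
    Integrable (fun ω => X ω ^ k) P := by
  have h1 : MemLp X k P := hX.mono_exponent (by exact_mod_cast hk)
  have h2 := h1.integrable_norm_pow'
  refine h2.mono' (h1.1.pow k) (Filter.Eventually.of_forall fun ω => ?_)
  rw [norm_pow]

/-- The exactly kept linear term has mean zero because `Z` is centred and independent of `X`. Hence
adding one summand changes the moment only by terms of second and of top order. -/
theorem integral_add_pow_le {Ω : Type*} [MeasurableSpace Ω] {P : Measure Ω}
    [IsProbabilityMeasure P] {X Z : Ω → ℝ} (p : ℕ) (hXZ : IndepFun X Z P)
    (hX : MemLp X ((2 * p + 2 : ℕ) : ℝ≥0∞) P) (hZ : MemLp Z ((2 * p + 2 : ℕ) : ℝ≥0∞) P)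
    (hZ0 : ∫ ω, Z ω ∂P = 0) :
    ∫ ω, (X ω + Z ω) ^ (2 * p + 2) ∂P ≤ ∫ ω, X ω ^ (2 * p + 2) ∂P
      + 2 ^ (2 * p + 2) * ((∫ ω, X ω ^ (2 * p) ∂P) * (∫ ω, Z ω ^ 2 ∂P)
        + ∫ ω, Z ω ^ (2 * p + 2) ∂P) := by
  have iX := fun k hk => integrable_pow_of_memLp (k := k) hX hk
  have iZ := fun k hk => integrable_pow_of_memLp (k := k) hZ hk
  have hi : ∀ a b : ℕ, IndepFun (fun ω => X ω ^ a) (fun ω => Z ω ^ b) P := fun a b =>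
    hXZ.comp (φ := fun x => x ^ a) (ψ := fun x => x ^ b) (by fun_prop) (by fun_prop)
  have iXZ1 : Integrable (fun ω => X ω ^ (2 * p + 1) * Z ω) P := by
    have := (hi (2 * p + 1) 1).integrable_mul (iX _ (by omega)) (iZ _ (by omega))
    simpa [Pi.mul_def] using this
  have iXZ2 : Integrable (fun ω => X ω ^ (2 * p) * Z ω ^ 2) P :=
    (hi (2 * p) 2).integrable_mul (iX _ (by omega)) (iZ _ (by omega))
  have e1 : ∫ ω, X ω ^ (2 * p + 1) * Z ω ∂P = 0 := by
    have := (hi (2 * p + 1) 1).integral_fun_mul_eq_mul_integral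
      (iX _ (by omega)).1 (iZ _ (by omega)).1
    simp only [pow_one] at this
    rw [this, hZ0, mul_zero]
  have e2 : ∫ ω, X ω ^ (2 * p) * Z ω ^ 2 ∂P = (∫ ω, X ω ^ (2 * p) ∂P) * ∫ ω, Z ω ^ 2 ∂P :=
    (hi (2 * p) 2).integral_fun_mul_eq_mul_integral (iX _ (by omega)).1 (iZ _ (by omega)).1
  have i1 := iX (2 * p + 2) le_rfl
  have i2 := iZ (2 * p + 2) le_rfl
  calc ∫ ω, (X ω + Z ω) ^ (2 * p + 2) ∂P
      ≤ ∫ ω, (X ω ^ (2 * p + 2) + (2 * p + 2 : ℕ) * (X ω ^ (2 * p + 1) * Z ω)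
      + 2 ^ (2 * p + 2) * (X ω ^ (2 * p) * Z ω ^ 2 + Z ω ^ (2 * p + 2))) ∂P :=
        integral_mono (integrable_pow_of_memLp (hX.add hZ) le_rfl)
          ((i1.add (iXZ1.const_mul _)).add ((iXZ2.add i2).const_mul _))
          fun ω => add_pow_le_of_even _ _ _
    _ = _ := by
        have j1 : Integrable (fun ω => X ω ^ (2 * p + 2)
            + (2 * p + 2 : ℕ) * (X ω ^ (2 * p + 1) * Z ω)) P := i1.add (iXZ1.const_mul _)
        have j2 : Integrable (fun ω => (2 : ℝ) ^ (2 * p + 2) *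
            (X ω ^ (2 * p) * Z ω ^ 2 + Z ω ^ (2 * p + 2))) P := (iXZ2.add i2).const_mul _
        rw [integral_add j1 j2, integral_add i1 (iXZ1.const_mul _), integral_const_mul, e1, integral_const_mul,
          integral_add iXZ2 i2, e2]
        ring

/-- Interpolation between moments: with `y = ξ²` and `t` the total variance it absorbs the
intermediate moments that arise in the induction for Rosenthal's inequality. -/
theorem mul_pow_le_pow_succ_add {t y : ℝ} (ht : 0 ≤ t) (hy : 0 ≤ y) {p : ℕ} (hp : 1 ≤ p) :
    t * y ^ p ≤ y ^ (p + 1) + t ^ p * y := by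
  obtain ⟨r, rfl⟩ : ∃ r, p = r + 1 := ⟨p - 1, by omega⟩
  rcases le_total t y with h | h
  · have : t * y ^ (r + 1) ≤ y * y ^ (r + 1) := by gcongr
    have h2 : 0 ≤ t ^ (r + 1) * y := by positivity
    rw [pow_succ' y (r + 1)]
    linarith
  · have : t * (y ^ r * y) ≤ t * (t ^ r * y) := by gcongr
    have h2 : 0 ≤ y ^ (r + 1 + 1) := by positivity
    rw [pow_succ y r, pow_succ' t r]
    linarith

/-- Induction on `p`. Adding the variables one at a time bounds the moment of order `2p + 2` by the
total variance times a bound for the moments of order `2p` of all partial sums, plus the sum of the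
individual moments of order `2p + 2`. -/
theorem exists_rosenthal_real (p : ℕ) : ∃ C : ℝ, 0 ≤ C ∧
    ∀ (Ω : Type u) [MeasurableSpace Ω] (P : Measure Ω) [IsProbabilityMeasure P]
      (ι : Type v) (ξ : ι → Ω → ℝ), iIndepFun ξ P → (∀ i, Measurable (ξ i)) →
      (∀ i, MemLp (ξ i) ((2 * p + 2 : ℕ) : ℝ≥0∞) P) → (∀ i, ∫ ω, ξ i ω ∂P = 0) →
      ∀ T : Finset ι, ∫ ω, (∑ i ∈ T, ξ i ω) ^ (2 * p + 2) ∂P ≤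
        C * ((∑ i ∈ T, ∫ ω, ξ i ω ^ 2 ∂P) ^ (p + 1) + ∑ i ∈ T, ∫ ω, ξ i ω ^ (2 * p + 2) ∂P) := by
  classical
  -- one step of the induction, for a bound `B` on the lower moments of all partial sums
  have step : ∀ (p : ℕ) (Ω : Type u) [MeasurableSpace Ω] (P : Measure Ω) [IsProbabilityMeasure P]
      (ι : Type v) (ξ : ι → Ω → ℝ), iIndepFun ξ P → (∀ i, Measurable (ξ i)) →
      (∀ i, MemLp (ξ i) ((2 * p + 2 : ℕ) : ℝ≥0∞) P) → (∀ i, ∫ ω, ξ i ω ∂P = 0) →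
      ∀ (U : Finset ι) (B : ℝ), (∀ T ⊆ U, ∫ ω, (∑ i ∈ T, ξ i ω) ^ (2 * p) ∂P ≤ B) →
      ∫ ω, (∑ i ∈ U, ξ i ω) ^ (2 * p + 2) ∂P ≤ 2 ^ (2 * p + 2) *
        (B * (∑ i ∈ U, ∫ ω, ξ i ω ^ 2 ∂P) + ∑ i ∈ U, ∫ ω, ξ i ω ^ (2 * p + 2) ∂P) := by
    intro p Ω _ P _ ι ξ hind hm hL h0 U B hB
    suffices ∀ T ⊆ U, ∫ ω, (∑ i ∈ T, ξ i ω) ^ (2 * p + 2) ∂P ≤ 2 ^ (2 * p + 2) *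
        (B * (∑ i ∈ T, ∫ ω, ξ i ω ^ 2 ∂P) + ∑ i ∈ T, ∫ ω, ξ i ω ^ (2 * p + 2) ∂P) from
      this U subset_rfl
    intro T
    induction T using Finset.induction_on with
    | empty => simp
    | insert i T hi ih =>
      intro hTU
      have hT : T ⊆ U := (Finset.subset_insert i T).trans hTU
      have hI : IndepFun (fun ω => ∑ j ∈ T, ξ j ω) (ξ i) P := by
        have := hind.indepFun_finsetSum_of_notMem hm hi
        convert this using 1
        ext ω
        simp
      have h1 := integral_add_pow_le p hI (memLp_finsetSum T fun j _ => hL j) (hL i) (h0 i)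
      have h2 := ih hT
      have h3 := hB T hT
      have h4 : 0 ≤ ∫ ω, ξ i ω ^ 2 ∂P := integral_nonneg fun ω => sq_nonneg _
      have h5 : (∫ ω, (∑ j ∈ T, ξ j ω) ^ (2 * p) ∂P) * (∫ ω, ξ i ω ^ 2 ∂P)
          ≤ B * ∫ ω, ξ i ω ^ 2 ∂P := mul_le_mul_of_nonneg_right h3 h4
      have h6 : (2 : ℝ) ^ (2 * p + 2) * ((∫ ω, (∑ j ∈ T, ξ j ω) ^ (2 * p) ∂P)
          * (∫ ω, ξ i ω ^ 2 ∂P) + ∫ ω, ξ i ω ^ (2 * p + 2) ∂P) ≤ 2 ^ (2 * p + 2) *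
          (B * (∫ ω, ξ i ω ^ 2 ∂P) + ∫ ω, ξ i ω ^ (2 * p + 2) ∂P) := by gcongr
      simp only [Finset.sum_insert hi]
      simp_rw [add_comm (ξ i _) (∑ j ∈ T, ξ j _)]
      calc _ ≤ _ := h1
        _ ≤ _ := add_le_add h2 h6
        _ = _ := by ring
  induction p with
  | zero =>
    refine ⟨4, by norm_num, fun Ω _ P _ ι ξ hind hm hL h0 U => ?_⟩
    have := step 0 Ω P ι ξ hind hm hL h0 U 1 (fun T _ => by simp)
    norm_num at this ⊢
    linarith
  | succ p ih =>
    obtain ⟨C, hC, ih⟩ := ih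
    refine ⟨2 ^ (2 * (p + 1) + 2) * (2 * C + 1), by positivity,
      fun Ω _ P _ ι ξ hind hm hL h0 U => ?_⟩
    have hsq : ∀ i, 0 ≤ ∫ ω, ξ i ω ^ 2 ∂P := fun i => integral_nonneg fun ω => sq_nonneg _
    have heven : ∀ (r : ℕ) (i : ι), 0 ≤ ∫ ω, ξ i ω ^ (2 * r + 2) ∂P := fun r i =>
      integral_nonneg fun ω => Even.pow_nonneg ⟨r + 1, by ring⟩ _
    set t := ∑ i ∈ U, ∫ ω, ξ i ω ^ 2 ∂P with ht
    have ht0 : 0 ≤ t := Finset.sum_nonneg fun i _ => hsq i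
    set b := ∑ i ∈ U, ∫ ω, ξ i ω ^ (2 * p + 2) ∂P with hb
    set b' := ∑ i ∈ U, ∫ ω, ξ i ω ^ (2 * (p + 1) + 2) ∂P with hb'
    have hb'0 : 0 ≤ b' := Finset.sum_nonneg fun i _ => heven _ i
    have hstep := step (p + 1) Ω P ι ξ hind hm hL h0 U (C * (t ^ (p + 1) + b)) (by
      intro T hT
      refine (ih Ω P ι ξ hind hm (fun i => (hL i).mono_exponent ?_) h0 T).trans ?_
      · exact_mod_cast (by omega : 2 * p + 2 ≤ 2 * (p + 1) + 2)
      refine mul_le_mul_of_nonneg_left (add_le_add ?_ ?_) hC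
      · exact pow_le_pow_left₀ (Finset.sum_nonneg fun i _ => hsq i)
          (Finset.sum_le_sum_of_subset_of_nonneg hT fun i _ _ => hsq i) _
      · exact Finset.sum_le_sum_of_subset_of_nonneg hT fun i _ _ => heven _ i)
    -- The induction hypothesis leaves the product of the variance `t` with the sum `b` of
    -- intermediate moments, a quantity absent from the claim. It is interpolated termwise between
    -- second and top moments.
    have hinter : t * b ≤ b' + t ^ (p + 2) := by
      rw [hb, Finset.mul_sum]
      have : ∀ i ∈ U, t * ∫ ω, ξ i ω ^ (2 * p + 2) ∂P
          ≤ (∫ ω, ξ i ω ^ (2 * (p + 1) + 2) ∂P) + t ^ (p + 1) * ∫ ω, ξ i ω ^ 2 ∂P := by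
        intro i _
        have i1 := integrable_pow_of_memLp (k := 2 * p + 2) (hL i) (by omega)
        have i2 := integrable_pow_of_memLp (k := 2 * (p + 1) + 2) (hL i) (by omega)
        have i3 := integrable_pow_of_memLp (k := 2) (hL i) (by omega)
        rw [← integral_const_mul, ← integral_const_mul,
          ← integral_add i2 (i3.const_mul _)]
        refine integral_mono (i1.const_mul _) (i2.add (i3.const_mul _)) fun ω => ?_
        have := mul_pow_le_pow_succ_add ht0 (sq_nonneg (ξ i ω)) (p := p + 1) (by omega)
        simp only [← pow_mul] at this
        exact this
      refine (Finset.sum_le_sum this).trans ?_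
      rw [Finset.sum_add_distrib, ← Finset.mul_sum, ← ht, ← hb']
      exact le_of_eq (by ring)
    refine hstep.trans ?_
    rw [← ht, ← hb', mul_assoc (2 ^ _) (2 * C + 1) _]
    have hc : (0 : ℝ) ≤ 2 ^ (2 * (p + 1) + 2) := by positivity
    refine mul_le_mul_of_nonneg_left ?_ hc
    have h7 : 0 ≤ t ^ (p + 2) := by positivity
    have h8 : C * (t * b) ≤ C * (b' + t ^ (p + 2)) := mul_le_mul_of_nonneg_left hinter hC
    have h9 : C * (t ^ (p + 1) + b) * t = C * t ^ (p + 2) + C * (t * b) := by ring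
    rw [h9]
    have h10 : 0 ≤ C * b' := by positivity
    nlinarith

/-! ### Moments of centred empirical sums -/

theorem ennreal_add_pow_le (a b : ℝ≥0∞) (n : ℕ) : (a + b) ^ n ≤ 2 ^ n * (a ^ n + b ^ n) := by
  calc (a + b) ^ n ≤ (2 * max a b) ^ n := by
        gcongr
        rw [two_mul]
        exact add_le_add (le_max_left _ _) (le_max_right _ _)
    _ = 2 ^ n * max a b ^ n := mul_pow _ _ _
    _ ≤ _ := by
        gcongr
        rcases max_choice a b with h | h <;> rw [h]
        · exact le_self_add
        · exact le_add_self

/-- Jensen's inequality for the power function and the finite measure `w μ`. -/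
theorem lintegral_mul_pow_le {α : Type*} [MeasurableSpace α] {μ : Measure α} {w f : α → ℝ≥0∞}
    (hw : AEMeasurable w μ) (hf : AEMeasurable f μ) {p : ℕ} (hp : 1 ≤ p) :
    (∫⁻ a, w a * f a ∂μ) ^ p ≤ (∫⁻ a, w a ∂μ) ^ (p - 1) * ∫⁻ a, w a * f a ^ p ∂μ := by
  have hp0 : (p : ℝ) ≠ 0 := by positivity
  have hp1 : (1 : ℝ) ≤ p := by exact_mod_cast hp
  have hinv : (0 : ℝ) ≤ (p : ℝ)⁻¹ := by positivity
  have hinv1 : (p : ℝ)⁻¹ ≤ 1 := inv_le_one_of_one_le₀ hp1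
  have h := ENNReal.lintegral_mul_norm_pow_le (μ := μ) (f := fun a => w a * f a ^ p)
    (g := w) (hw.mul (hf.pow_const p)) hw hinv (sub_nonneg.2 hinv1) (by ring)
  have e : ∀ a, (w a * f a ^ p) ^ (p : ℝ)⁻¹ * w a ^ (1 - (p : ℝ)⁻¹) = w a * f a := by
    intro a
    rw [ENNReal.mul_rpow_of_nonneg _ _ hinv, ENNReal.pow_rpow_inv_natCast (by omega),
      mul_right_comm, ← ENNReal.rpow_add_of_nonneg _ _ hinv (sub_nonneg.2 hinv1)]
    simp
  simp_rw [e] at h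
  calc _ ≤ _ := pow_le_pow_left₀ zero_le h p
    _ = _ := by
      rw [mul_pow, ENNReal.rpow_inv_natCast_pow (by omega), ← ENNReal.rpow_natCast,
        ← ENNReal.rpow_mul, mul_comm]
      congr 1
      rw [← ENNReal.rpow_natCast, Nat.cast_sub hp]
      congr 1
      field_simp
      simp

theorem lintegral_pow_le {α : Type*} [MeasurableSpace α] {μ : Measure α} [IsProbabilityMeasure μ]
    {f : α → ℝ≥0∞} (hf : AEMeasurable f μ) {p : ℕ} (hp : 1 ≤ p) :
    (∫⁻ a, f a ∂μ) ^ p ≤ ∫⁻ a, f a ^ p ∂μ := by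
  have := lintegral_mul_pow_le (w := fun _ => 1) (μ := μ) aemeasurable_const hf hp
  simpa using this

theorem enorm_pow_even (x : ℝ) (k : ℕ) : ‖x‖ₑ ^ (2 * k) = ENNReal.ofReal (x ^ (2 * k)) := by
  rw [← (even_two_mul k).pow_abs, ENNReal.ofReal_pow (abs_nonneg x), Real.enorm_eq_ofReal_abs]

theorem lintegral_enorm_pow_even {Ω : Type*} [MeasurableSpace Ω] {P : Measure Ω} {X : Ω → ℝ}
    {k : ℕ} (hX : Integrable (fun ω => X ω ^ (2 * k)) P) :
    ∫⁻ ω, ‖X ω‖ₑ ^ (2 * k) ∂P = ENNReal.ofReal (∫ ω, X ω ^ (2 * k) ∂P) := by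
  rw [ofReal_integral_eq_lintegral_ofReal hX
    (Filter.Eventually.of_forall fun ω => (even_two_mul k).pow_nonneg _)]
  exact lintegral_congr fun ω => enorm_pow_even _ _

theorem exists_rosenthal_sample_real (r : ℕ) : ∃ C : ℝ≥0∞, C ≠ ∞ ∧
    ∀ (Ω : Type u) [MeasurableSpace Ω] (P : Measure Ω) [IsProbabilityMeasure P]
      (E : Type v) [MeasurableSpace E] (ν : Measure E) (n : ℕ) (Y : Fin n → Ω → E),
      iIndepFun Y P → (∀ j, Measurable (Y j)) → (∀ j, P.map (Y j) = ν) →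
      ∀ g : E → ℝ, Measurable g → MemLp g ((2 * r + 2 : ℕ) : ℝ≥0∞) ν → ∫ y, g y ∂ν = 0 →
        ∫⁻ ω, ‖∑ j, g (Y j ω)‖ₑ ^ (2 * (r + 1)) ∂P ≤
          C * ((n * ∫⁻ y, ‖g y‖ₑ ^ 2 ∂ν) ^ (r + 1) + n * ∫⁻ y, ‖g y‖ₑ ^ (2 * (r + 1)) ∂ν) := by
  obtain ⟨C, hC, h⟩ := exists_rosenthal_real.{u, 0} r
  refine ⟨ENNReal.ofReal C, ENNReal.ofReal_ne_top, fun Ω _ P _ E _ ν n Y hind hm hlaw g hg hgL hg0 => ?_⟩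
  have hLj : ∀ j, MemLp (fun ω => g (Y j ω)) ((2 * r + 2 : ℕ) : ℝ≥0∞) P := fun j => by
    rw [← hlaw j] at hgL
    exact hgL.comp_of_map (hm j).aemeasurable
  have hint : ∀ (f : E → ℝ) (hf : Measurable f) j, ∫ ω, f (Y j ω) ∂P = ∫ y, f y ∂ν :=
    fun f hf j => by
      rw [← hlaw j, integral_map (hm j).aemeasurable hf.aestronglyMeasurable]
  have hlint : ∀ (f : E → ℝ≥0∞) (hf : Measurable f) j,
      ∫⁻ ω, f (Y j ω) ∂P = ∫⁻ y, f y ∂ν := fun f hf j => by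
    rw [← hlaw j, lintegral_map hf (hm j)]
  have key := h Ω P (Fin n) (fun j ω => g (Y j ω)) (hind.comp (fun _ => g) fun _ => hg)
    (fun j => hg.comp (hm j)) hLj (fun j => by rw [hint g hg, hg0]) Finset.univ
  have hSL : MemLp (fun ω => ∑ j, g (Y j ω)) ((2 * r + 2 : ℕ) : ℝ≥0∞) P :=
    memLp_finsetSum _ fun j _ => hLj j
  rw [lintegral_enorm_pow_even (k := r + 1) (integrable_pow_of_memLp hSL le_rfl)]
  refine (ENNReal.ofReal_le_ofReal key).trans ?_
  have hsq : ∀ j, 0 ≤ ∫ ω, g (Y j ω) ^ 2 ∂P := fun i => integral_nonneg fun ω => sq_nonneg _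
  have heven : ∀ j, 0 ≤ ∫ ω, g (Y j ω) ^ (2 * r + 2) ∂P := fun i =>
    integral_nonneg fun ω => Even.pow_nonneg ⟨r + 1, by ring⟩ _
  rw [ENNReal.ofReal_mul hC, ENNReal.ofReal_add (pow_nonneg (Finset.sum_nonneg fun j _ => hsq j) _)
    (Finset.sum_nonneg fun j _ => heven j), ENNReal.ofReal_pow (Finset.sum_nonneg fun j _ => hsq j),
    ENNReal.ofReal_sum_of_nonneg fun j _ => hsq j, ENNReal.ofReal_sum_of_nonneg fun j _ => heven j]
  have e1 : ∀ j, ENNReal.ofReal (∫ ω, g (Y j ω) ^ 2 ∂P) = ∫⁻ y, ‖g y‖ₑ ^ 2 ∂ν := fun j => by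
    rw [← hlint _ (by fun_prop) j]
    exact (lintegral_enorm_pow_even (k := 1) (integrable_pow_of_memLp (hLj j) (by omega))).symm
  have e2 : ∀ j, ENNReal.ofReal (∫ ω, g (Y j ω) ^ (2 * r + 2) ∂P)
      = ∫⁻ y, ‖g y‖ₑ ^ (2 * (r + 1)) ∂ν := fun j => by
    rw [← hlint _ (by fun_prop) j]
    exact (lintegral_enorm_pow_even (k := r + 1) (integrable_pow_of_memLp (hLj j) le_rfl)).symm
  simp only [e1, e2]
  simp

/-- By Jensen the mean is no larger than the moment, so centring costs a constant factor only. This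
allows all later bounds to use moments of the uncentred function. -/
theorem lintegral_enorm_sub_integral_pow_le {E : Type*} [MeasurableSpace E] {ν : Measure E}
    [IsProbabilityMeasure ν] {F : E → ℂ} (hF : Measurable F) {k : ℕ} (hk : 1 ≤ k) :
    ∫⁻ y, ‖F y - ∫ z, F z ∂ν‖ₑ ^ k ∂ν ≤ 2 ^ (k + 1) * ∫⁻ y, ‖F y‖ₑ ^ k ∂ν := by
  have hm : ‖∫ z, F z ∂ν‖ₑ ^ k ≤ ∫⁻ y, ‖F y‖ₑ ^ k ∂ν :=
    (pow_le_pow_left₀ zero_le (enorm_integral_le_lintegral_enorm F) k).trans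
      (lintegral_pow_le hF.enorm.aemeasurable hk)
  calc ∫⁻ y, ‖F y - ∫ z, F z ∂ν‖ₑ ^ k ∂ν
      ≤ ∫⁻ y, 2 ^ k * (‖F y‖ₑ ^ k + ‖∫ z, F z ∂ν‖ₑ ^ k) ∂ν := by
        refine lintegral_mono fun y => ?_
        exact (pow_le_pow_left₀ zero_le (enorm_sub_le (a := F y)) k).trans
          (ennreal_add_pow_le _ _ _)
    _ = 2 ^ k * ((∫⁻ y, ‖F y‖ₑ ^ k ∂ν) + ‖∫ z, F z ∂ν‖ₑ ^ k) := by
        rw [lintegral_const_mul _ (by fun_prop), lintegral_add_left (by fun_prop)]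
        simp
    _ ≤ 2 ^ k * ((∫⁻ y, ‖F y‖ₑ ^ k ∂ν) + ∫⁻ y, ‖F y‖ₑ ^ k ∂ν) := by gcongr
    _ = _ := by rw [← two_mul]; ring

/-- The real inequality is applied to the real and the imaginary part of the centred function; the
constants `8` and `2^(2(r+1)+1)` are the cost of undoing the centring in the second and in the top
moment. -/
theorem exists_rosenthal_sample (p : ℕ) (hp : 1 ≤ p) : ∃ C : ℝ≥0∞, C ≠ ∞ ∧
    ∀ (Ω : Type u) [MeasurableSpace Ω] (P : Measure Ω) [IsProbabilityMeasure P]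
      (E : Type v) [MeasurableSpace E] (ν : Measure E) [IsProbabilityMeasure ν]
      (n : ℕ) (Y : Fin n → Ω → E),
      iIndepFun Y P → (∀ j, Measurable (Y j)) → (∀ j, P.map (Y j) = ν) →
      ∀ F : E → ℂ, Measurable F → MemLp F ((2 * p : ℕ) : ℝ≥0∞) ν →
        ∫⁻ ω, ‖∑ j, (F (Y j ω) - ∫ y, F y ∂ν)‖ₑ ^ (2 * p) ∂P ≤
          C * ((n * ∫⁻ y, ‖F y‖ₑ ^ 2 ∂ν) ^ p + n * ∫⁻ y, ‖F y‖ₑ ^ (2 * p) ∂ν) := by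
  obtain ⟨r, rfl⟩ : ∃ r, p = r + 1 := ⟨p - 1, by omega⟩
  obtain ⟨C, hC, h⟩ := exists_rosenthal_sample_real.{u, v} r
  refine ⟨2 ^ (2 * (r + 1)) * (2 * (C * (8 ^ (r + 1) + 2 ^ (2 * (r + 1) + 1)))), by finiteness,
    fun Ω _ P _ E _ ν _ n Y hind hm hlaw F hF hFL => ?_⟩
  set m := ∫ y, F y ∂ν with hmdef
  have hFi : Integrable F ν := hFL.integrable (by exact_mod_cast (by omega : 1 ≤ 2 * (r + 1)))
  have hGL : MemLp (fun y => F y - m) ((2 * r + 2 : ℕ) : ℝ≥0∞) ν := hFL.sub (memLp_const m)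
  have h0 : ∫ y, (F y - m) ∂ν = 0 := by
    rw [integral_sub hFi (integrable_const _)]; simp [hmdef]
  have hbound : ∀ g : E → ℝ, Measurable g → MemLp g ((2 * r + 2 : ℕ) : ℝ≥0∞) ν →
      ∫ y, g y ∂ν = 0 → (∀ y, ‖g y‖ₑ ≤ ‖F y - m‖ₑ) →
      ∫⁻ ω, ‖∑ j, g (Y j ω)‖ₑ ^ (2 * (r + 1)) ∂P ≤ C * (8 ^ (r + 1) + 2 ^ (2 * (r + 1) + 1)) *
        ((n * ∫⁻ y, ‖F y‖ₑ ^ 2 ∂ν) ^ (r + 1) + n * ∫⁻ y, ‖F y‖ₑ ^ (2 * (r + 1)) ∂ν) := by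
    intro g hg hgL hg0 hgF
    refine (h Ω P E ν n Y hind hm hlaw g hg hgL hg0).trans ?_
    have hk : ∀ k, 1 ≤ k → ∫⁻ y, ‖g y‖ₑ ^ k ∂ν ≤ 2 ^ (k + 1) * ∫⁻ y, ‖F y‖ₑ ^ k ∂ν := fun k hk =>
      (lintegral_mono fun y => pow_le_pow_left₀ zero_le (hgF y) k).trans
        (lintegral_enorm_sub_integral_pow_le hF hk)
    rw [mul_assoc]
    gcongr
    calc _ ≤ (n * (2 ^ (2 + 1) * ∫⁻ y, ‖F y‖ₑ ^ 2 ∂ν)) ^ (r + 1)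
          + n * (2 ^ (2 * (r + 1) + 1) * ∫⁻ y, ‖F y‖ₑ ^ (2 * (r + 1)) ∂ν) := by
          gcongr
          · exact hk 2 (by norm_num)
          · exact hk _ (by omega)
      _ = 8 ^ (r + 1) * (n * ∫⁻ y, ‖F y‖ₑ ^ 2 ∂ν) ^ (r + 1)
          + 2 ^ (2 * (r + 1) + 1) * (n * ∫⁻ y, ‖F y‖ₑ ^ (2 * (r + 1)) ∂ν) := by
          rw [← mul_pow]
          congr 1
          · congr 1
            norm_num
            ring
          · ring
      _ ≤ _ := by
          rw [add_mul]
          gcongr ?_ + ?_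
          · gcongr; exact le_self_add
          · gcongr; exact le_add_self
  have hre := hbound (fun y => (F y - m).re) (by fun_prop) hGL.re
    (by
      have := integral_re (f := fun y => F y - m) (μ := ν) (hFi.sub (integrable_const _))
      simp only [RCLike.re_to_complex] at this
      rw [this, h0]; rfl)
    (fun y => by
      rw [← ofReal_norm, ← ofReal_norm]
      exact ENNReal.ofReal_le_ofReal (Complex.abs_re_le_norm _))
  have him := hbound (fun y => (F y - m).im) (by fun_prop) hGL.im
    (by
      have := integral_im (f := fun y => F y - m) (μ := ν) (hFi.sub (integrable_const _))
      simp only [RCLike.im_to_complex] at this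
      rw [this, h0]; rfl)
    (fun y => by
      rw [← ofReal_norm, ← ofReal_norm]
      exact ENNReal.ofReal_le_ofReal (Complex.abs_im_le_norm _))
  have hpt : ∀ z : ℂ, ‖z‖ₑ ^ (2 * (r + 1)) ≤
      2 ^ (2 * (r + 1)) * (‖z.re‖ₑ ^ (2 * (r + 1)) + ‖z.im‖ₑ ^ (2 * (r + 1))) := by
    intro z
    refine (pow_le_pow_left₀ zero_le ?_ _).trans (ennreal_add_pow_le _ _ _)
    rw [← ofReal_norm, ← ofReal_norm, ← ofReal_norm, ← ENNReal.ofReal_add (norm_nonneg _)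
      (norm_nonneg _)]
    exact ENNReal.ofReal_le_ofReal (Complex.norm_le_abs_re_add_abs_im z)
  have hmeas : ∀ j, Measurable fun ω => F (Y j ω) := fun j => hF.comp (hm j)
  calc _ ≤ ∫⁻ ω, 2 ^ (2 * (r + 1)) * (‖∑ j, (F (Y j ω) - m).re‖ₑ ^ (2 * (r + 1))
        + ‖∑ j, (F (Y j ω) - m).im‖ₑ ^ (2 * (r + 1))) ∂P := by
        refine lintegral_mono fun ω => ?_
        refine (hpt _).trans (le_of_eq ?_)
        rw [Complex.re_sum, Complex.im_sum]
    _ = 2 ^ (2 * (r + 1)) * ((∫⁻ ω, ‖∑ j, (F (Y j ω) - m).re‖ₑ ^ (2 * (r + 1)) ∂P)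
        + ∫⁻ ω, ‖∑ j, (F (Y j ω) - m).im‖ₑ ^ (2 * (r + 1)) ∂P) := by
        rw [lintegral_const_mul _ (by fun_prop), lintegral_add_left (by fun_prop)]
    _ ≤ _ := by
        rw [mul_assoc, mul_assoc]
        gcongr
        exact (add_le_add hre him).trans_eq (two_mul _).symm

/-! ### The law of a repeated measurement -/

section Law

variable {μX με : Measure ℝ} [IsProbabilityMeasure μX] [IsProbabilityMeasure με]

instance isProbabilityMeasure_lawY : IsProbabilityMeasure (lawY μX με) := by
  unfold lawY
  exact Measure.isProbabilityMeasure_map (by fun_prop)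

theorem integral_lawY {F : ℝ × ℝ → ℂ} (hF : Continuous F) :
    ∫ y, F y ∂(lawY μX με)
      = ∫ p, F (p.1 + p.2.1, p.1 + p.2.2) ∂(μX.prod (με.prod με)) := by
  rw [lawY, integral_map (by fun_prop) hF.aestronglyMeasurable]

theorem integral_prod_prod_mul (f g k : ℝ → ℂ) :
    ∫ p, f p.1 * (g p.2.1 * k p.2.2) ∂(μX.prod (με.prod με))
      = (∫ x, f x ∂μX) * ((∫ x, g x ∂με) * ∫ x, k x ∂με) := by
  rw [← integral_prod_mul g k, ← integral_prod_mul]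

theorem integrable_prod_prod_mul {f g k : ℝ → ℂ} (hf : Integrable f μX) (hg : Integrable g με)
    (hk : Integrable k με) :
    Integrable (fun p : ℝ × ℝ × ℝ => f p.1 * (g p.2.1 * k p.2.2)) (μX.prod (με.prod με)) :=
  hf.mul_prod (hg.mul_prod hk)

theorem psi_eq (u₁ u₂ : ℝ) :
    psi μX με u₁ u₂ = charFun μX (u₁ + u₂) * (charFun με u₁ * charFun με u₂) := by
  rw [psi, integral_lawY (by fun_prop)]
  simp only [charFun_apply_real]
  rw [← integral_prod_prod_mul]
  refine integral_congr_ae (Filter.Eventually.of_forall fun p => ?_)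
  simp only [← Complex.exp_add]
  congr 1
  push_cast
  ring

theorem phiY_eq (z : ℝ) : phiY μX με z = charFun μX z * charFun με z := by
  rw [phiY, psi_eq]
  simp

theorem integrable_exp_ofReal_mul_I {μ : Measure ℝ} [IsFiniteMeasure μ] (u : ℝ) :
    Integrable (fun x : ℝ => exp (u * x * I)) μ := by
  refine (integrable_const (1 : ℝ)).mono' (by fun_prop) (Filter.Eventually.of_forall fun x => ?_)
  rw [← ofReal_mul, norm_exp_ofReal_mul_I]

theorem integrable_mul_exp_ofReal_mul_I {μ : Measure ℝ} [IsFiniteMeasure μ] {f : ℝ → ℂ}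
    (hf : Integrable f μ) (u : ℝ) : Integrable (fun x : ℝ => f x * exp (u * x * I)) μ := by
  refine hf.norm.mono' (hf.1.mul (by fun_prop)) (Filter.Eventually.of_forall fun x => ?_)
  rw [norm_mul, ← ofReal_mul, norm_exp_ofReal_mul_I, mul_one]

theorem hasDerivAt_charFun {μ : Measure ℝ} [IsFiniteMeasure μ] (hμ : MemLp id 2 μ) (u : ℝ) :
    HasDerivAt (charFun μ) (I * ∫ x : ℝ, x * exp (u * x * I) ∂μ) u := by
  have h1 : MemLp id ((1 : ℕ) : ℝ≥0∞) μ := hμ.mono_exponent (by norm_num)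
  have hd : Differentiable ℝ (charFun μ) := (contDiff_charFun h1).differentiable (by norm_num)
  have := (hd u).hasDerivAt
  rw [← iteratedDeriv_one, iteratedDeriv_charFun h1] at this
  simpa using this

theorem continuous_deriv_charFun {μ : Measure ℝ} [IsFiniteMeasure μ] (hμ : MemLp id 2 μ) :
    Continuous (deriv (charFun μ)) :=
  (contDiff_charFun (n := 1) (hμ.mono_exponent (by norm_num))).continuous_deriv (by norm_num)

theorem integrable_ofReal_of_memLp {μ : Measure ℝ} [IsFiniteMeasure μ] (hμ : MemLp id 2 μ) :
    Integrable (fun x : ℝ => (x : ℂ)) μ :=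
  (hμ.integrable (by norm_num)).ofReal

theorem integrable_ofReal_sq_of_memLp {μ : Measure ℝ} [IsFiniteMeasure μ] (hμ : MemLp id 2 μ) :
    Integrable (fun x : ℝ => (x : ℂ) ^ 2) μ := by
  have : Integrable (fun x : ℝ => x ^ 2) μ := hμ.integrable_sq
  simpa using this.ofReal (𝕜 := ℂ)

/-- The partial derivative `∂₁ψ(0, u)`, as an expectation. -/
theorem integral_fst_mul_exp_lawY (hX : MemLp id 2 μX) (hε : MemLp id 2 με)
    (h0 : ∫ e, e ∂με = 0) (u : ℝ) :
    ∫ y, I * y.1 * exp (I * ((0 : ℝ) * y.1 + u * y.2)) ∂(lawY μX με)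
      = deriv (charFun μX) u * charFun με u := by
  rw [integral_lawY (by fun_prop), (hasDerivAt_charFun hX u).deriv, charFun_apply_real]
  -- Splitting `X + ε₁` makes both summands products over the three independent variables; the one
  -- with `ε₁` integrates to zero.
  have e : ∀ p : ℝ × ℝ × ℝ, I * ((p.1 + p.2.1 : ℝ) : ℂ)
        * exp (I * ((0 : ℝ) * (p.1 + p.2.1 : ℝ) + u * (p.1 + p.2.2 : ℝ)))
      = (I * (p.1 * exp (u * p.1 * I))) * (1 * exp (u * p.2.2 * I))
        + exp (u * p.1 * I) * ((I * p.2.1) * exp (u * p.2.2 * I)) := by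
    intro p
    have : exp (I * ((0 : ℝ) * (p.1 + p.2.1 : ℝ) + u * (p.1 + p.2.2 : ℝ)))
        = exp (u * p.1 * I) * exp (u * p.2.2 * I) := by
      rw [← Complex.exp_add]; congr 1; push_cast; ring
    rw [this]
    push_cast
    ring
  simp_rw [e]
  have i1 := integrable_ofReal_of_memLp hX
  have i2 := integrable_ofReal_of_memLp hε
  rw [integral_add
    (integrable_prod_prod_mul (f := fun x : ℝ => I * (x * exp (u * x * I))) (g := fun _ => 1)
      (k := fun x : ℝ => exp (u * x * I))
      ((integrable_mul_exp_ofReal_mul_I i1 u).const_mul I) (integrable_const _)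
      (integrable_exp_ofReal_mul_I u))
    (integrable_prod_prod_mul (f := fun x : ℝ => exp (u * x * I)) (g := fun x : ℝ => I * x)
      (k := fun x : ℝ => exp (u * x * I))
      (integrable_exp_ofReal_mul_I u) (i2.const_mul I) (integrable_exp_ofReal_mul_I u)),
    integral_prod_prod_mul (fun x : ℝ => I * (x * exp (u * x * I))) (fun _ => 1)
      (fun x : ℝ => exp (u * x * I)),
    integral_prod_prod_mul (fun x : ℝ => exp (u * x * I)) (fun x : ℝ => I * x)
      (fun x : ℝ => exp (u * x * I)), integral_const_mul, integral_const_mul,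
    integral_complex_ofReal, h0]
  simp

/-- Expand `(X + ε₁)²`: `X²` produces the second derivative of `φ_X`, the cross term vanishes
because `ε₁` is centred, and `ε₁²` contributes its variance. -/
theorem integral_fst_sq_mul_exp_lawY (hX : MemLp id 2 μX) (hε : MemLp id 2 με)
    (h0 : ∫ e, e ∂με = 0) (u : ℝ) :
    ∫ y, (y.1 : ℂ) ^ 2 * exp (I * (u * y.2)) ∂(lawY μX με)
      = -(iteratedDeriv 2 (charFun μX) u * charFun με u)
        + (∫ e, e ^ 2 ∂με : ℝ) * (charFun μX u * charFun με u) := by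
  rw [integral_lawY (by fun_prop), iteratedDeriv_charFun (by exact_mod_cast hX),
    charFun_apply_real, charFun_apply_real]
  have e : ∀ p : ℝ × ℝ × ℝ, ((p.1 + p.2.1 : ℝ) : ℂ) ^ 2 * exp (I * (u * (p.1 + p.2.2 : ℝ)))
      = (p.1 ^ 2 * exp (u * p.1 * I)) * (1 * exp (u * p.2.2 * I))
        + (p.1 * exp (u * p.1 * I)) * ((2 * p.2.1) * exp (u * p.2.2 * I))
        + exp (u * p.1 * I) * (p.2.1 ^ 2 * exp (u * p.2.2 * I)) := by
    intro p
    have : exp (I * (u * (p.1 + p.2.2 : ℝ)))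
        = exp (u * p.1 * I) * exp (u * p.2.2 * I) := by
      rw [← Complex.exp_add]; congr 1; push_cast; ring
    rw [this]
    push_cast
    ring
  simp_rw [e]
  have i1 := integrable_ofReal_of_memLp hX
  have i2 := integrable_ofReal_of_memLp hε
  have i3 := integrable_ofReal_sq_of_memLp hX
  have i4 := integrable_ofReal_sq_of_memLp hε
  have j1 := integrable_prod_prod_mul (f := fun x : ℝ => x ^ 2 * exp (u * x * I))
      (g := fun _ => 1) (k := fun x : ℝ => exp (u * x * I))
      (integrable_mul_exp_ofReal_mul_I i3 u) (integrable_const (μ := με) _)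
      (integrable_exp_ofReal_mul_I u)
  have j2 := integrable_prod_prod_mul (f := fun x : ℝ => x * exp (u * x * I))
      (g := fun x : ℝ => 2 * x) (k := fun x : ℝ => exp (u * x * I))
      (integrable_mul_exp_ofReal_mul_I i1 u) (i2.const_mul 2)
      (integrable_exp_ofReal_mul_I u)
  have j3 := integrable_prod_prod_mul (f := fun x : ℝ => exp (u * x * I))
      (g := fun x : ℝ => x ^ 2) (k := fun x : ℝ => exp (u * x * I))
      (integrable_exp_ofReal_mul_I (μ := μX) u) i4 (integrable_exp_ofReal_mul_I u)
  rw [integral_add (by exact j1.add j2) j3, integral_add j1 j2,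
    integral_prod_prod_mul (fun x : ℝ => x ^ 2 * exp (u * x * I)) (fun _ => 1)
      (fun x : ℝ => exp (u * x * I)),
    integral_prod_prod_mul (fun x : ℝ => x * exp (u * x * I)) (fun x : ℝ => 2 * x)
      (fun x : ℝ => exp (u * x * I)),
    integral_prod_prod_mul (fun x : ℝ => exp (u * x * I)) (fun x : ℝ => x ^ 2)
      (fun x : ℝ => exp (u * x * I)), integral_const_mul,
    integral_complex_ofReal, h0, ← integral_complex_ofReal]
  simp
  ring

/-- The factor of `ψ` coming from `ε₁` has derivative `i E ε = 0` at the origin, and the one coming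
from `ε₂` does not depend on `u₁`. This identifiability relation is what the estimator is built on.
-/
theorem logDeriv_psi_eq (hX : MemLp id 2 μX) (hε : MemLp id 2 με) (h0 : ∫ e, e ∂με = 0)
    (x : ℝ) (hne : charFun με x ≠ 0) :
    logDeriv (fun u₁ : ℝ => psi μX με u₁ x) 0 = deriv (charFun μX) x / charFun μX x := by
  have h1 : HasDerivAt (fun u₁ : ℝ => charFun μX (u₁ + x)) (deriv (charFun μX) x) 0 := by
    have := (hasDerivAt_charFun hX (0 + x)).comp_add_const 0 x
    rw [← (hasDerivAt_charFun hX (0 + x)).deriv, zero_add] at this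
    exact this
  have h2 : HasDerivAt (charFun με) 0 0 := by
    have := hasDerivAt_charFun hε 0
    have e : ∫ x : ℝ, (x : ℂ) ∂με = 0 := by rw [integral_complex_ofReal, h0, ofReal_zero]
    simpa [e] using this
  have h3 : HasDerivAt (fun u₁ : ℝ => psi μX με u₁ x) (deriv (charFun μX) x * charFun με x) 0 := by
    have := h1.mul (h2.mul_const (charFun με x))
    refine (this.congr_deriv (by simp)).congr_of_eventuallyEq
      (Filter.Eventually.of_forall fun u => ?_)
    simp [psi_eq]
  rw [logDeriv_apply, h3.deriv, psi_eq]
  simp only [zero_add, charFun_zero, probReal_univ, ofReal_one, one_mul]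
  rw [mul_div_mul_right _ _ hne]

theorem momentY_eq (m : ℕ) :
    momentY μX με m = ∫⁻ x, ∫⁻ e, ‖x + e‖ₑ ^ m ∂με ∂μX := by
  rw [momentY, lawY, lintegral_map (by fun_prop) (by fun_prop), lintegral_prod _ (by fun_prop)]
  refine lintegral_congr fun x => ?_
  rw [lintegral_prod _ (by fun_prop)]
  simp

theorem momentY_eq_snd (m : ℕ) :
    ∫⁻ y, ‖y.2‖ₑ ^ m ∂(lawY μX με) = momentY μX με m := by
  rw [momentY_eq, lawY, lintegral_map (by fun_prop) (by fun_prop), lintegral_prod _ (by fun_prop)]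
  refine lintegral_congr fun x => ?_
  rw [lintegral_prod _ (by fun_prop)]
  simp

theorem memLp_of_lintegral_enorm_pow_lt_top {α : Type*} [MeasurableSpace α] {μ : Measure α}
    {E : Type*} [NormedAddCommGroup E] {f : α → E}
    (hf : AEStronglyMeasurable f μ) {m : ℕ} (hm : m ≠ 0) (h : ∫⁻ x, ‖f x‖ₑ ^ m ∂μ < ∞) :
    MemLp f m μ := by
  refine ⟨hf, ?_⟩
  rw [eLpNorm_lt_top_iff_lintegral_rpow_enorm_lt_top (by exact_mod_cast hm) (by simp)]
  simpa using h

theorem memLp_fst_lawY {m : ℕ} (hm : m ≠ 0) (h : momentY μX με m < ∞) :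
    MemLp (fun y : ℝ × ℝ => y.1) m (lawY μX με) :=
  memLp_of_lintegral_enorm_pow_lt_top (by fun_prop) hm h

theorem memLp_of_memLp_add_const {μ : Measure ℝ} [IsProbabilityMeasure μ] {m : ℕ} (c : ℝ)
    (h : MemLp (fun x => x + c) m μ) : MemLp id m μ := by
  have := h.sub (memLp_const c)
  refine this.ae_eq (Filter.Eventually.of_forall fun x => by simp)

/-- By Tonelli some translate of `X` by a fixed value of `ε`, and some translate of `ε` by a fixed
value of `X`, already has the moment. -/
theorem memLp_id_of_momentY_lt_top {m : ℕ} (hm : m ≠ 0) (h : momentY μX με m < ∞) :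
    MemLp id m μX ∧ MemLp id m με := by
  rw [momentY_eq] at h
  constructor
  · rw [lintegral_lintegral_swap (by fun_prop)] at h
    obtain ⟨e, he⟩ := (ae_lt_top (by fun_prop) h.ne).exists
    exact memLp_of_memLp_add_const e
      (memLp_of_lintegral_enorm_pow_lt_top (by fun_prop) hm he)
  · obtain ⟨x, hx⟩ := (ae_lt_top (by fun_prop) h.ne).exists
    refine memLp_of_memLp_add_const x
      (memLp_of_lintegral_enorm_pow_lt_top (by fun_prop) hm ?_)
    simpa [add_comm] using hx

end Law

/-! ### Moments of the empirical characteristic function and its derivative -/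

/-- Centred, square integrable variables with nowhere vanishing characteristic functions. -/
structure RegularModel (μX με : Measure ℝ) : Prop where
  memLp_X : MemLp id 2 μX
  memLp_eps : MemLp id 2 με
  integral_eps : ∫ e, e ∂με = 0
  charFun_X_ne_zero : ∀ u, charFun μX u ≠ 0
  charFun_eps_ne_zero : ∀ u, charFun με u ≠ 0

/-- Rosenthal's inequality divided by `n^(2p)`. The second summand, of order `n^(1-2p)`, is written
with the common factor `n^(-p)` taken out. -/
theorem exists_lintegral_empirical_mean_le (p : ℕ) (hp : 1 ≤ p) : ∃ C : ℝ≥0∞, C ≠ ∞ ∧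
    ∀ (μX με : Measure ℝ) [IsProbabilityMeasure μX] [IsProbabilityMeasure με]
      (Ω : Type u) [MeasurableSpace Ω] (P : Measure Ω) [IsProbabilityMeasure P]
      (n : ℕ) (Y : Fin n → Ω → ℝ × ℝ), 0 < n → IsSample P μX με Y →
      ∀ F : ℝ × ℝ → ℂ, Measurable F → MemLp F ((2 * p : ℕ) : ℝ≥0∞) (lawY μX με) →
        ∫⁻ ω, ‖1 / (n : ℂ) * ∑ j, F (Y j ω) - ∫ y, F y ∂(lawY μX με)‖ₑ ^ (2 * p) ∂P ≤
          C * ((n : ℝ≥0∞)⁻¹ ^ p * ((∫⁻ y, ‖F y‖ₑ ^ 2 ∂(lawY μX με)) ^ p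
            + (n : ℝ≥0∞)⁻¹ ^ (p - 1) * ∫⁻ y, ‖F y‖ₑ ^ (2 * p) ∂(lawY μX με))) := by
  obtain ⟨C, hC, h⟩ := exists_rosenthal_sample.{u, 0} p hp
  refine ⟨C, hC, fun μX με _ _ Ω _ P _ n Y hn hY F hF hFL => ?_⟩
  have hn0 : (n : ℝ≥0∞) ≠ 0 := by exact_mod_cast hn.ne'
  have hnc : (n : ℂ) ≠ 0 := by exact_mod_cast hn.ne'
  have hnt : (n : ℝ≥0∞) ≠ ∞ := ENNReal.natCast_ne_top n
  have hne : ‖1 / (n : ℂ)‖ₑ = (n : ℝ≥0∞)⁻¹ := by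
    rw [one_div, enorm_inv hnc]
    congr 1
    rw [← ofReal_norm]
    simp
  have key := h Ω P (ℝ × ℝ) (lawY μX με) n Y hY.indep hY.measurable hY.law F hF hFL
  set m := ∫ y, F y ∂(lawY μX με)
  have e : ∀ ω, 1 / (n : ℂ) * ∑ j, F (Y j ω) - m = 1 / (n : ℂ) * ∑ j, (F (Y j ω) - m) := by
    intro ω
    rw [Finset.sum_sub_distrib]
    simp
    field_simp
  simp_rw [e, enorm_mul, mul_pow, hne]
  have hmeas : ∀ j, Measurable fun ω => F (Y j ω) := fun j => hF.comp (hY.measurable j)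
  rw [lintegral_const_mul _
    ((Finset.measurable_sum _ fun j _ => (hmeas j).sub_const m).enorm.pow_const _)]
  set a := ∫⁻ y, ‖F y‖ₑ ^ 2 ∂(lawY μX με)
  set b := ∫⁻ y, ‖F y‖ₑ ^ (2 * p) ∂(lawY μX με)
  calc _ ≤ (n : ℝ≥0∞)⁻¹ ^ (2 * p) * (C * ((n * a) ^ p + n * b)) := by gcongr
    _ = C * ((n : ℝ≥0∞)⁻¹ ^ (2 * p) * (n * a) ^ p + (n : ℝ≥0∞)⁻¹ ^ (2 * p) * (n * b)) := by ring
    _ = _ := by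
      congr 1
      rw [mul_add (_ ^ p)]
      congr 1
      · rw [← mul_pow, two_mul, pow_add, mul_assoc, ← mul_pow, ← mul_assoc,
          ENNReal.inv_mul_cancel hn0 hnt, one_mul, ← mul_pow]
      · have : 2 * p = p + (p - 1) + 1 := by omega
        rw [this, pow_succ, pow_add, mul_assoc, ← mul_assoc _ (n : ℝ≥0∞) b,
          ENNReal.inv_mul_cancel hn0 hnt, one_mul, mul_assoc]

theorem memLp_of_norm_le_const {α : Type*} [MeasurableSpace α] {μ : Measure α}
    [IsFiniteMeasure μ] {F : α → ℂ} (hF : Measurable F) {C : ℝ} (h : ∀ a, ‖F a‖ ≤ C) (p : ℝ≥0∞) :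
    MemLp F p μ :=
  MemLp.of_bound hF.aestronglyMeasurable C (Filter.Eventually.of_forall h)

theorem norm_exp_I_mul (t : ℂ) (ht : t.im = 0) : ‖exp (I * t)‖ = 1 := by
  rw [Complex.norm_exp]
  simp [ht]

theorem inv_natCast_le_one {n : ℕ} (hn : 0 < n) : (n : ℝ≥0∞)⁻¹ ≤ 1 := by
  rw [ENNReal.inv_le_one]
  exact_mod_cast hn

theorem exists_lintegral_psiHat_sub_le (p : ℕ) (hp : 1 ≤ p) : ∃ C : ℝ≥0∞, C ≠ ∞ ∧
    ∀ (μX με : Measure ℝ) [IsProbabilityMeasure μX] [IsProbabilityMeasure με]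
      (Ω : Type u) [MeasurableSpace Ω] (P : Measure Ω) [IsProbabilityMeasure P]
      (n : ℕ) (Y : Fin n → Ω → ℝ × ℝ), 0 < n → IsSample P μX με Y → ∀ z : ℝ,
        ∫⁻ ω, ‖psiHat (fun j => Y j ω) 0 z - phiY μX με z‖ₑ ^ (2 * p) ∂P ≤
          C * (n : ℝ≥0∞)⁻¹ ^ p := by
  obtain ⟨C, hC, h⟩ := exists_lintegral_empirical_mean_le.{u} p hp
  refine ⟨C * 2, by finiteness, fun μX με _ _ Ω _ P _ n Y hn hY z => ?_⟩
  set F : ℝ × ℝ → ℂ := fun y => exp (I * ((0 : ℝ) * y.1 + z * y.2)) with hFdef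
  have hF : Measurable F := by fun_prop
  have hF1 : ∀ y, ‖F y‖ = 1 := fun y => norm_exp_I_mul _ (by simp)
  have hFe : ∀ y, ‖F y‖ₑ = 1 := fun y => by rw [← ofReal_norm, hF1, ENNReal.ofReal_one]
  have key := h μX με Ω P n Y hn hY F hF (memLp_of_norm_le_const hF (fun y => (hF1 y).le) _)
  simp only [hFe, one_pow, lintegral_const, measure_univ, mul_one] at key
  calc _ ≤ _ := key
    _ ≤ C * ((n : ℝ≥0∞)⁻¹ ^ p * (1 + 1)) := by
        gcongr
        exact pow_le_one₀ zero_le (inv_natCast_le_one hn)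
    _ = _ := by rw [one_add_one_eq_two]; ring

theorem lintegral_enorm_snd_le (μX με : Measure ℝ) [IsProbabilityMeasure μX]
    [IsProbabilityMeasure με] :
    ∫⁻ y, ‖y.2‖ₑ ∂(lawY μX με) ≤ momentY μX με 2 ^ (1 / 2 : ℝ) := by
  have h := lintegral_pow_le (μ := lawY μX με) (f := fun y => ‖y.2‖ₑ) (by fun_prop)
    (p := 2) (by norm_num)
  rw [momentY_eq_snd] at h
  have h2 := ENNReal.rpow_le_rpow h (by norm_num : (0 : ℝ) ≤ 1 / 2)
  rwa [← ENNReal.rpow_natCast, ← ENNReal.rpow_mul, show ((2 : ℕ) : ℝ) * (1 / 2) = 1 by norm_num,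
    ENNReal.rpow_one] at h2

/-- Subtracting `1` from each exponential does not change the deviation from the mean, and `|e^{iθ}
- 1|² ≤ 2 |θ|`. The factor `|z|` is needed near the origin, where the target bound `∫_0^{|z|}
|φ_X|^{-2}` tends to zero. -/
theorem exists_lintegral_psiHat_sub_sq_le : ∃ C : ℝ≥0∞, C ≠ ∞ ∧
    ∀ (μX με : Measure ℝ) [IsProbabilityMeasure μX] [IsProbabilityMeasure με]
      (Ω : Type u) [MeasurableSpace Ω] (P : Measure Ω) [IsProbabilityMeasure P]
      (n : ℕ) (Y : Fin n → Ω → ℝ × ℝ), 0 < n → IsSample P μX με Y → ∀ z : ℝ,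
        ∫⁻ ω, ‖psiHat (fun j => Y j ω) 0 z - phiY μX με z‖ₑ ^ 2 ∂P ≤
          C * ((n : ℝ≥0∞)⁻¹ * (‖z‖ₑ * momentY μX με 2 ^ (1 / 2 : ℝ))) := by
  obtain ⟨C, hC, h⟩ := exists_lintegral_empirical_mean_le.{u} 1 le_rfl
  refine ⟨C * 4, by finiteness, fun μX με _ _ Ω _ P _ n Y hn hY z => ?_⟩
  have hnc : (n : ℂ) ≠ 0 := by exact_mod_cast hn.ne'
  set F : ℝ × ℝ → ℂ := fun y => exp (I * ((0 : ℝ) * y.1 + z * y.2)) with hFdef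
  have hF : Measurable F := by fun_prop
  have hF1 : ∀ y, ‖F y‖ = 1 := fun y => norm_exp_I_mul _ (by simp)
  have hFi : Integrable F (lawY μX με) :=
    memLp_one_iff_integrable.1 (memLp_of_norm_le_const hF (fun y => (hF1 y).le) _)
  have hG2 : ∀ y, ‖F y - 1‖ ≤ 2 := fun y =>
    (norm_sub_le _ _).trans (by rw [hF1, norm_one]; norm_num)
  have hG1 : ∀ y, ‖F y - 1‖ ≤ |z * y.2| := fun y => by
    have := Real.norm_exp_I_mul_ofReal_sub_one_le (x := z * y.2)
    simpa [hFdef] using this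
  have key := h μX με Ω P n Y hn hY (fun y => F y - 1) (by fun_prop)
    (memLp_of_norm_le_const (by fun_prop) hG2 _)
  have hsq : ∫⁻ y, ‖F y - 1‖ₑ ^ 2 ∂(lawY μX με)
      ≤ 2 * (‖z‖ₑ * momentY μX με 2 ^ (1 / 2 : ℝ)) := by
    calc _ ≤ ∫⁻ y, 2 * (‖z‖ₑ * ‖y.2‖ₑ) ∂(lawY μX με) := by
          refine lintegral_mono fun y => ?_
          rw [sq]
          refine mul_le_mul' ?_ ?_
          · rw [← ofReal_norm, ← ENNReal.ofReal_ofNat]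
            exact ENNReal.ofReal_le_ofReal (hG2 y)
          · rw [← enorm_mul, Real.enorm_eq_ofReal_abs, ← ofReal_norm]
            exact ENNReal.ofReal_le_ofReal (hG1 y)
      _ = 2 * (‖z‖ₑ * ∫⁻ y, ‖y.2‖ₑ ∂(lawY μX με)) := by
          rw [lintegral_const_mul _ (by fun_prop), lintegral_const_mul _ (by fun_prop)]
      _ ≤ _ := by
          gcongr
          exact lintegral_enorm_snd_le μX με
  have e : ∀ ω, psiHat (fun j => Y j ω) 0 z - phiY μX με z
      = 1 / (n : ℂ) * ∑ j, (F (Y j ω) - 1) - ∫ y, (F y - 1) ∂(lawY μX με) := by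
    intro ω
    rw [integral_sub hFi (integrable_const _), Finset.sum_sub_distrib]
    simp only [psiHat, phiY, psi, hFdef]
    simp
    field_simp
    ring
  simp only [e]
  calc _ ≤ _ := key
    _ ≤ C * ((n : ℝ≥0∞)⁻¹ ^ 1 * ((2 * (‖z‖ₑ * momentY μX με 2 ^ (1 / 2 : ℝ))) ^ 1
          + (n : ℝ≥0∞)⁻¹ ^ (1 - 1) * (2 * (‖z‖ₑ * momentY μX με 2 ^ (1 / 2 : ℝ))))) := by
        gcongr
    _ = _ := by
        simp only [pow_one, Nat.sub_self, pow_zero, one_mul]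
        ring

theorem enorm_I_mul_fst_mul_exp (z : ℝ) (y : ℝ × ℝ) :
    ‖I * y.1 * exp (I * ((0 : ℝ) * y.1 + z * y.2))‖ₑ = ‖y.1‖ₑ := by
  rw [← ofReal_norm, norm_mul, norm_mul, norm_exp_I_mul _ (by simp), ← ofReal_norm]
  simp

theorem exists_lintegral_dpsiHat_sub_le (p : ℕ) (hp : 1 ≤ p) : ∃ C : ℝ≥0∞, C ≠ ∞ ∧
    ∀ (μX με : Measure ℝ) [IsProbabilityMeasure μX] [IsProbabilityMeasure με]
      (Ω : Type u) [MeasurableSpace Ω] (P : Measure Ω) [IsProbabilityMeasure P]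
      (n : ℕ) (Y : Fin n → Ω → ℝ × ℝ), 0 < n → IsSample P μX με Y → RegularModel μX με →
      momentY μX με (2 * p) < ∞ → ∀ z : ℝ,
        ∫⁻ ω, ‖dpsiHat (fun j => Y j ω) 0 z - deriv (charFun μX) z * charFun με z‖ₑ ^ (2 * p) ∂P ≤
          C * ((n : ℝ≥0∞)⁻¹ ^ p * momentY μX με (2 * p)) := by
  obtain ⟨C, hC, h⟩ := exists_lintegral_empirical_mean_le.{u} p hp
  refine ⟨C * 2, by finiteness, fun μX με _ _ Ω _ P _ n Y hn hY hM hmom z => ?_⟩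
  set F : ℝ × ℝ → ℂ := fun y => I * y.1 * exp (I * ((0 : ℝ) * y.1 + z * y.2)) with hFdef
  have hF : Measurable F := by fun_prop
  have hFe : ∀ y, ‖F y‖ₑ = ‖y.1‖ₑ := enorm_I_mul_fst_mul_exp z
  have hFL : MemLp F ((2 * p : ℕ) : ℝ≥0∞) (lawY μX με) :=
    memLp_of_lintegral_enorm_pow_lt_top (by fun_prop) (by omega) (by simp only [hFe]; exact hmom)
  have key := h μX με Ω P n Y hn hY F hF hFL
  rw [← integral_fst_mul_exp_lawY hM.memLp_X hM.memLp_eps hM.integral_eps]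
  simp only [hFe] at key
  have hJ : (∫⁻ y, ‖y.1‖ₑ ^ 2 ∂(lawY μX με)) ^ p ≤ momentY μX με (2 * p) := by
    refine (lintegral_pow_le (by fun_prop) hp).trans (le_of_eq ?_)
    simp only [← pow_mul]
    rfl
  calc _ ≤ _ := key
    _ ≤ C * ((n : ℝ≥0∞)⁻¹ ^ p * (momentY μX με (2 * p) + 1 * momentY μX με (2 * p))) := by
        gcongr
        · exact pow_le_one₀ zero_le (inv_natCast_le_one hn)
        · exact le_rfl
    _ = _ := by ring

/-! ### Linear functionals of the empirical derivative -/

theorem lintegral_mul_sq_le {α : Type*} [MeasurableSpace α] {μ : Measure α} {f g : α → ℝ≥0∞}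
    (hf : AEMeasurable f μ) (hg : AEMeasurable g μ) :
    (∫⁻ a, f a * g a ∂μ) ^ 2 ≤ (∫⁻ a, f a ^ 2 ∂μ) * ∫⁻ a, g a ^ 2 ∂μ := by
  have h := ENNReal.lintegral_mul_norm_pow_le (μ := μ) (hf.pow_const 2) (hg.pow_const 2)
    (p := 1 / 2) (q := 1 / 2) (by norm_num) (by norm_num) (by norm_num)
  have e : ∀ x : ℝ≥0∞, (x ^ 2) ^ (1 / 2 : ℝ) = x := fun x => by
    rw [← ENNReal.rpow_natCast, ← ENNReal.rpow_mul]
    norm_num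
  have e' : ∀ x : ℝ≥0∞, (x ^ (1 / 2 : ℝ)) ^ 2 = x := fun x => by
    rw [← ENNReal.rpow_natCast, ← ENNReal.rpow_mul]
    norm_num
  simp only [e] at h
  calc _ ≤ _ := pow_le_pow_left₀ zero_le h 2
    _ = _ := by rw [mul_pow, e', e']

/-- The weighted integral of the empirical derivative of a single observation. -/
noncomputable def linFun (τ : Measure ℝ) (g : ℝ → ℂ) (y : ℝ × ℝ) : ℂ :=
  ∫ z, I * y.1 * exp (I * ((0 : ℝ) * y.1 + z * y.2)) * g z ∂τ

section Lin

variable {μX με : Measure ℝ} [IsProbabilityMeasure μX] [IsProbabilityMeasure με]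
  {τ : Measure ℝ} [IsFiniteMeasure τ] {g : ℝ → ℂ}

theorem measurable_linFun (hg : Measurable g) : Measurable (linFun τ g) := by
  unfold linFun
  refine (StronglyMeasurable.integral_prod_right
    (f := fun y : ℝ × ℝ => fun z : ℝ => I * y.1 * exp (I * ((0 : ℝ) * y.1 + z * y.2)) * g z)
    ?_).measurable
  exact Measurable.stronglyMeasurable (by fun_prop)

theorem norm_I_mul_fst_mul_exp (z : ℝ) (y : ℝ × ℝ) :
    ‖I * y.1 * exp (I * ((0 : ℝ) * y.1 + z * y.2))‖ = |y.1| := by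
  rw [norm_mul, norm_mul, norm_exp_I_mul _ (by simp)]
  simp

theorem integrable_fst_mul_exp_mul (y : ℝ × ℝ) (hg : Integrable g τ) :
    Integrable (fun z : ℝ => I * y.1 * exp (I * ((0 : ℝ) * y.1 + z * y.2)) * g z) τ := by
  refine (hg.norm.const_mul |y.1|).mono' (AEStronglyMeasurable.mul (by fun_prop) hg.1)
    (Filter.Eventually.of_forall fun z => ?_)
  rw [norm_mul, norm_I_mul_fst_mul_exp]

theorem integral_linFun (hM : RegularModel μX με) (hmom : momentY μX με 2 < ∞)
    (hg : Integrable g τ) (hgm : Measurable g) :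
    ∫ y, linFun τ g y ∂(lawY μX με) = ∫ z, deriv (charFun μX) z * charFun με z * g z ∂τ := by
  unfold linFun
  rw [integral_integral_swap]
  · refine integral_congr_ae (Filter.Eventually.of_forall fun z => ?_)
    simp only
    rw [integral_mul_const, integral_fst_mul_exp_lawY hM.memLp_X hM.memLp_eps hM.integral_eps]
  · have h1 : Integrable (fun y : ℝ × ℝ => y.1) (lawY μX με) :=
      (memLp_fst_lawY (by norm_num) hmom).integrable (by norm_num)
    refine (h1.norm.mul_prod hg.norm).mono' ?_ (Filter.Eventually.of_forall fun p => ?_)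
    · exact Measurable.aestronglyMeasurable (by unfold Function.uncurry; fun_prop)
    · simp only [Function.uncurry]
      rw [norm_mul, norm_I_mul_fst_mul_exp, Real.norm_eq_abs]

theorem mean_linFun {n : ℕ} (y : Fin n → ℝ × ℝ) (hg : Integrable g τ) :
    1 / (n : ℂ) * ∑ j, linFun τ g (y j) = ∫ z, dpsiHat y 0 z * g z ∂τ := by
  unfold linFun dpsiHat
  rw [← integral_finsetSum _ fun j _ => integrable_fst_mul_exp_mul (y j) hg,
    ← integral_const_mul]
  refine integral_congr_ae (Filter.Eventually.of_forall fun z => ?_)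
  simp only [Finset.sum_mul, mul_assoc]

theorem enorm_linFun_le (y : ℝ × ℝ) : ‖linFun τ g y‖ₑ ≤ ‖y.1‖ₑ * ∫⁻ z, ‖g z‖ₑ ∂τ := by
  unfold linFun
  refine (enorm_integral_le_lintegral_enorm _).trans ?_
  simp_rw [enorm_mul _ (g _), enorm_I_mul_fst_mul_exp]
  exact (lintegral_const_mul' _ _ (by finiteness)).le

theorem lintegral_linFun_pow_le (hgm : Measurable g) {p : ℕ} :
    ∫⁻ y, ‖linFun τ g y‖ₑ ^ (2 * p) ∂(lawY μX με)
      ≤ momentY μX με (2 * p) * (τ Set.univ * ∫⁻ z, ‖g z‖ₑ ^ 2 ∂τ) ^ p := by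
  have hCS : (∫⁻ z, ‖g z‖ₑ ∂τ) ^ 2 ≤ τ Set.univ * ∫⁻ z, ‖g z‖ₑ ^ 2 ∂τ := by
    have := lintegral_mul_pow_le (μ := τ) (w := fun _ => 1) (f := fun z => ‖g z‖ₑ)
      (by fun_prop) (by fun_prop) (p := 2) (by norm_num)
    simpa using this
  calc _ ≤ ∫⁻ y, ‖y.1‖ₑ ^ (2 * p) * (τ Set.univ * ∫⁻ z, ‖g z‖ₑ ^ 2 ∂τ) ^ p ∂(lawY μX με) := by
        refine lintegral_mono fun y => ?_
        refine (pow_le_pow_left₀ zero_le (enorm_linFun_le y) _).trans ?_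
        rw [mul_pow, pow_mul (∫⁻ z, ‖g z‖ₑ ∂τ)]
        gcongr
    _ = _ := by rw [lintegral_mul_const _ (by fun_prop), momentY]

/-- The covariance kernel of the empirical derivative. -/
noncomputable def covKernel (μX με : Measure ℝ) (z : ℝ) : ℂ :=
  ∫ y, (y.1 : ℂ) ^ 2 * exp (I * (z * y.2)) ∂(lawY μX με)

theorem measurable_covKernel : Measurable (covKernel μX με) := by
  unfold covKernel
  refine (StronglyMeasurable.integral_prod_right
    (f := fun z : ℝ => fun y : ℝ × ℝ => (y.1 : ℂ) ^ 2 * exp (I * (z * y.2))) ?_).measurable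
  exact Measurable.stronglyMeasurable (by fun_prop)

/-- The kernel is `-φ_X'' φ_ε + E[ε²] φ_X φ_ε`; this is where the `L¹` norms in `G` come from. -/
theorem lintegral_covKernel_le (hM : RegularModel μX με) :
    ∫⁻ z, ‖covKernel μX με z‖ₑ ≤
      eLpNorm (fun z => iteratedDeriv 2 (charFun μX) z * charFun με z) 1 volume
      + (∫⁻ e, ‖e‖ₑ ^ 2 ∂με) * eLpNorm (fun z => charFun μX z * charFun με z) 1 volume := by
  have h2 : Continuous (iteratedDeriv 2 (charFun μX)) :=
    (contDiff_charFun (n := 2) (by exact_mod_cast hM.memLp_X)).continuous_iteratedDeriv 2 le_rfl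
  have hsq : ‖((∫ e, e ^ 2 ∂με : ℝ) : ℂ)‖ₑ = ∫⁻ e, ‖e‖ₑ ^ 2 ∂με := by
    have := lintegral_enorm_pow_even (P := με) (X := fun e => e) (k := 1)
      hM.memLp_eps.integrable_sq
    rw [mul_one] at this
    rw [this, ← ofReal_norm, norm_real, Real.norm_of_nonneg (integral_nonneg fun e => sq_nonneg _)]
  rw [eLpNorm_one_eq_lintegral_enorm, eLpNorm_one_eq_lintegral_enorm,
    ← lintegral_const_mul _ (by fun_prop), ← lintegral_add_left (by fun_prop)]
  refine lintegral_mono fun z => ?_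
  rw [covKernel, integral_fst_sq_mul_exp_lawY hM.memLp_X hM.memLp_eps hM.integral_eps]
  refine (enorm_add_le _ _).trans ?_
  rw [enorm_neg, enorm_mul (ofReal _), hsq]

theorem mul_le_sq_add_sq (a b : ℝ≥0∞) : a * b ≤ a ^ 2 + b ^ 2 := by
  rcases le_total a b with h | h
  · calc a * b ≤ b * b := by gcongr
      _ = b ^ 2 := (sq b).symm
      _ ≤ _ := le_add_self
  · calc a * b ≤ a * a := by gcongr
      _ = a ^ 2 := (sq a).symm
      _ ≤ _ := le_self_add

/-- In this double integral the observation enters only through `y₁² exp(i(z - w) y₂)`, so its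
expectation is the covariance kernel at the difference `z - w`. -/
theorem linFun_mul_conj (y : ℝ × ℝ) (τ : Measure ℝ) [SFinite τ] (g : ℝ → ℂ) :
    linFun τ g y * (starRingEnd ℂ) (linFun τ g y) =
      ∫ p : ℝ × ℝ, (y.1 : ℂ) ^ 2 * exp (I * ((p.1 - p.2 : ℝ) * y.2))
        * (g p.1 * (starRingEnd ℂ) (g p.2)) ∂(τ.prod τ) := by
  have hc : (starRingEnd ℂ) (linFun τ g y) = ∫ z, (starRingEnd ℂ)
      (I * y.1 * exp (I * ((0 : ℝ) * y.1 + z * y.2)) * g z) ∂τ := integral_conj.symm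
  rw [hc, linFun, ← integral_prod_mul]
  refine integral_congr_ae (Filter.Eventually.of_forall fun p => ?_)
  simp only [map_mul, ← exp_conj, conj_I, conj_ofReal, map_add]
  have : exp (I * ((p.1 - p.2 : ℝ) * y.2)) = exp (I * ((0 : ℝ) * y.1 + p.1 * y.2))
      * exp (-I * ((0 : ℝ) * y.1 + p.2 * y.2)) := by
    rw [← Complex.exp_add]; congr 1; push_cast; ring
  rw [this]
  linear_combination (-(y.1 : ℂ) ^ 2 * exp (I * ((0 : ℝ) * y.1 + p.1 * y.2))
      * exp (-I * ((0 : ℝ) * y.1 + p.2 * y.2)) * g p.1 * (starRingEnd ℂ) (g p.2)) * I_mul_I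

/-- Schur's test: the expected square is a quadratic form with kernel `covKernel (z - w)`. Bounding
`|g(z) g(w)|` by `|g(z)|² + |g(w)|²` and integrating out the other variable leaves the `L¹` norm of
the kernel. Unlike Cauchy-Schwarz in `z`, this costs no factor for the length of the interval. -/
theorem lintegral_linFun_sq_le (hmom : momentY μX με 2 < ∞)
    {s : Set ℝ} [IsFiniteMeasure (volume.restrict s)] (hg : Integrable g (volume.restrict s))
    (hgm : Measurable g) :
    ∫⁻ y, ‖linFun (volume.restrict s) g y‖ₑ ^ 2 ∂(lawY μX με)
      ≤ 2 * (∫⁻ z, ‖covKernel μX με z‖ₑ) * ∫⁻ z in s, ‖g z‖ₑ ^ 2 := by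
  set τ := volume.restrict s with hτ
  have hL2 : MemLp (fun y : ℝ × ℝ => y.1) 2 (lawY μX με) := memLp_fst_lawY (by norm_num) hmom
  have hlm := measurable_linFun (τ := τ) hgm
  have hint : Integrable (Function.uncurry fun (y : ℝ × ℝ) (p : ℝ × ℝ) =>
      (y.1 : ℂ) ^ 2 * exp (I * ((p.1 - p.2 : ℝ) * y.2)) * (g p.1 * (starRingEnd ℂ) (g p.2)))
      ((lawY μX με).prod (τ.prod τ)) := by
    refine (hL2.integrable_sq.mul_prod (hg.norm.mul_prod hg.norm)).mono' ?_
      (Filter.Eventually.of_forall fun p => ?_)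
    · have hc : Measurable (starRingEnd ℂ) := Complex.continuous_conj.measurable
      exact Measurable.aestronglyMeasurable (by
        unfold Function.uncurry
        exact Measurable.mul (by fun_prop) ((by fun_prop : Measurable fun a : (ℝ × ℝ) × ℝ × ℝ =>
          g a.2.1).mul (hc.comp (by fun_prop : Measurable fun a : (ℝ × ℝ) × ℝ × ℝ =>
          g a.2.2))))
    · simp only [Function.uncurry]
      rw [norm_mul, norm_mul, norm_exp_I_mul _ (by simp), norm_mul, RCLike.norm_conj]
      simp
  have hsq : ∀ y, ‖linFun τ g y‖ₑ ^ 2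
      = ENNReal.ofReal ((linFun τ g y * (starRingEnd ℂ) (linFun τ g y)).re) := by
    intro y
    rw [Complex.mul_conj, ofReal_re, Complex.normSq_eq_norm_sq,
      ENNReal.ofReal_pow (norm_nonneg _), ofReal_norm]
  have hbd : Integrable (fun y => linFun τ g y * (starRingEnd ℂ) (linFun τ g y))
      (lawY μX με) := by
    simp_rw [linFun_mul_conj]
    exact hint.integral_prod_left
  have h1 : ∫⁻ y, ‖linFun τ g y‖ₑ ^ 2 ∂(lawY μX με)
      = ENNReal.ofReal (∫ y, linFun τ g y * (starRingEnd ℂ) (linFun τ g y) ∂(lawY μX με)).re := by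
    have hre := integral_re hbd
    simp only [RCLike.re_to_complex] at hre
    have hbdre : Integrable (fun y => (linFun τ g y * (starRingEnd ℂ) (linFun τ g y)).re)
        (lawY μX με) := hbd.re
    rw [← hre, ofReal_integral_eq_lintegral_ofReal hbdre
      (Filter.Eventually.of_forall fun y => ?_)]
    · exact lintegral_congr hsq
    · simp only [Pi.zero_apply]
      rw [Complex.mul_conj, ofReal_re]
      exact Complex.normSq_nonneg _
  have h2 : ∫ y, linFun τ g y * (starRingEnd ℂ) (linFun τ g y) ∂(lawY μX με)
      = ∫ p, covKernel μX με (p.1 - p.2) * (g p.1 * (starRingEnd ℂ) (g p.2)) ∂(τ.prod τ) := by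
    simp_rw [linFun_mul_conj]
    rw [integral_integral_swap hint]
    refine integral_congr_ae (Filter.Eventually.of_forall fun p => ?_)
    simp only
    rw [integral_mul_const, covKernel]
  set k := ∫⁻ z, ‖covKernel μX με z‖ₑ with hk
  have hcm := measurable_covKernel (μX := μX) (με := με)
  have hk1 : ∀ z, ∫⁻ w, ‖covKernel μX με (z - w)‖ₑ ∂τ ≤ k := fun z => by
    calc _ ≤ ∫⁻ w, ‖covKernel μX με (z - w)‖ₑ := setLIntegral_le_lintegral _ _
      _ = k := lintegral_sub_left_eq_self (fun w => ‖covKernel μX με w‖ₑ) z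
  have hk2 : ∀ w, ∫⁻ z, ‖covKernel μX με (z - w)‖ₑ ∂τ ≤ k := fun w => by
    calc _ ≤ ∫⁻ z, ‖covKernel μX με (z - w)‖ₑ := setLIntegral_le_lintegral _ _
      _ = k := lintegral_sub_right_eq_self (fun w => ‖covKernel μX με w‖ₑ) w
  rw [h1, h2]
  calc _ ≤ ‖∫ p, covKernel μX με (p.1 - p.2) * (g p.1 * (starRingEnd ℂ) (g p.2)) ∂(τ.prod τ)‖ₑ := by
        rw [← ofReal_norm]
        exact ENNReal.ofReal_le_ofReal (Complex.re_le_norm _)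
    _ ≤ ∫⁻ p, ‖covKernel μX με (p.1 - p.2)‖ₑ * (‖g p.1‖ₑ ^ 2 + ‖g p.2‖ₑ ^ 2) ∂(τ.prod τ) := by
        refine (enorm_integral_le_lintegral_enorm _).trans (lintegral_mono fun p => ?_)
        simp only [enorm_mul, RCLike.enorm_conj]
        gcongr
        exact mul_le_sq_add_sq _ _
    _ = (∫⁻ p, ‖covKernel μX με (p.1 - p.2)‖ₑ * ‖g p.1‖ₑ ^ 2 ∂(τ.prod τ))
        + ∫⁻ p, ‖covKernel μX με (p.1 - p.2)‖ₑ * ‖g p.2‖ₑ ^ 2 ∂(τ.prod τ) := by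
        simp_rw [mul_add]
        rw [lintegral_add_left (by fun_prop)]
    _ ≤ k * (∫⁻ z, ‖g z‖ₑ ^ 2 ∂τ) + k * ∫⁻ z, ‖g z‖ₑ ^ 2 ∂τ := by
        gcongr
        · rw [lintegral_prod _ (by fun_prop), ← lintegral_const_mul _ (by fun_prop)]
          refine lintegral_mono fun z => ?_
          simp only
          rw [lintegral_mul_const _ (by fun_prop)]
          gcongr
          exact hk1 z
        · rw [lintegral_prod_symm _ (by fun_prop), ← lintegral_const_mul _ (by fun_prop)]
          refine lintegral_mono fun z => ?_
          simp only
          rw [lintegral_mul_const _ (by fun_prop)]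
          gcongr
          exact hk2 z
    _ = _ := by ring

end Lin

/-! ### The regularized inverse -/

theorem regularize_zero (n : ℕ) : regularize n 0 = 0 := by simp [regularize]

theorem regularize_of_one_le {n : ℕ} {z : ℂ} (h : 1 ≤ Real.sqrt n * ‖z‖) : regularize n z = z := by
  simp [regularize, min_eq_right h]

theorem norm_regularize_of_le_one {n : ℕ} (hn : 0 < n) {z : ℂ} (hz : z ≠ 0)
    (h : Real.sqrt n * ‖z‖ ≤ 1) : ‖regularize n z‖ = 1 / Real.sqrt n := by
  have hs : 0 < Real.sqrt n := Real.sqrt_pos.2 (by exact_mod_cast hn)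
  have hz' : 0 < ‖z‖ := norm_pos_iff.2 hz
  rw [regularize, min_eq_left h, norm_div, norm_real, Real.norm_of_nonneg (by positivity)]
  field_simp

theorem le_norm_regularize {n : ℕ} (hn : 0 < n) {z : ℂ} (hz : z ≠ 0) :
    1 / Real.sqrt n ≤ ‖regularize n z‖ := by
  have hs : 0 < Real.sqrt n := Real.sqrt_pos.2 (by exact_mod_cast hn)
  rcases le_total (Real.sqrt n * ‖z‖) 1 with h | h
  · exact (norm_regularize_of_le_one hn hz h).ge
  · rw [regularize_of_one_le h, div_le_iff₀ hs]
    linarith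

theorem norm_regularize_sub_le {n : ℕ} (hn : 0 < n) (z : ℂ) :
    ‖regularize n z - z‖ ≤ 1 / Real.sqrt n := by
  have hs : 0 < Real.sqrt n := Real.sqrt_pos.2 (by exact_mod_cast hn)
  by_cases hz : z = 0
  · rw [hz, regularize_zero]
    simp
  have hz' : 0 < ‖z‖ := norm_pos_iff.2 hz
  rcases le_total (Real.sqrt n * ‖z‖) 1 with h | h
  · have e : regularize n z - z = z * ((1 / (Real.sqrt n * ‖z‖) - 1 : ℝ) : ℂ) := by
      rw [regularize, min_eq_left h]
      push_cast
      ring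
    have h1 : 0 ≤ 1 / (Real.sqrt n * ‖z‖) - 1 := by
      rw [sub_nonneg, le_div_iff₀ (by positivity)]
      linarith
    rw [e, norm_mul, norm_real, Real.norm_of_nonneg h1, mul_sub, mul_one]
    have : ‖z‖ * (1 / (Real.sqrt n * ‖z‖)) = 1 / Real.sqrt n := by field_simp
    linarith
  · rw [regularize_of_one_le h]
    simp

theorem norm_inv_regularize_le {n : ℕ} (hn : 0 < n) (z : ℂ) :
    ‖1 / regularize n z‖ ≤ Real.sqrt n := by
  have hs : 0 < Real.sqrt n := Real.sqrt_pos.2 (by exact_mod_cast hn)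
  by_cases hz : z = 0
  · rw [hz, regularize_zero]
    simp
  · rw [norm_div, norm_one, ← one_div_one_div (Real.sqrt n)]
    exact one_div_le_one_div_of_le (by positivity) (le_norm_regularize hn hz)

theorem measurable_regularize (n : ℕ) : Measurable (regularize n) := by
  unfold regularize
  fun_prop

/-- With `r` the regularized value and `d = |φ - r|`, the left side is `|φ| d / |r| ≤ d + d²/|r|`.
Regularization gives `1/|r| ≤ √n` and moves `z` by at most `1/√n`, so `d` is at most `(1 + √n |z -
φ|)/√n`. -/
theorem norm_sq_mul_norm_inv_regularize_sub_le {n : ℕ} (hn : 0 < n) (z : ℂ) {φ : ℂ} (hφ : φ ≠ 0) :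
    ‖φ‖ ^ 2 * ‖1 / regularize n z - 1 / φ‖
      ≤ 2 / Real.sqrt n * (1 + Real.sqrt n * ‖z - φ‖) ^ 2 := by
  have hs : 0 < Real.sqrt n := Real.sqrt_pos.2 (by exact_mod_cast hn)
  have hφ' : 0 < ‖φ‖ := norm_pos_iff.2 hφ
  set x := Real.sqrt n * ‖z - φ‖ with hx
  have hx0 : 0 ≤ x := by positivity
  have hxd : ‖z - φ‖ = x / Real.sqrt n := by rw [hx]; field_simp
  by_cases hz : z = 0
  -- At `z = 0` the regularized inverse is `0` by convention, and the left side is just `|φ| = |z -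
  -- φ|`.
  · have e : ‖φ‖ = x / Real.sqrt n := by rw [← hxd, hz, zero_sub, norm_neg]
    rw [hz, regularize_zero, div_zero, zero_sub, norm_neg, norm_div, norm_one]
    have : ‖φ‖ ^ 2 * (1 / ‖φ‖) = ‖φ‖ := by field_simp
    rw [this, e, div_mul_eq_mul_div]
    gcongr
    nlinarith
  · set r := regularize n z with hr
    have hrl : 1 / Real.sqrt n ≤ ‖r‖ := le_norm_regularize hn hz
    have hr0 : 0 < ‖r‖ := lt_of_lt_of_le (by positivity) hrl
    have hrne : r ≠ 0 := norm_pos_iff.1 hr0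
    set d := ‖φ - r‖ with hd
    have hd0 : 0 ≤ d := norm_nonneg _
    have hdle : d ≤ (1 + x) / Real.sqrt n := by
      have h1 : d ≤ ‖z - φ‖ + ‖r - z‖ := by
        rw [hd, norm_sub_rev]
        calc ‖r - φ‖ = ‖(z - φ) + (r - z)‖ := by ring_nf
          _ ≤ _ := norm_add_le _ _
      have h2 := norm_regularize_sub_le hn z
      rw [hxd] at h1
      calc d ≤ x / Real.sqrt n + 1 / Real.sqrt n := by linarith
        _ = _ := by ring
    have e : ‖φ‖ ^ 2 * ‖1 / r - 1 / φ‖ = ‖φ‖ * d / ‖r‖ := by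
      have : 1 / r - 1 / φ = (φ - r) / (r * φ) := by field_simp
      rw [this, norm_div, norm_mul]
      field_simp
      rfl
    have hφr : ‖φ‖ ≤ ‖r‖ + d := by
      calc ‖φ‖ = ‖r + (φ - r)‖ := by ring_nf
        _ ≤ _ := norm_add_le _ _
    rw [e]
    have h3 : ‖φ‖ * d / ‖r‖ ≤ d + Real.sqrt n * d ^ 2 := by
      rw [div_le_iff₀ hr0]
      have h4 : 1 ≤ Real.sqrt n * ‖r‖ := by
        rw [div_le_iff₀ hs] at hrl
        linarith
      have h5 : d ^ 2 * 1 ≤ d ^ 2 * (Real.sqrt n * ‖r‖) := by gcongr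
      nlinarith
    have h6 : d + Real.sqrt n * d ^ 2 ≤ (1 + x) / Real.sqrt n
        + Real.sqrt n * ((1 + x) / Real.sqrt n) ^ 2 := by gcongr
    have h7 : (1 + x) / Real.sqrt n + Real.sqrt n * ((1 + x) / Real.sqrt n) ^ 2
        = ((1 + x) + (1 + x) ^ 2) / Real.sqrt n := by field_simp
    rw [h7] at h6
    refine (h3.trans h6).trans ?_
    rw [div_mul_eq_mul_div]
    gcongr
    nlinarith

/-- The error of the regularized inverse of the empirical characteristic function. -/
noncomputable def invError (μX με : Measure ℝ) {n : ℕ} (y : Fin n → ℝ × ℝ) (z : ℝ) : ℂ :=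
  1 / psiTilde y z - 1 / phiY μX με z

/-- The error of the empirical derivative. -/
noncomputable def derivError (μX με : Measure ℝ) {n : ℕ} (y : Fin n → ℝ × ℝ) (z : ℝ) : ℂ :=
  dpsiHat y 0 z - deriv (charFun μX) z * charFun με z

section Measurability

variable {μX με : Measure ℝ} [IsProbabilityMeasure μX] [IsProbabilityMeasure με]
  {Ω : Type*} [MeasurableSpace Ω] {n : ℕ} {Y : Fin n → Ω → ℝ × ℝ}

theorem continuous_phiY : Continuous (phiY μX με) := by
  simp only [funext phiY_eq]
  fun_prop

theorem measurable_psiHat (hY : ∀ j, Measurable (Y j)) :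
    Measurable fun a : Ω × ℝ => psiHat (fun j => Y j a.1) 0 a.2 := by
  unfold psiHat
  refine measurable_const.mul (Finset.measurable_sum _ fun j _ => ?_)
  have h1 : Measurable fun a : Ω × ℝ => (Y j a.1).1 := (hY j).fst.comp measurable_fst
  have h2 : Measurable fun a : Ω × ℝ => (Y j a.1).2 := (hY j).snd.comp measurable_fst
  fun_prop

theorem measurable_dpsiHat (hY : ∀ j, Measurable (Y j)) :
    Measurable fun a : Ω × ℝ => dpsiHat (fun j => Y j a.1) 0 a.2 := by
  unfold dpsiHat
  refine measurable_const.mul (Finset.measurable_sum _ fun j _ => ?_)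
  have h1 : Measurable fun a : Ω × ℝ => (Y j a.1).1 := (hY j).fst.comp measurable_fst
  have h2 : Measurable fun a : Ω × ℝ => (Y j a.1).2 := (hY j).snd.comp measurable_fst
  fun_prop

theorem measurable_psiTilde (hY : ∀ j, Measurable (Y j)) :
    Measurable fun a : Ω × ℝ => psiTilde (fun j => Y j a.1) a.2 :=
  (measurable_regularize n).comp (measurable_psiHat hY)

theorem measurable_invError (hY : ∀ j, Measurable (Y j)) :
    Measurable fun a : Ω × ℝ => invError μX με (fun j => Y j a.1) a.2 := by
  have h1 := measurable_psiTilde hY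
  have h2 : Measurable (phiY μX με) := continuous_phiY.measurable
  unfold invError
  fun_prop

theorem measurable_derivError (hX : MemLp id 2 μX) (hY : ∀ j, Measurable (Y j)) :
    Measurable fun a : Ω × ℝ => derivError μX με (fun j => Y j a.1) a.2 := by
  have h1 := measurable_dpsiHat hY
  have h2 := (continuous_deriv_charFun hX).measurable
  unfold derivError
  fun_prop

end Measurability

/-- The deterministic bound is quadratic in `√n |ψ̂ - φ_Y|`, so moments of order `4p` of the
empirical characteristic function are needed; they are all bounded after scaling. The constant `64`
is `4 · 16`, from `(2/√n)^(2p) = 4^p n^(-p)` and `(1 + x)^(4p) ≤ 16^p (1 + x^(4p))`. -/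
theorem exists_lintegral_invError_le (p : ℕ) (hp : 1 ≤ p) : ∃ C : ℝ≥0∞, C ≠ ∞ ∧
    ∀ (μX με : Measure ℝ) [IsProbabilityMeasure μX] [IsProbabilityMeasure με]
      (Ω : Type u) [MeasurableSpace Ω] (P : Measure Ω) [IsProbabilityMeasure P]
      (n : ℕ) (Y : Fin n → Ω → ℝ × ℝ), 0 < n → IsSample P μX με Y → RegularModel μX με → ∀ z : ℝ,
        ∫⁻ ω, (‖phiY μX με z‖ₑ ^ 2 * ‖invError μX με (fun j => Y j ω) z‖ₑ) ^ (2 * p) ∂P ≤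
          C * (n : ℝ≥0∞)⁻¹ ^ p := by
  obtain ⟨C, hC, h⟩ := exists_lintegral_psiHat_sub_le.{u} (2 * p) (by omega)
  refine ⟨64 ^ p * (1 + C), by finiteness, fun μX με _ _ Ω _ P _ n Y hn hY hM z => ?_⟩
  have hφ : phiY μX με z ≠ 0 := by
    rw [phiY_eq]
    exact mul_ne_zero (hM.charFun_X_ne_zero z) (hM.charFun_eps_ne_zero z)
  have hn0 : (n : ℝ≥0∞) ≠ 0 := by exact_mod_cast hn.ne'
  have hnt : (n : ℝ≥0∞) ≠ ∞ := ENNReal.natCast_ne_top n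
  have hnpos : (0 : ℝ) < n := by exact_mod_cast hn
  have hs : 0 < Real.sqrt n := Real.sqrt_pos.2 hnpos
  have hpt : ∀ ω, (‖phiY μX με z‖ₑ ^ 2 * ‖invError μX με (fun j => Y j ω) z‖ₑ) ^ (2 * p)
      ≤ 64 ^ p * (n : ℝ≥0∞)⁻¹ ^ p * (1 + (n : ℝ≥0∞) ^ (2 * p)
        * ‖psiHat (fun j => Y j ω) 0 z - phiY μX με z‖ₑ ^ (2 * (2 * p))) := by
    intro ω
    set S := psiHat (fun j => Y j ω) 0 z - phiY μX με z with hS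
    have h1 := norm_sq_mul_norm_inv_regularize_sub_le hn (psiHat (fun j => Y j ω) 0 z) hφ
    rw [← hS] at h1
    have h2 : ‖phiY μX με z‖ₑ ^ 2 * ‖invError μX με (fun j => Y j ω) z‖ₑ
        ≤ ENNReal.ofReal (2 / Real.sqrt n * (1 + Real.sqrt n * ‖S‖) ^ 2) := by
      rw [← ofReal_norm, ← ofReal_norm, ← ENNReal.ofReal_pow (norm_nonneg _),
        ← ENNReal.ofReal_mul (by positivity)]
      exact ENNReal.ofReal_le_ofReal h1
    refine (pow_le_pow_left₀ zero_le h2 _).trans ?_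
    rw [← ENNReal.ofReal_pow (by positivity), ← ofReal_norm,
      ← ENNReal.ofReal_pow (norm_nonneg _)]
    have e1 : (n : ℝ≥0∞)⁻¹ = ENNReal.ofReal (n : ℝ)⁻¹ := by
      rw [ENNReal.ofReal_inv_of_pos hnpos, ENNReal.ofReal_natCast]
    have e2 : (64 : ℝ≥0∞) ^ p * (n : ℝ≥0∞)⁻¹ ^ p * (1 + (n : ℝ≥0∞) ^ (2 * p)
        * ENNReal.ofReal (‖S‖ ^ (2 * (2 * p))))
        = ENNReal.ofReal (64 ^ p * (n : ℝ)⁻¹ ^ p * (1 + (n : ℝ) ^ (2 * p)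
          * ‖S‖ ^ (2 * (2 * p)))) := by
      rw [ENNReal.ofReal_mul (by positivity), ENNReal.ofReal_mul (by positivity),
        ENNReal.ofReal_add (by positivity) (by positivity), ENNReal.ofReal_mul (by positivity),
        ENNReal.ofReal_pow (by norm_num : (0 : ℝ) ≤ 64),
        ENNReal.ofReal_pow (by positivity : 0 ≤ (n : ℝ)⁻¹), ← e1,
        ENNReal.ofReal_pow hnpos.le, ENNReal.ofReal_natCast, ENNReal.ofReal_one,
        ENNReal.ofReal_ofNat]
    rw [e2]
    refine ENNReal.ofReal_le_ofReal ?_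
    set x := Real.sqrt n * ‖S‖ with hx
    have hx0 : 0 ≤ x := by positivity
    have hss : Real.sqrt n ^ 2 = n := Real.sq_sqrt hnpos.le
    have e3 : (n : ℝ) ^ (2 * p) * ‖S‖ ^ (2 * (2 * p)) = x ^ (2 * (2 * p)) := by
      rw [hx, mul_pow, pow_mul (Real.sqrt n), hss]
    have e4 : (2 / Real.sqrt n * (1 + x) ^ 2) ^ (2 * p)
        = 4 ^ p * (n : ℝ)⁻¹ ^ p * (1 + x) ^ (2 * (2 * p)) := by
      rw [mul_pow, ← pow_mul, pow_mul (2 / _), div_pow, hss, div_eq_mul_inv, mul_pow]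
      norm_num
    have e5 : (1 + x) ^ (2 * (2 * p)) ≤ 16 ^ p * (1 + x ^ (2 * (2 * p))) := by
      have := add_pow_le (zero_le_one (α := ℝ)) hx0 (2 * (2 * p))
      rw [one_pow] at this
      refine this.trans ?_
      have : (2 : ℝ) ^ (2 * (2 * p) - 1) ≤ 16 ^ p := by
        calc (2 : ℝ) ^ (2 * (2 * p) - 1) ≤ 2 ^ (2 * (2 * p)) :=
              pow_le_pow_right₀ (by norm_num) (by omega)
          _ = 16 ^ p := by rw [← mul_assoc, pow_mul]; norm_num
      gcongr
    rw [e3, e4]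
    calc 4 ^ p * (n : ℝ)⁻¹ ^ p * (1 + x) ^ (2 * (2 * p))
        ≤ 4 ^ p * (n : ℝ)⁻¹ ^ p * (16 ^ p * (1 + x ^ (2 * (2 * p)))) := by gcongr
      _ = (4 * 16) ^ p * (n : ℝ)⁻¹ ^ p * (1 + x ^ (2 * (2 * p))) := by rw [mul_pow 4 16]; ring
      _ = _ := by norm_num
  have hmeas : Measurable fun ω => psiHat (fun j => Y j ω) 0 z - phiY μX με z :=
    ((measurable_psiHat hY.measurable).comp (by fun_prop : Measurable fun ω : Ω => (ω, z))).sub_const _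
  calc _ ≤ _ := lintegral_mono hpt
    _ = 64 ^ p * (n : ℝ≥0∞)⁻¹ ^ p * (1 + (n : ℝ≥0∞) ^ (2 * p) *
        ∫⁻ ω, ‖psiHat (fun j => Y j ω) 0 z - phiY μX με z‖ₑ ^ (2 * (2 * p)) ∂P) := by
        rw [lintegral_const_mul _ (by fun_prop), lintegral_add_left (by fun_prop),
          lintegral_const_mul _ (by fun_prop)]
        simp
    _ ≤ 64 ^ p * (n : ℝ≥0∞)⁻¹ ^ p * (1 + (n : ℝ≥0∞) ^ (2 * p) *
        (C * (n : ℝ≥0∞)⁻¹ ^ (2 * p))) := by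
        gcongr
        exact h μX με Ω P n Y hn hY z
    _ = _ := by
        have : (n : ℝ≥0∞) ^ (2 * p) * (C * (n : ℝ≥0∞)⁻¹ ^ (2 * p)) = C := by
          rw [mul_left_comm, ← mul_pow, ENNReal.mul_inv_cancel hn0 hnt, one_pow, mul_one]
        rw [this]
        ring

/-! ### The fluctuation of the logarithmic derivative estimator -/

/-- The part of the fluctuation that is linear in the empirical derivative. -/
noncomputable def fluctLin (μX με : Measure ℝ) {n : ℕ} (y : Fin n → ℝ × ℝ) (u : ℝ) : ℝ≥0∞ :=
  ‖∫ z in Set.Ioc 0 u, derivError μX με y z * (1 / phiY μX με z)‖ₑ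

/-- The part of the fluctuation due to the regularized inverse. -/
noncomputable def fluctInv (μX με : Measure ℝ) {n : ℕ} (y : Fin n → ℝ × ℝ) (u : ℝ) : ℝ≥0∞ :=
  ∫⁻ z in Set.Ioc 0 u, ‖deriv (charFun μX) z / charFun μX z‖ₑ
    * (‖phiY μX με z‖ₑ * ‖invError μX με y z‖ₑ)

/-- The part of the fluctuation in which both errors are multiplied. -/
noncomputable def fluctMixed (μX με : Measure ℝ) {n : ℕ} (y : Fin n → ℝ × ℝ) (u : ℝ) : ℝ≥0∞ :=
  ∫⁻ z in Set.Ioc 0 u, ‖derivError μX με y z‖ₑ * ‖invError μX με y z‖ₑ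

section Basic

variable {μX με : Measure ℝ} [IsProbabilityMeasure μX] [IsProbabilityMeasure με]

theorem RegularModel.phiY_ne_zero (hM : RegularModel μX με) (z : ℝ) : phiY μX με z ≠ 0 := by
  rw [phiY_eq]
  exact mul_ne_zero (hM.charFun_X_ne_zero z) (hM.charFun_eps_ne_zero z)

theorem intInvSq_eq_Ioc {φ : ℝ → ℂ} {u : ℝ} (hu : 0 ≤ u) :
    intInvSq φ u = ∫⁻ z in Set.Ioc 0 u, (‖φ z‖ₑ ^ 2)⁻¹ := by
  rw [intInvSq, abs_of_nonneg hu]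
  exact (setLIntegral_congr Ioc_ae_eq_Icc).symm

theorem enorm_one_div_sq {φ : ℂ} (hφ : φ ≠ 0) : ‖1 / φ‖ₑ ^ 2 = (‖φ‖ₑ ^ 2)⁻¹ := by
  rw [one_div, enorm_inv hφ, ENNReal.inv_pow]

theorem enorm_sq_ne_zero {φ : ℂ} (hφ : φ ≠ 0) : ‖φ‖ₑ ^ 2 ≠ 0 := by
  simpa using hφ

theorem integrable_one_div_phiY (hM : RegularModel μX με) (u : ℝ) :
    IntegrableOn (fun z => 1 / phiY μX με z) (Set.Ioc 0 u) := by
  have hc : Continuous fun z => 1 / phiY μX με z :=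
    continuous_const.div continuous_phiY hM.phiY_ne_zero
  exact (hc.integrableOn_Icc).mono_set Set.Ioc_subset_Icc_self

theorem intInvSq_lt_top {φ : ℝ → ℂ} (hc : Continuous φ) (h0 : ∀ z, φ z ≠ 0) (u : ℝ) :
    intInvSq φ u < ∞ := by
  have hc' : Continuous fun z => ‖1 / φ z‖ ^ 2 := (continuous_const.div hc h0).norm.pow 2
  have := (hc'.integrableOn_Icc (a := 0) (b := |u|) (μ := volume)).2
  rw [hasFiniteIntegral_iff_enorm] at this
  refine lt_of_le_of_lt (lintegral_mono fun z => ?_) this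
  rw [← enorm_one_div_sq (h0 z), enorm_pow, enorm_norm]

theorem momentY_lt_top_of_le {m k : ℕ} (hk : k ≠ 0) (hkm : k ≤ m) (h : momentY μX με m < ∞) :
    momentY μX με k < ∞ := by
  have h1 : MemLp (fun y : ℝ × ℝ => y.1) k (lawY μX με) :=
    (memLp_fst_lawY (by omega) h).mono_exponent (by exact_mod_cast hkm)
  have h2 := h1.2
  rw [eLpNorm_lt_top_iff_lintegral_rpow_enorm_lt_top (by exact_mod_cast hk) (by simp)] at h2
  simpa [momentY] using h2

end Basic

/-- The linear part is the deviation of an empirical mean of `linFun` with weight `1/φ_Y`. In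
Rosenthal's bound the variance is estimated through the covariance kernel, the top moment crudely by
Cauchy-Schwarz in `z`; the latter yields the factor `u^p`, compensated by `n^(1-p)`. -/
theorem exists_lintegral_fluctLin_le (p : ℕ) (hp : 1 ≤ p) : ∃ C : ℝ≥0∞, C ≠ ∞ ∧
    ∀ (μX με : Measure ℝ) [IsProbabilityMeasure μX] [IsProbabilityMeasure με]
      (Ω : Type u) [MeasurableSpace Ω] (P : Measure Ω) [IsProbabilityMeasure P]
      (n : ℕ) (Y : Fin n → Ω → ℝ × ℝ), 0 < n → IsSample P μX με Y → RegularModel μX με →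
      momentY μX με (2 * p) < ∞ → ∀ u : ℝ, 0 ≤ u →
        ∫⁻ ω, fluctLin μX με (fun j => Y j ω) u ^ (2 * p) ∂P ≤
          C * ((n : ℝ≥0∞)⁻¹ ^ p * intInvSq (phiY μX με) u ^ p *
            ((∫⁻ z, ‖covKernel μX με z‖ₑ) ^ p
              + if 2 ≤ p then momentY μX με (2 * p) * ENNReal.ofReal u ^ p / (n : ℝ≥0∞) ^ (p - 1)
                else 0)) := by
  obtain ⟨C, hC, h⟩ := exists_lintegral_empirical_mean_le.{u} p hp
  refine ⟨C * 2 ^ (p + 1), by finiteness, fun μX με _ _ Ω _ P _ n Y hn hY hM hmom u hu => ?_⟩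
  have hmom2 : momentY μX με 2 < ∞ := momentY_lt_top_of_le (by norm_num) (by omega) hmom
  set g : ℝ → ℂ := fun z => 1 / phiY μX με z with hgdef
  have hgm : Measurable g := measurable_const.div continuous_phiY.measurable
  have hgi : Integrable g (volume.restrict (Set.Ioc 0 u)) := integrable_one_div_phiY hM u
  have hJ : ∫⁻ z in Set.Ioc 0 u, ‖g z‖ₑ ^ 2 = intInvSq (phiY μX με) u := by
    rw [intInvSq_eq_Ioc hu]
    exact lintegral_congr fun z => enorm_one_div_sq (hM.phiY_ne_zero z)
  have hJt : intInvSq (phiY μX με) u < ∞ := intInvSq_lt_top continuous_phiY hM.phiY_ne_zero u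
  set τ := volume.restrict (Set.Ioc 0 u) with hτ
  have hτu : τ Set.univ = ENNReal.ofReal u := by simp [hτ]
  set J := intInvSq (phiY μX με) u
  set k := ∫⁻ z, ‖covKernel μX με z‖ₑ
  set F := linFun τ g with hF
  have hFm : Measurable F := measurable_linFun hgm
  have h2 : ∫⁻ y, ‖F y‖ₑ ^ 2 ∂(lawY μX με) ≤ 2 * k * J := by
    have := lintegral_linFun_sq_le hmom2 hgi hgm
    rwa [hJ] at this
  have h3 : ∫⁻ y, ‖F y‖ₑ ^ (2 * p) ∂(lawY μX με)
      ≤ momentY μX με (2 * p) * (ENNReal.ofReal u * J) ^ p := by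
    have := lintegral_linFun_pow_le (μX := μX) (με := με) (τ := τ) hgm (p := p)
    rwa [hJ, hτu] at this
  have hFL : MemLp F ((2 * p : ℕ) : ℝ≥0∞) (lawY μX με) :=
    memLp_of_lintegral_enorm_pow_lt_top hFm.aestronglyMeasurable (by omega)
      (h3.trans_lt (by finiteness))
  have key := h μX με Ω P n Y hn hY F hFm hFL
  have hdi : Integrable (fun z => deriv (charFun μX) z * charFun με z * g z) τ := by
    have hc : Continuous fun z => deriv (charFun μX) z * charFun με z * g z :=
      ((continuous_deriv_charFun hM.memLp_X).mul continuous_charFun).mul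
        (continuous_const.div continuous_phiY hM.phiY_ne_zero)
    exact hc.integrableOn_Icc.mono_set Set.Ioc_subset_Icc_self
  have e : ∀ ω, fluctLin μX με (fun j => Y j ω) u
      = ‖1 / (n : ℂ) * ∑ j, F (Y j ω) - ∫ y, F y ∂(lawY μX με)‖ₑ := by
    intro ω
    rw [hF, integral_linFun hM hmom2 hgi hgm, mean_linFun (fun j => Y j ω) hgi, ← integral_sub]
    · rw [fluctLin]
      congr 2
      funext z
      simp only [derivError, hgdef]
      ring
    · have : Integrable (fun z : ℝ => 1 / (n : ℂ) * ∑ j, I * (Y j ω).1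
          * exp (I * ((0 : ℝ) * (Y j ω).1 + z * (Y j ω).2)) * g z) τ :=
        (integrable_finsetSum _ fun j _ => integrable_fst_mul_exp_mul (Y j ω) hgi).const_mul _
      refine this.congr (Filter.Eventually.of_forall fun z => ?_)
      simp only [dpsiHat, Finset.sum_mul, mul_assoc]
    · exact hdi
  simp only [e]
  refine key.trans ?_
  rw [mul_assoc C]
  refine mul_le_mul' le_rfl ?_
  set N := (n : ℝ≥0∞)⁻¹ with hN
  by_cases hp2 : 2 ≤ p
  · rw [if_pos hp2]
    have hdiv : momentY μX με (2 * p) * ENNReal.ofReal u ^ p / (n : ℝ≥0∞) ^ (p - 1)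
        = momentY μX με (2 * p) * ENNReal.ofReal u ^ p * N ^ (p - 1) := by
      rw [div_eq_mul_inv, hN, ENNReal.inv_pow]
    rw [hdiv]
    set m := momentY μX με (2 * p)
    set U := ENNReal.ofReal u
    calc _ ≤ N ^ p * ((2 * k * J) ^ p + N ^ (p - 1) * (m * (U * J) ^ p)) := by gcongr
      _ = N ^ p * J ^ p * (2 ^ p * k ^ p + 1 * (m * U ^ p * N ^ (p - 1))) := by
          simp only [mul_pow]; ring
      _ ≤ N ^ p * J ^ p * (2 ^ (p + 1) * k ^ p + 2 ^ (p + 1) * (m * U ^ p * N ^ (p - 1))) := by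
          gcongr
          · norm_num
          · omega
          · exact one_le_pow₀ (by norm_num)
      _ = _ := by ring
  -- For `p = 1` the top moment is itself the variance, so the kernel bound serves for both. Hence
  -- the moment term of `G` is present only for `p ≥ 2`.
  · have hp1 : p = 1 := by omega
    subst hp1
    rw [if_neg hp2]
    simp only [pow_one, mul_one, Nat.sub_self, pow_zero, one_mul, add_zero] at h2 ⊢
    calc _ ≤ N * (2 * k * J + 2 * k * J) := by gcongr
      _ = _ := by ring

/-- Jensen's and Tonelli's theorems for weighted integrals of a random function. -/
theorem lintegral_lintegral_mul_pow_le {Ω : Type*} [MeasurableSpace Ω] {P : Measure Ω}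
    [SFinite P] {τ : Measure ℝ} [SFinite τ] {w : ℝ → ℝ≥0∞} {f : Ω → ℝ → ℝ≥0∞} (hw : Measurable w)
    (hf : Measurable fun a : Ω × ℝ => f a.1 a.2) {p : ℕ} (hp : 1 ≤ p) {B : ℝ≥0∞}
    (hB : ∀ z, ∫⁻ ω, f ω z ^ p ∂P ≤ B) :
    ∫⁻ ω, (∫⁻ z, w z * f ω z ∂τ) ^ p ∂P ≤ (∫⁻ z, w z ∂τ) ^ p * B := by
  have hpt : ∀ ω, (∫⁻ z, w z * f ω z ∂τ) ^ p
      ≤ (∫⁻ z, w z ∂τ) ^ (p - 1) * ∫⁻ z, w z * f ω z ^ p ∂τ := fun ω =>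
    lintegral_mul_pow_le hw.aemeasurable
      (hf.comp (measurable_prodMk_left (x := ω))).aemeasurable hp
  have hm2 : Measurable (Function.uncurry fun ω z => w z * f ω z ^ p) :=
    (hw.comp measurable_snd).mul (hf.pow_const p)
  calc _ ≤ _ := lintegral_mono hpt
    _ = (∫⁻ z, w z ∂τ) ^ (p - 1) * ∫⁻ ω, ∫⁻ z, w z * f ω z ^ p ∂τ ∂P := by
        rw [lintegral_const_mul _ hm2.lintegral_prod_right]
    _ = (∫⁻ z, w z ∂τ) ^ (p - 1) * ∫⁻ z, w z * ∫⁻ ω, f ω z ^ p ∂P ∂τ := by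
        rw [lintegral_lintegral_swap hm2.aemeasurable]
        congr 1
        refine lintegral_congr fun z => ?_
        have hfz : Measurable fun ω => f ω z := hf.comp (measurable_prodMk_right (y := z))
        rw [lintegral_const_mul _ (hfz.pow_const p)]
    _ ≤ (∫⁻ z, w z ∂τ) ^ (p - 1) * ∫⁻ z, w z * B ∂τ := by
        gcongr with z
        exact hB z
    _ = (∫⁻ z, w z ∂τ) ^ (p - 1) * ((∫⁻ z, w z ∂τ) * B) := by
        rw [lintegral_mul_const _ hw]
    _ = _ := by
        obtain ⟨r, rfl⟩ : ∃ r, p = r + 1 := ⟨p - 1, by omega⟩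
        rw [Nat.add_sub_cancel, pow_succ, mul_assoc]

theorem inv_sq_mul_sq_mul {φ : ℂ} (hφ : φ ≠ 0) (x : ℝ≥0∞) :
    (‖φ‖ₑ ^ 2)⁻¹ * (‖φ‖ₑ ^ 2 * x) = x := by
  rw [← mul_assoc, ENNReal.inv_mul_cancel (enorm_sq_ne_zero hφ) (by finiteness), one_mul]

theorem measurable_phiY {μX με : Measure ℝ} [IsProbabilityMeasure μX] [IsProbabilityMeasure με] :
    Measurable (phiY μX με) := continuous_phiY.measurable

theorem measurable_sq_mul_invError {μX με : Measure ℝ} [IsProbabilityMeasure μX]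
    [IsProbabilityMeasure με] {Ω : Type*} [MeasurableSpace Ω] {n : ℕ} {Y : Fin n → Ω → ℝ × ℝ}
    (hY : ∀ j, Measurable (Y j)) :
    Measurable fun a : Ω × ℝ =>
      ‖phiY μX με a.2‖ₑ ^ 2 * ‖invError μX με (fun j => Y j a.1) a.2‖ₑ :=
  ((measurable_phiY.comp measurable_snd).enorm.pow_const 2).mul (measurable_invError hY).enorm

/-- Cauchy-Schwarz in `z` separates `φ_X'/φ_X`. What remains is the integral of `(|φ_Y|² |Q|)²` with
weight `|φ_Y|^(-2)`, `Q` being the inverse error, to which Jensen and Tonelli apply. -/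
theorem exists_lintegral_fluctInv_le (p : ℕ) (hp : 1 ≤ p) : ∃ C : ℝ≥0∞, C ≠ ∞ ∧
    ∀ (μX με : Measure ℝ) [IsProbabilityMeasure μX] [IsProbabilityMeasure με]
      (Ω : Type u) [MeasurableSpace Ω] (P : Measure Ω) [IsProbabilityMeasure P]
      (n : ℕ) (Y : Fin n → Ω → ℝ × ℝ), 0 < n → IsSample P μX με Y → RegularModel μX με →
      ∀ u : ℝ, 0 ≤ u →
        ∫⁻ ω, fluctInv μX με (fun j => Y j ω) u ^ (2 * p) ∂P ≤
          C * ((n : ℝ≥0∞)⁻¹ ^ p * intInvSq (phiY μX με) u ^ p *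
            (∫⁻ z in Set.Ioc 0 u, ‖deriv (charFun μX) z / charFun μX z‖ₑ ^ 2) ^ p) := by
  obtain ⟨C, hC, h⟩ := exists_lintegral_invError_le.{u} p hp
  refine ⟨C, by finiteness, fun μX με _ _ Ω _ P _ n Y hn hY hM u hu => ?_⟩
  rw [intInvSq_eq_Ioc hu]
  have hwm : Measurable fun z => (‖phiY μX με z‖ₑ ^ 2)⁻¹ :=
    (measurable_phiY.enorm.pow_const 2).inv
  have hVm := measurable_sq_mul_invError (μX := μX) (με := με) hY.measurable
  have hLm : Measurable fun z => ‖deriv (charFun μX) z / charFun μX z‖ₑ :=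
    ((continuous_deriv_charFun hM.memLp_X).measurable.div continuous_charFun.measurable).enorm
  have hpt : ∀ ω, fluctInv μX με (fun j => Y j ω) u ^ (2 * p)
      ≤ (∫⁻ z in Set.Ioc 0 u, ‖deriv (charFun μX) z / charFun μX z‖ₑ ^ 2) ^ p *
        (∫⁻ z in Set.Ioc 0 u, (‖phiY μX με z‖ₑ ^ 2)⁻¹ *
          (‖phiY μX με z‖ₑ ^ 2 * ‖invError μX με (fun j => Y j ω) z‖ₑ) ^ 2) ^ p := by
    intro ω
    have hQω : Measurable fun z => ‖invError μX με (fun j => Y j ω) z‖ₑ :=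
      ((measurable_invError hY.measurable).comp (measurable_prodMk_left (x := ω))).enorm
    have hPQ : Measurable fun z => ‖phiY μX με z‖ₑ * ‖invError μX με (fun j => Y j ω) z‖ₑ :=
      measurable_phiY.enorm.mul hQω
    rw [pow_mul, ← mul_pow]
    refine pow_le_pow_left₀ zero_le ?_ p
    refine (lintegral_mul_sq_le hLm.aemeasurable hPQ.aemeasurable).trans (le_of_eq ?_)
    congr 1
    refine lintegral_congr fun z => ?_
    rw [mul_pow, mul_pow, sq (‖phiY μX με z‖ₑ ^ 2), mul_assoc,
      inv_sq_mul_sq_mul (hM.phiY_ne_zero z)]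
  refine (lintegral_mono hpt).trans ?_
  have hm : Measurable fun ω => (∫⁻ z in Set.Ioc 0 u, (‖phiY μX με z‖ₑ ^ 2)⁻¹ *
      (‖phiY μX με z‖ₑ ^ 2 * ‖invError μX με (fun j => Y j ω) z‖ₑ) ^ 2) ^ p := by
    have : Measurable (Function.uncurry fun (ω : Ω) (z : ℝ) => (‖phiY μX με z‖ₑ ^ 2)⁻¹ *
      (‖phiY μX με z‖ₑ ^ 2 * ‖invError μX με (fun j => Y j ω) z‖ₑ) ^ 2) :=
        (hwm.comp measurable_snd).mul (hVm.pow_const 2)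
    exact this.lintegral_prod_right.pow_const p
  rw [lintegral_const_mul _ hm]
  have key := lintegral_lintegral_mul_pow_le (P := P) (τ := volume.restrict (Set.Ioc 0 u))
    (f := fun ω z => (‖phiY μX με z‖ₑ ^ 2 * ‖invError μX με (fun j => Y j ω) z‖ₑ) ^ 2)
    hwm (hVm.pow_const 2) hp (B := C * (n : ℝ≥0∞)⁻¹ ^ p)
    (fun z => by simpa only [← pow_mul] using h μX με Ω P n Y hn hY hM z)
  refine (mul_le_mul' le_rfl key).trans (le_of_eq ?_)
  ring

theorem ennreal_sq_rpow_half (x : ℝ≥0∞) : (x ^ 2) ^ (1 / 2 : ℝ) = x := by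
  rw [← ENNReal.rpow_natCast, ← ENNReal.rpow_mul]
  norm_num

/-- Cauchy-Schwarz in the sample separates the two errors at the same `z`, whence the square root of
the moment. A product of two errors is already of order `1/n`, so the power `p` gives the rate that
the other parts have with the power `2p`. -/
theorem exists_lintegral_fluctMixed_le (p : ℕ) (hp : 1 ≤ p) : ∃ C : ℝ≥0∞, C ≠ ∞ ∧
    ∀ (μX με : Measure ℝ) [IsProbabilityMeasure μX] [IsProbabilityMeasure με]
      (Ω : Type u) [MeasurableSpace Ω] (P : Measure Ω) [IsProbabilityMeasure P]
      (n : ℕ) (Y : Fin n → Ω → ℝ × ℝ), 0 < n → IsSample P μX με Y → RegularModel μX με →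
      momentY μX με (2 * p) < ∞ → ∀ u : ℝ, 0 ≤ u →
        ∫⁻ ω, fluctMixed μX με (fun j => Y j ω) u ^ p ∂P ≤
          C * ((n : ℝ≥0∞)⁻¹ ^ p * intInvSq (phiY μX με) u ^ p *
            momentY μX με (2 * p) ^ (1 / 2 : ℝ)) := by
  obtain ⟨C, hC, h⟩ := exists_lintegral_invError_le.{u} p hp
  obtain ⟨C', hC', h'⟩ := exists_lintegral_dpsiHat_sub_le.{u} p hp
  refine ⟨(C' * C) ^ (1 / 2 : ℝ), by finiteness, fun μX με _ _ Ω _ P _ n Y hn hY hM hmom u hu => ?_⟩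
  rw [intInvSq_eq_Ioc hu]
  have hwm : Measurable fun z => (‖phiY μX με z‖ₑ ^ 2)⁻¹ :=
    (measurable_phiY.enorm.pow_const 2).inv
  have hVm := measurable_sq_mul_invError (μX := μX) (με := με) hY.measurable
  have hDm := (measurable_derivError (με := με) hM.memLp_X hY.measurable).enorm
  have e : ∀ ω, fluctMixed μX με (fun j => Y j ω) u = ∫⁻ z in Set.Ioc 0 u,
      (‖phiY μX με z‖ₑ ^ 2)⁻¹ * (‖derivError μX με (fun j => Y j ω) z‖ₑ *
        (‖phiY μX με z‖ₑ ^ 2 * ‖invError μX με (fun j => Y j ω) z‖ₑ)) := fun ω =>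
    lintegral_congr fun z => by
      rw [mul_left_comm, inv_sq_mul_sq_mul (hM.phiY_ne_zero z)]
  simp only [e]
  have hz : ∀ z, ∫⁻ ω, (‖derivError μX με (fun j => Y j ω) z‖ₑ *
        (‖phiY μX με z‖ₑ ^ 2 * ‖invError μX με (fun j => Y j ω) z‖ₑ)) ^ p ∂P
      ≤ (C' * C) ^ (1 / 2 : ℝ) * ((n : ℝ≥0∞)⁻¹ ^ p * momentY μX με (2 * p) ^ (1 / 2 : ℝ)) := by
    intro z
    have hVz := (hVm.comp (measurable_prodMk_right (y := z))).pow_const p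
    have hDz := (hDm.comp (measurable_prodMk_right (y := z))).pow_const p
    have h1 : (∫⁻ ω, (‖derivError μX με (fun j => Y j ω) z‖ₑ *
        (‖phiY μX με z‖ₑ ^ 2 * ‖invError μX με (fun j => Y j ω) z‖ₑ)) ^ p ∂P) ^ 2
        ≤ C' * C * (((n : ℝ≥0∞)⁻¹ ^ p) ^ 2 * momentY μX με (2 * p)) := by
      simp_rw [mul_pow (‖derivError _ _ _ _‖ₑ)]
      refine (lintegral_mul_sq_le hDz.aemeasurable hVz.aemeasurable).trans ?_
      have hD := h' μX με Ω P n Y hn hY hM hmom z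
      have hV := h μX με Ω P n Y hn hY hM z
      rw [mul_comm 2 p] at hD hV
      simp_rw [pow_mul _ p 2] at hD hV
      refine (mul_le_mul' hD hV).trans (le_of_eq ?_)
      rw [mul_comm p 2]
      ring
    have h2 := ENNReal.rpow_le_rpow h1 (by norm_num : (0 : ℝ) ≤ 1 / 2)
    rwa [ennreal_sq_rpow_half, ENNReal.mul_rpow_of_nonneg _ _ (by norm_num),
      ENNReal.mul_rpow_of_nonneg _ (momentY μX με (2 * p)) (by norm_num),
      ennreal_sq_rpow_half] at h2
  have key := lintegral_lintegral_mul_pow_le (P := P) (τ := volume.restrict (Set.Ioc 0 u))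
    (f := fun ω z => ‖derivError μX με (fun j => Y j ω) z‖ₑ *
        (‖phiY μX με z‖ₑ ^ 2 * ‖invError μX με (fun j => Y j ω) z‖ₑ))
    hwm (hDm.mul hVm) hp hz
  refine key.trans (le_of_eq ?_)
  ring

/-- The moments of order `2p`, `2p` and `p` of the three parts of the fluctuation. -/
noncomputable def fluct (μX με : Measure ℝ) {n : ℕ} (y : Fin n → ℝ × ℝ) (p : ℕ) (u : ℝ) : ℝ≥0∞ :=
  fluctLin μX με y u ^ (2 * p) + fluctInv μX με y u ^ (2 * p) + fluctMixed μX με y u ^ p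

section FluctMeasurable

variable {μX με : Measure ℝ} [IsProbabilityMeasure μX] [IsProbabilityMeasure με]
  {Ω : Type*} [MeasurableSpace Ω] {n : ℕ} {Y : Fin n → Ω → ℝ × ℝ}

theorem measurable_fluctLin (hX : MemLp id 2 μX) (hY : ∀ j, Measurable (Y j)) (u : ℝ) :
    Measurable fun ω => fluctLin μX με (fun j => Y j ω) u := by
  have hd := (measurable_derivError (με := με) hX hY).mul
    ((measurable_const (a := (1 : ℂ))).div (measurable_phiY (μX := μX) (με := με))
      |>.comp measurable_snd)
  exact (StronglyMeasurable.integral_prod_right (ν := volume.restrict (Set.Ioc 0 u))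
    (f := fun ω z => derivError μX με (fun j => Y j ω) z * (1 / phiY μX με z))
    (Measurable.stronglyMeasurable hd)).measurable.enorm

theorem measurable_fluctInv (hX : MemLp id 2 μX) (hY : ∀ j, Measurable (Y j)) (u : ℝ) :
    Measurable fun ω => fluctInv μX με (fun j => Y j ω) u := by
  have hLm : Measurable fun z => ‖deriv (charFun μX) z / charFun μX z‖ₑ :=
    ((continuous_deriv_charFun hX).measurable.div continuous_charFun.measurable).enorm
  have : Measurable (Function.uncurry fun (ω : Ω) (z : ℝ) =>
      ‖deriv (charFun μX) z / charFun μX z‖ₑ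
        * (‖phiY μX με z‖ₑ * ‖invError μX με (fun j => Y j ω) z‖ₑ)) :=
    (hLm.comp measurable_snd).mul ((measurable_phiY.enorm.comp measurable_snd).mul
      (measurable_invError hY).enorm)
  exact this.lintegral_prod_right

theorem measurable_fluctMixed (hX : MemLp id 2 μX) (hY : ∀ j, Measurable (Y j)) (u : ℝ) :
    Measurable fun ω => fluctMixed μX με (fun j => Y j ω) u := by
  have : Measurable (Function.uncurry fun (ω : Ω) (z : ℝ) =>
      ‖derivError μX με (fun j => Y j ω) z‖ₑ * ‖invError μX με (fun j => Y j ω) z‖ₑ) :=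
    (measurable_derivError hX hY).enorm.mul (measurable_invError hY).enorm
  exact this.lintegral_prod_right

theorem measurable_fluct (hX : MemLp id 2 μX) (hY : ∀ j, Measurable (Y j)) (p : ℕ) (u : ℝ) :
    Measurable fun ω => fluct μX με (fun j => Y j ω) p u :=
  (((measurable_fluctLin hX hY u).pow_const _).add ((measurable_fluctInv hX hY u).pow_const _)).add
    ((measurable_fluctMixed hX hY u).pow_const _)

end FluctMeasurable

theorem lintegral_logDeriv_psi_sq {μX με : Measure ℝ} [IsProbabilityMeasure μX]
    [IsProbabilityMeasure με] (hM : RegularModel μX με) {u : ℝ} (hu : 0 ≤ u) :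
    ∫⁻ x in Set.Icc 0 |u|, ‖logDeriv (fun u₁ : ℝ => psi μX με u₁ x) 0‖ₑ ^ 2
      = ∫⁻ z in Set.Ioc 0 u, ‖deriv (charFun μX) z / charFun μX z‖ₑ ^ 2 := by
  rw [abs_of_nonneg hu, setLIntegral_congr Ioc_ae_eq_Icc]
  refine lintegral_congr fun x => ?_
  rw [logDeriv_psi_eq hM.memLp_X hM.memLp_eps hM.integral_eps x (hM.charFun_eps_ne_zero x)]

/-- The summands of `G` match the parts of the fluctuation: the spectral norms and the moment with
`u^p` belong to the linear part, the logarithmic derivative to the inverse part, the square root of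
the moment to the mixed part. -/
theorem exists_lintegral_fluct_le (p : ℕ) (hp : 1 ≤ p) : ∃ C : ℝ≥0∞, C ≠ ∞ ∧
    ∀ (μX με : Measure ℝ) [IsProbabilityMeasure μX] [IsProbabilityMeasure με]
      (Ω : Type u) [MeasurableSpace Ω] (P : Measure Ω) [IsProbabilityMeasure P]
      (n : ℕ) (Y : Fin n → Ω → ℝ × ℝ), 0 < n → IsSample P μX με Y → RegularModel μX με →
      momentY μX με (2 * p) < ∞ → ∀ u : ℝ, 0 ≤ u →
        ∫⁻ ω, fluct μX με (fun j => Y j ω) p u ∂P ≤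
          C * ((n : ℝ≥0∞)⁻¹ ^ p * intInvSq (phiY μX με) u ^ p * G μX με n p u) := by
  obtain ⟨C₁, hC₁, h₁⟩ := exists_lintegral_fluctLin_le.{u} p hp
  obtain ⟨C₂, hC₂, h₂⟩ := exists_lintegral_fluctInv_le.{u} p hp
  obtain ⟨C₃, hC₃, h₃⟩ := exists_lintegral_fluctMixed_le.{u} p hp
  refine ⟨C₁ + C₂ + C₃, by finiteness, fun μX με _ _ Ω _ P _ n Y hn hY hM hmom u hu => ?_⟩
  simp only [fluct]
  have m1 := (measurable_fluctLin (με := με) hM.memLp_X hY.measurable u).pow_const (2 * p)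
  have m2 := (measurable_fluctInv (με := με) hM.memLp_X hY.measurable u).pow_const (2 * p)
  have m12 : Measurable fun ω => fluctLin μX με (fun j => Y j ω) u ^ (2 * p)
      + fluctInv μX με (fun j => Y j ω) u ^ (2 * p) := m1.add m2
  rw [lintegral_add_left m12, lintegral_add_left m1, add_mul, add_mul]
  have hk := pow_le_pow_left₀ zero_le (lintegral_covKernel_le hM) p
  refine add_le_add (add_le_add ?_ ?_) ?_
  · refine (h₁ μX με Ω P n Y hn hY hM hmom u hu).trans ?_
    rw [G]
    refine mul_le_mul' le_rfl (mul_le_mul' le_rfl ?_)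
    refine le_trans ?_ le_self_add
    gcongr ?_ + _
    refine le_trans ?_ le_self_add
    refine hk.trans ?_
    -- Only the two `L¹` terms are used, since the covariance kernel is uncentred; `‖φ_X' φ_ε‖²` is
    -- added for free.
    exact pow_le_pow_left₀ zero_le le_self_add p
  · refine (h₂ μX με Ω P n Y hn hY hM u hu).trans ?_
    rw [G, lintegral_logDeriv_psi_sq hM hu]
    refine mul_le_mul' le_rfl (mul_le_mul' le_rfl ?_)
    exact le_trans (le_trans le_add_self le_self_add) le_self_add
  · refine (h₃ μX με Ω P n Y hn hY hM hmom u hu).trans ?_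
    rw [G]
    exact mul_le_mul' le_rfl (mul_le_mul' le_rfl le_add_self)

/-! ### The logarithm of the estimator of `φ_X` -/

/-- The error of the estimator of `log φ_X`. -/
noncomputable def logError (μX : Measure ℝ) {n : ℕ} (y : Fin n → ℝ × ℝ) (u : ℝ) : ℂ :=
  ∫ z in (0 : ℝ)..u, (dpsiHat y 0 z / psiTilde y z - deriv (charFun μX) z / charFun μX z)

section Log

variable {μX με : Measure ℝ} [IsProbabilityMeasure μX] [IsProbabilityMeasure με] {n : ℕ}

theorem RegularModel.continuous_logDeriv (hM : RegularModel μX με) :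
    Continuous fun z => deriv (charFun μX) z / charFun μX z :=
  (continuous_deriv_charFun hM.memLp_X).div continuous_charFun hM.charFun_X_ne_zero

theorem RegularModel.hasDerivAt_charFun_X (hM : RegularModel μX με) (u : ℝ) :
    HasDerivAt (charFun μX) (deriv (charFun μX) u) u :=
  (hasDerivAt_charFun hM.memLp_X u).differentiableAt.hasDerivAt

/-- No branch of the logarithm is chosen: `φ_X` times the exponential of minus the primitive has
derivative zero and equals `1` at the origin. -/
theorem RegularModel.charFun_eq_exp (hM : RegularModel μX με) (u : ℝ) :
    charFun μX u = exp (∫ z in (0 : ℝ)..u, deriv (charFun μX) z / charFun μX z) := by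
  have hc := hM.continuous_logDeriv
  set L : ℝ → ℂ := fun z => deriv (charFun μX) z / charFun μX z with hL
  have hd : ∀ v, HasDerivAt (fun v => charFun μX v * exp (-∫ z in (0 : ℝ)..v, L z)) 0 v := by
    intro v
    have h1 : HasDerivAt (fun v => ∫ z in (0 : ℝ)..v, L z) (L v) v :=
      intervalIntegral.integral_hasDerivAt_right (hc.intervalIntegrable _ _)
        (hc.stronglyMeasurableAtFilter _ _) hc.continuousAt
    have h2 := (hM.hasDerivAt_charFun_X v).mul (h1.neg.cexp)
    refine h2.congr_deriv ?_
    have : charFun μX v * L v = deriv (charFun μX) v := by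
      simp only [hL]
      rw [mul_div_cancel₀ _ (hM.charFun_X_ne_zero v)]
    rw [← this]
    ring
  have hconst := is_const_of_deriv_eq_zero (fun v => (hd v).differentiableAt)
    (fun v => (hd v).deriv) u 0
  simp only [intervalIntegral.integral_same, neg_zero, Complex.exp_zero, mul_one,
    charFun_zero, probReal_univ, ofReal_one] at hconst
  rw [Complex.exp_neg] at hconst
  exact (mul_inv_eq_one₀ (Complex.exp_ne_zero _)).1 hconst

theorem norm_dpsiHat_le (y : Fin n → ℝ × ℝ) (z : ℝ) :
    ‖dpsiHat y 0 z‖ ≤ ‖1 / (n : ℂ)‖ * ∑ j, |(y j).1| := by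
  rw [dpsiHat, norm_mul]
  gcongr
  exact (norm_sum_le _ _).trans (Finset.sum_le_sum fun j _ => (norm_I_mul_fst_mul_exp z (y j)).le)

theorem continuous_psiHat (y : Fin n → ℝ × ℝ) : Continuous fun z => psiHat y 0 z := by
  unfold psiHat
  fun_prop

theorem continuous_dpsiHat (y : Fin n → ℝ × ℝ) : Continuous fun z => dpsiHat y 0 z := by
  unfold dpsiHat
  fun_prop

theorem measurable_psiTilde_right (y : Fin n → ℝ × ℝ) : Measurable fun z => psiTilde y z :=
  (measurable_regularize n).comp (continuous_psiHat y).measurable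

theorem intervalIntegrable_dpsiHat_div (hn : 0 < n) (y : Fin n → ℝ × ℝ) (a b : ℝ) :
    IntervalIntegrable (fun z => dpsiHat y 0 z / psiTilde y z) volume a b := by
  have m1 := (continuous_dpsiHat y).measurable
  have m2 := measurable_psiTilde_right y
  refine (intervalIntegrable_const (c := (‖1 / (n : ℂ)‖ * ∑ j, |(y j).1|) * Real.sqrt n)).mono_fun
    (m1.div m2).aestronglyMeasurable (Filter.Eventually.of_forall fun z => ?_)
  refine le_trans ?_ (le_abs_self _)
  simp only [div_eq_mul_one_div (dpsiHat y 0 z), norm_mul (dpsiHat y 0 z)]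
  exact mul_le_mul (norm_dpsiHat_le y z) (norm_inv_regularize_le hn _) (norm_nonneg _)
    (by positivity)

/-- The error of the estimator becomes multiplicative, which makes it relative to the size of `φ_X`.
-/
theorem phiMod_eq (hM : RegularModel μX με) (hn : 0 < n) (y : Fin n → ℝ × ℝ) (u : ℝ) :
    phiMod y u = charFun μX u * exp (logError μX y u) := by
  rw [phiMod, hM.charFun_eq_exp u, ← Complex.exp_add, logError,
    intervalIntegral.integral_sub (intervalIntegrable_dpsiHat_div hn y 0 u)
      (hM.continuous_logDeriv.intervalIntegrable _ _)]
  congr 1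
  ring

theorem enorm_logError_le (hM : RegularModel μX με) (hn : 0 < n) (y : Fin n → ℝ × ℝ) {u : ℝ}
    (hu : 0 ≤ u) :
    ‖logError μX y u‖ₑ ≤ fluctLin μX με y u + (fluctInv μX με y u + fluctMixed μX με y u) := by
  set τ := volume.restrict (Set.Ioc 0 u) with hτ
  have i0 : Integrable (fun z => dpsiHat y 0 z / psiTilde y z
      - deriv (charFun μX) z / charFun μX z) τ :=
    ((intervalIntegrable_dpsiHat_div hn y 0 u).sub
      (hM.continuous_logDeriv.intervalIntegrable _ _)).1
  have hc : Continuous fun z => derivError μX με y z * (1 / phiY μX με z) := by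
    exact ((continuous_dpsiHat y).sub
      ((continuous_deriv_charFun hM.memLp_X).mul continuous_charFun)).mul
        (continuous_const.div continuous_phiY hM.phiY_ne_zero)
  have i1 : Integrable (fun z => derivError μX με y z * (1 / phiY μX με z)) τ :=
    hc.integrableOn_Icc.mono_set Set.Ioc_subset_Icc_self
  -- With `D`, `Q` the errors of the derivative and of the inverse, and `a = φ_X' φ_ε`, this is `(a
  -- + D)(1/φ_Y + Q) - a/φ_Y = D/φ_Y + a Q + D Q`, where `a = (φ_X'/φ_X) φ_Y`.
  have e : ∀ z, dpsiHat y 0 z / psiTilde y z - deriv (charFun μX) z / charFun μX z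
      = derivError μX με y z * (1 / phiY μX με z)
        + (deriv (charFun μX) z / charFun μX z * (phiY μX με z * invError μX με y z)
          + derivError μX με y z * invError μX με y z) := by
    intro z
    have hφ := hM.phiY_ne_zero z
    have h1 := hM.charFun_X_ne_zero z
    have h2 := hM.charFun_eps_ne_zero z
    have hd : deriv (charFun μX) z * charFun με z
        = deriv (charFun μX) z / charFun μX z * phiY μX με z := by
      rw [phiY_eq]; field_simp
    simp only [derivError, invError, hd, div_eq_mul_one_div (dpsiHat y 0 z)]
    have : phiY μX με z * (1 / phiY μX με z) = 1 := by field_simp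
    linear_combination (deriv (charFun μX) z / charFun μX z) * this
  have hQm : Measurable fun z => invError μX με y z :=
    (measurable_const.div (measurable_psiTilde_right y)).sub (measurable_const.div measurable_phiY)
  have hDm : Measurable fun z => derivError μX με y z :=
    (continuous_dpsiHat y).measurable.sub
      ((continuous_deriv_charFun hM.memLp_X).mul continuous_charFun).measurable
  rw [logError, intervalIntegral.integral_of_le hu]
  have i2 : Integrable (fun z => deriv (charFun μX) z / charFun μX z *
      (phiY μX με z * invError μX με y z) + derivError μX με y z * invError μX με y z) τ := by
    refine (i0.sub i1).congr (Filter.Eventually.of_forall fun z => ?_)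
    simp only [Pi.sub_apply, e z]
    ring
  simp_rw [e]
  rw [integral_add i1 i2]
  refine (enorm_add_le _ _).trans (add_le_add le_rfl ?_)
  refine (enorm_integral_le_lintegral_enorm _).trans ?_
  have hDQ : Measurable fun z => ‖derivError μX με y z‖ₑ * ‖invError μX με y z‖ₑ :=
    hDm.enorm.mul hQm.enorm
  rw [fluctInv, fluctMixed, ← lintegral_add_right _ hDQ]
  refine lintegral_mono fun z => ?_
  refine (enorm_add_le _ _).trans (le_of_eq ?_)
  simp only [enorm_mul]

/-- Integrate the derivative of `1/φ_X`, which is `-(φ_X'/φ_X)(1/φ_X)`, from `0` and apply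
Cauchy-Schwarz. In this way a pointwise `|φ_X(u)|^(-2)` is traded for its integral, at the price of
a factor contained in `G`. -/
theorem inv_enorm_charFun_sq_le (hM : RegularModel μX με) {u : ℝ} (hu : 0 ≤ u) :
    (‖charFun μX u‖ₑ ^ 2)⁻¹ ≤ 4 * (1 +
      (∫⁻ z in Set.Ioc 0 u, ‖deriv (charFun μX) z / charFun μX z‖ₑ ^ 2)
        * intInvSq (charFun μX) u) := by
  have hc := hM.continuous_logDeriv
  have hd : ∀ v, HasDerivAt (fun v => (charFun μX v)⁻¹)
      (-(deriv (charFun μX) v / charFun μX v * (1 / charFun μX v))) v := by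
    intro v
    have h0 := hM.charFun_X_ne_zero v
    refine ((hM.hasDerivAt_charFun_X v).inv h0).congr_deriv ?_
    field_simp
  have hci : Continuous fun v => 1 / charFun μX v :=
    continuous_const.div continuous_charFun hM.charFun_X_ne_zero
  have hftc := intervalIntegral.integral_eq_sub_of_hasDerivAt (fun v _ => hd v)
    ((hc.mul hci).neg.intervalIntegrable 0 u)
  have h1 : 1 / charFun μX u = 1 + ∫ v in (0 : ℝ)..u,
      -(deriv (charFun μX) v / charFun μX v * (1 / charFun μX v)) := by
    rw [hftc]
    simp [charFun_zero]
  rw [← enorm_one_div_sq (hM.charFun_X_ne_zero u), h1, intervalIntegral.integral_of_le hu]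
  refine (pow_le_pow_left₀ zero_le (enorm_add_le _ _) 2).trans ?_
  refine (ennreal_add_pow_le _ _ 2).trans ?_
  have h4 : (2 : ℝ≥0∞) ^ 2 = 4 := by norm_num
  rw [h4]
  gcongr
  · simp
  · refine (pow_le_pow_left₀ zero_le (enorm_integral_le_lintegral_enorm _) 2).trans ?_
    simp_rw [enorm_neg, enorm_mul]
    refine (lintegral_mul_sq_le hc.measurable.enorm.aemeasurable
      hci.measurable.enorm.aemeasurable).trans (le_of_eq ?_)
    rw [intInvSq_eq_Ioc hu]
    simp_rw [enorm_one_div_sq (hM.charFun_X_ne_zero _)]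

end Log

/-! ### Truncation -/

/-- If `|m| > 1`, truncation moves `m` by `|m| - 1`, which is at most `|m| - |φ|` and so at most `|m
- φ|`. -/
theorem norm_truncate_sub_le {m φ : ℂ} (hφ : ‖φ‖ ≤ 1) :
    ‖m / ((max 1 ‖m‖ : ℝ) : ℂ) - φ‖ ≤ 2 * ‖m - φ‖ := by
  rcases le_total ‖m‖ 1 with h | h
  · rw [max_eq_left h, ofReal_one, div_one]
    linarith [norm_nonneg (m - φ)]
  · rw [max_eq_right h]
    have hm : 0 < ‖m‖ := by linarith
    have e : m / ((‖m‖ : ℝ) : ℂ) - φ = (m - φ) + m * ((1 / ‖m‖ - 1 : ℝ) : ℂ) := by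
      push_cast
      ring
    have h1 : 1 / ‖m‖ - 1 ≤ 0 := by
      rw [sub_nonpos, div_le_one hm]
      exact h
    have h2 : ‖m * ((1 / ‖m‖ - 1 : ℝ) : ℂ)‖ = ‖m‖ - 1 := by
      rw [norm_mul, norm_real, Real.norm_of_nonpos h1]
      field_simp
      ring
    have h3 : ‖m‖ - ‖φ‖ ≤ ‖m - φ‖ := norm_sub_norm_le _ _
    rw [e]
    refine (norm_add_le _ _).trans ?_
    rw [h2]
    linarith

/-- The factor `3` comes from `|exp Δ| ≥ 1/e ≥ 1/3`; truncated values have modulus `1 ≥ |φ|`. -/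
theorem le_norm_truncate {φ Δ : ℂ} (hφ : ‖φ‖ ≤ 1) (hΔ : ‖Δ‖ ≤ 1) :
    ‖φ‖ / 3 ≤ ‖φ * exp Δ / ((max 1 ‖φ * exp Δ‖ : ℝ) : ℂ)‖ := by
  have hm : ‖φ‖ / 3 ≤ ‖φ * exp Δ‖ := by
    rw [norm_mul, norm_exp, div_eq_mul_inv]
    refine mul_le_mul_of_nonneg_left ?_ (norm_nonneg _)
    have h1 : -1 ≤ Δ.re := by
      have := (abs_le.1 (abs_re_le_norm Δ)).1
      linarith
    refine le_trans ?_ (Real.exp_le_exp.2 h1)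
    rw [Real.exp_neg]
    exact inv_anti₀ (Real.exp_pos _) (by linarith [Real.exp_one_lt_d9])
  rw [norm_div, norm_real, Real.norm_of_nonneg (by positivity)]
  rcases le_total ‖φ * exp Δ‖ 1 with h | h
  · rwa [max_eq_left h, div_one]
  · rw [max_eq_right h, div_self (by linarith)]
    linarith

section Quotient

variable {n : ℕ} {φ φ' Δ p : ℂ}

/-- The truncated estimator `w` satisfies `|w| ≥ |φ|/3 ≥ 1/√n`, so the regularization does nothing.
Then `|w - φ| ≤ 4 |φ| |Δ|`, with one factor `2` from truncation and one from `|exp Δ - 1| ≤ 2 |Δ|`,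
and dividing by `w` costs the factor `3`. -/
theorem norm_div_regularize_sub_le_of_small (hφ0 : φ ≠ 0) (hφ : ‖φ‖ ≤ 1)
    (hΔ : ‖Δ‖ ≤ 1) (h3 : 3 ≤ Real.sqrt n * ‖φ‖) :
    ‖p / regularize n (φ * exp Δ / ((max 1 ‖φ * exp Δ‖ : ℝ) : ℂ)) - φ'‖ ≤
      3 * (‖p - φ * φ'‖ / ‖φ‖) + 12 * (‖Δ‖ * ‖φ'‖) := by
  set w := φ * exp Δ / ((max 1 ‖φ * exp Δ‖ : ℝ) : ℂ) with hw
  have hφ' : 0 < ‖φ‖ := norm_pos_iff.2 hφ0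
  have hlow : ‖φ‖ / 3 ≤ ‖w‖ := le_norm_truncate hφ hΔ
  have hwpos : 0 < ‖w‖ := by linarith [div_pos hφ' (by norm_num : (0 : ℝ) < 3)]
  have hw0 : w ≠ 0 := norm_pos_iff.1 hwpos
  have hreg : regularize n w = w := by
    apply regularize_of_one_le
    calc (1 : ℝ) ≤ Real.sqrt n * ‖φ‖ / 3 := by linarith
      _ = Real.sqrt n * (‖φ‖ / 3) := by ring
      _ ≤ _ := by gcongr
  have hd : ‖w - φ‖ ≤ 4 * ‖φ‖ * ‖Δ‖ := by
    refine (norm_truncate_sub_le hφ).trans ?_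
    have e : φ * exp Δ - φ = φ * (exp Δ - 1) := by ring
    rw [e, norm_mul]
    have := Complex.norm_exp_sub_one_le hΔ
    nlinarith
  have e : p / w - φ' = (p - φ * φ') / w + φ' * (φ - w) / w := by
    field_simp
    ring
  have hinv : ‖w‖⁻¹ ≤ 3 / ‖φ‖ := by
    rw [← one_div, div_le_div_iff₀ hwpos hφ']
    linarith
  rw [hreg, e]
  refine (norm_add_le _ _).trans (add_le_add ?_ ?_)
  · rw [norm_div, div_eq_mul_inv]
    calc ‖p - φ * φ'‖ * ‖w‖⁻¹ ≤ ‖p - φ * φ'‖ * (3 / ‖φ‖) := by gcongr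
      _ = _ := by ring
  · rw [norm_div, norm_mul, norm_sub_rev, div_eq_mul_inv]
    calc ‖φ'‖ * ‖w - φ‖ * ‖w‖⁻¹ ≤ ‖φ'‖ * (4 * ‖φ‖ * ‖Δ‖) * (3 / ‖φ‖) := by gcongr
      _ = _ := by field_simp; ring

theorem norm_div_regularize_sub_le (hn : 0 < n) (w : ℂ) :
    ‖p / regularize n w - φ'‖ ≤
      Real.sqrt n * ‖p - φ * φ'‖ + Real.sqrt n * (‖φ‖ * ‖φ'‖) + ‖φ'‖ := by
  have e : p / regularize n w - φ' = (p - φ * φ') * (1 / regularize n w)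
      + φ * φ' * (1 / regularize n w) - φ' := by ring
  have h := norm_inv_regularize_le hn w
  rw [e]
  refine (norm_sub_le _ _).trans (add_le_add ((norm_add_le _ _).trans (add_le_add ?_ ?_)) le_rfl)
  · rw [norm_mul, mul_comm]
    gcongr
  · rw [norm_mul, mul_comm, norm_mul]
    gcongr

end Quotient

theorem enorm_sq_le_of_norm_sq_le {z : ℂ} {r : ℝ} (h : ‖z‖ ^ 2 ≤ r) :
    ‖z‖ₑ ^ 2 ≤ ENNReal.ofReal r := by
  rw [← ofReal_norm, ← ENNReal.ofReal_pow (norm_nonneg _)]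
  exact ENNReal.ofReal_le_ofReal h

theorem ofReal_norm_sq (z : ℂ) : ENNReal.ofReal (‖z‖ ^ 2) = ‖z‖ₑ ^ 2 := by
  rw [ENNReal.ofReal_pow (norm_nonneg _), ofReal_norm]

theorem exists_le_three_mul {t a b c : ℝ≥0∞} (h : t ≤ a + (b + c)) :
    t ≤ 3 * a ∨ t ≤ 3 * b ∨ t ≤ 3 * c := by
  have h1 : a + (b + c) ≤ 3 * max a (max b c) := by
    calc a + (b + c) ≤ max a (max b c) + (max a (max b c) + max a (max b c)) := by
          gcongr
          · exact le_max_left _ _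
          · exact (le_max_left _ _).trans (le_max_right _ _)
          · exact (le_max_right _ _).trans (le_max_right _ _)
      _ = _ := by ring
  have h2 := h.trans h1
  rcases max_choice a (max b c) with e | e
  · exact Or.inl (e ▸ h2)
  · rcases max_choice b c with e' | e'
    · rw [e, e'] at h2
      exact Or.inr (Or.inl h2)
    · rw [e, e'] at h2
      exact Or.inr (Or.inr h2)

/-- One of the three summands is at least `t/3`. If it is `c`, then `t² ≤ t ≤ 3c`, so `c` need not
be squared; applied to the mixed part of the fluctuation, this saves moments. -/
theorem sq_le_of_le_one {t a b c : ℝ≥0∞} (ht : t ≤ 1) (h : t ≤ a + (b + c)) :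
    t ^ 2 ≤ 9 * (a ^ 2 + b ^ 2 + c) := by
  have h9 : (3 : ℝ≥0∞) ^ 2 = 9 := by norm_num
  rcases exists_le_three_mul h with h | h | h
  · refine (pow_le_pow_left₀ zero_le h 2).trans ?_
    rw [mul_pow, h9]
    gcongr
    exact le_self_add.trans le_self_add
  · refine (pow_le_pow_left₀ zero_le h 2).trans ?_
    rw [mul_pow, h9]
    gcongr
    exact le_add_self.trans le_self_add
  · calc t ^ 2 = t * t := sq t
      _ ≤ 1 * (3 * c) := by gcongr
      _ ≤ 9 * c := by
        rw [one_mul]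
        gcongr
        norm_num
      _ ≤ _ := by
        gcongr
        exact le_add_self

/-- The Markov device: on the event of a large logarithmic error the constant `1` is replaced by
arbitrarily high powers of the parts of the fluctuation. -/
theorem one_le_of_one_lt {t a b c : ℝ≥0∞} (ht : 1 ≤ t) (h : t ≤ a + (b + c)) (p : ℕ) :
    1 ≤ 9 ^ p * (a ^ (2 * p) + b ^ (2 * p) + c ^ p) := by
  have h9 : (3 : ℝ≥0∞) ^ 2 = 9 := by norm_num
  rcases exists_le_three_mul h with h | h | h
  · refine (one_le_pow₀ (ht.trans h) (n := 2 * p)).trans ?_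
    rw [mul_pow, pow_mul 3, h9]
    refine mul_le_mul' le_rfl ?_
    exact le_self_add.trans le_self_add
  · refine (one_le_pow₀ (ht.trans h) (n := 2 * p)).trans ?_
    rw [mul_pow, pow_mul 3, h9]
    refine mul_le_mul' le_rfl ?_
    exact le_add_self.trans le_self_add
  · refine (one_le_pow₀ (ht.trans h) (n := p)).trans ?_
    rw [mul_pow]
    refine mul_le_mul' ?_ le_add_self
    gcongr
    norm_num

/-! ### Deterministic bounds of the error of `φ̂_ε` at a point. -/

section Pointwise

variable {μX με : Measure ℝ} [IsProbabilityMeasure μX] [IsProbabilityMeasure με] {n : ℕ}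

theorem phiHatEps_eq (hM : RegularModel μX με) (hn : 0 < n) (y : Fin n → ℝ × ℝ) (u : ℝ) :
    phiHatEps y u = psiHat y 0 u / regularize n (charFun μX u * exp (logError μX y u) /
      ((max 1 ‖charFun μX u * exp (logError μX y u)‖ : ℝ) : ℂ)) := by
  rw [phiHatEps, phiTildeX, phiHatX, phiMod_eq hM hn]

/-- Whatever the estimate of `φ_X`, its regularized inverse is at most `√n`. The deterministic part
of the error is then at most `3 + 1 = 4`, whose doubled square is `32`. -/
theorem enorm_phiHatEps_sub_sq_le_of_lt (hn : 0 < n)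
    (y : Fin n → ℝ × ℝ) {u : ℝ} (h3 : Real.sqrt n * ‖charFun μX u‖ < 3) :
    ‖phiHatEps y u - charFun με u‖ₑ ^ 2 ≤
      2 * n * ‖psiHat y 0 u - phiY μX με u‖ₑ ^ 2 + 32 := by
  have h := norm_div_regularize_sub_le (p := psiHat y 0 u) (φ := charFun μX u)
    (φ' := charFun με u) hn (phiHatX y u)
  have hε : ‖charFun με u‖ ≤ 1 := norm_charFun_le_one u
  rw [← phiY_eq] at h
  set s := ‖psiHat y 0 u - phiY μX με u‖ with hs
  have hs0 : 0 ≤ s := norm_nonneg _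
  have h' : ‖phiHatEps y u - charFun με u‖ ≤ Real.sqrt n * s + 4 := by
    refine h.trans ?_
    have : Real.sqrt n * (‖charFun μX u‖ * ‖charFun με u‖) ≤ 3 * 1 := by
      rw [← mul_assoc]
      gcongr
    linarith
  have hsq : Real.sqrt n ^ 2 = n := Real.sq_sqrt (Nat.cast_nonneg n)
  have key : ‖phiHatEps y u - charFun με u‖ ^ 2 ≤ 2 * n * s ^ 2 + 32 := by
    refine (pow_le_pow_left₀ (norm_nonneg _) h' 2).trans ?_
    have e : 2 * n * s ^ 2 = 2 * (Real.sqrt n * s) ^ 2 := by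
      rw [mul_pow, hsq]
      ring
    rw [e]
    nlinarith [sq_nonneg (Real.sqrt n * s - 4)]
  refine (enorm_sq_le_of_norm_sq_le key).trans (le_of_eq ?_)
  rw [ENNReal.ofReal_add (by positivity) (by norm_num), ENNReal.ofReal_mul (by positivity),
    hs, ofReal_norm_sq, ENNReal.ofReal_mul (by norm_num), ENNReal.ofReal_natCast]
  norm_num

/-- The first two summands cover `|Δ| ≤ 1`, with `18 = 2 · 3²` and `2592 = 2 · 12² · 9`. The last
two cover `|Δ| > 1`, where the crude bound is multiplied by powers of the fluctuation. The order
`2q` with a square root is used next to `|ψ̂ - φ_Y|²`, which is random and will require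
Cauchy-Schwarz. -/
theorem enorm_phiHatEps_sub_sq_le (hM : RegularModel μX με) (hn : 0 < n)
    (y : Fin n → ℝ × ℝ) (q : ℕ) {u : ℝ} (hu : 0 ≤ u) (h3 : 3 ≤ Real.sqrt n * ‖charFun μX u‖) :
    ‖phiHatEps y u - charFun με u‖ₑ ^ 2 ≤
      18 * ((‖charFun μX u‖ₑ ^ 2)⁻¹ * ‖psiHat y 0 u - phiY μX με u‖ₑ ^ 2)
      + 2592 * (‖charFun με u‖ₑ ^ 2 * fluct μX με y 1 u)
      + 2 * 9 ^ q * n * (‖psiHat y 0 u - phiY μX με u‖ₑ ^ 2 * fluct μX με y (2 * q) u ^ (1 / 2 : ℝ))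
      + 8 * 9 ^ q * n * (‖charFun μX u‖ₑ ^ 2 * ‖charFun με u‖ₑ ^ 2 * fluct μX με y q u) := by
  have hsq : Real.sqrt n ^ 2 = n := Real.sq_sqrt (Nat.cast_nonneg n)
  have hX0 := hM.charFun_X_ne_zero u
  have hX : ‖charFun μX u‖ ≤ 1 := norm_charFun_le_one u
  have hXpos : 0 < ‖charFun μX u‖ := norm_pos_iff.2 hX0
  have ht := enorm_logError_le hM hn y hu
  rcases le_or_gt ‖logError μX y u‖ 1 with h1 | h1
  · have h := norm_div_regularize_sub_le_of_small (p := psiHat y 0 u) (φ := charFun μX u)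
      (φ' := charFun με u) (Δ := logError μX y u) hX0 hX h1 h3
    rw [← phiY_eq, ← phiHatEps_eq hM hn] at h
    have key : ‖phiHatEps y u - charFun με u‖ ^ 2 ≤
        18 * ((‖charFun μX u‖ ^ 2)⁻¹ * ‖psiHat y 0 u - phiY μX με u‖ ^ 2)
          + 288 * (‖charFun με u‖ ^ 2 * ‖logError μX y u‖ ^ 2) := by
      refine (pow_le_pow_left₀ (norm_nonneg _) h 2).trans ?_
      have e : (‖charFun μX u‖ ^ 2)⁻¹ * ‖psiHat y 0 u - phiY μX με u‖ ^ 2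
        = (‖psiHat y 0 u - phiY μX με u‖ / ‖charFun μX u‖) ^ 2 := by
        rw [div_pow, div_eq_mul_inv, mul_comm]
      rw [e]
      nlinarith [sq_nonneg (3 * (‖psiHat y 0 u - phiY μX με u‖ / ‖charFun μX u‖)
        - 12 * (‖logError μX y u‖ * ‖charFun με u‖))]
    refine (enorm_sq_le_of_norm_sq_le key).trans ?_
    refine le_trans ?_ (le_self_add.trans le_self_add)
    rw [ENNReal.ofReal_add (by positivity) (by positivity), ENNReal.ofReal_mul (by norm_num),
      ENNReal.ofReal_mul (by positivity), ENNReal.ofReal_mul (by norm_num),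
      ENNReal.ofReal_mul (by positivity), ENNReal.ofReal_inv_of_pos (by positivity),
      ofReal_norm_sq, ofReal_norm_sq, ofReal_norm_sq, ofReal_norm_sq]
    refine add_le_add (by norm_num) ?_
    have ht1 : ‖logError μX y u‖ₑ ≤ 1 := by
      rw [← ofReal_norm, ← ENNReal.ofReal_one]
      exact ENNReal.ofReal_le_ofReal h1
    have := sq_le_of_le_one ht1 ht
    calc ENNReal.ofReal 288 * (‖charFun με u‖ₑ ^ 2 * ‖logError μX y u‖ₑ ^ 2)
        ≤ 288 * (‖charFun με u‖ₑ ^ 2 * (9 * fluct μX με y 1 u)) := by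
          refine mul_le_mul' (by norm_num) (mul_le_mul' le_rfl ?_)
          simpa [fluct] using this
      _ = (288 * 9) * (‖charFun με u‖ₑ ^ 2 * fluct μX με y 1 u) := by ring
      _ = _ := by norm_num
  · have h := norm_div_regularize_sub_le (p := psiHat y 0 u) (φ := charFun μX u)
      (φ' := charFun με u) hn (phiHatX y u)
    rw [← phiY_eq] at h
    have key : ‖phiHatEps y u - charFun με u‖ ^ 2 ≤
        2 * n * ‖psiHat y 0 u - phiY μX με u‖ ^ 2
          + 8 * n * (‖charFun μX u‖ ^ 2 * ‖charFun με u‖ ^ 2) := by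
      have h' : ‖phiHatEps y u - charFun με u‖ ≤ Real.sqrt n * ‖psiHat y 0 u - phiY μX με u‖
          + 2 * (Real.sqrt n * (‖charFun μX u‖ * ‖charFun με u‖)) := by
        refine h.trans ?_
        -- The lone `|φ_ε|` is absorbed because `√n |φ_X| ≥ 3 ≥ 1`.
        have : ‖charFun με u‖ ≤ Real.sqrt n * (‖charFun μX u‖ * ‖charFun με u‖) := by
          rw [← mul_assoc]
          exact le_mul_of_one_le_left (norm_nonneg _) (by linarith)
        linarith
      refine (pow_le_pow_left₀ (norm_nonneg _) h' 2).trans ?_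
      have e : ∀ a b c : ℝ, 2 * n * a ^ 2 + 8 * n * (b ^ 2 * c ^ 2)
          = 2 * (Real.sqrt n * a) ^ 2 + 8 * (Real.sqrt n * (b * c)) ^ 2 := fun a b c => by
        rw [mul_pow, mul_pow (Real.sqrt n) (b * c), hsq]
        ring
      rw [e]
      nlinarith [sq_nonneg (Real.sqrt n * ‖psiHat y 0 u - phiY μX με u‖
        - 2 * (Real.sqrt n * (‖charFun μX u‖ * ‖charFun με u‖)))]
    have ht1 : 1 ≤ ‖logError μX y u‖ₑ := by
      rw [← ofReal_norm, ← ENNReal.ofReal_one]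
      exact ENNReal.ofReal_le_ofReal h1.le
    have hq : 1 ≤ 9 ^ q * fluct μX με y q u := one_le_of_one_lt ht1 ht q
    have h2q : 1 ≤ 9 ^ q * fluct μX με y (2 * q) u ^ (1 / 2 : ℝ) := by
      have := ENNReal.rpow_le_rpow (z := 1 / 2) (one_le_of_one_lt ht1 ht (2 * q)) (by norm_num)
      rw [ENNReal.one_rpow, ENNReal.mul_rpow_of_nonneg _ _ (by norm_num), mul_comm 2 q, pow_mul,
        ennreal_sq_rpow_half] at this
      rw [mul_comm 2 q]
      exact this
    refine (enorm_sq_le_of_norm_sq_le key).trans ?_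
    rw [ENNReal.ofReal_add (by positivity) (by positivity), ENNReal.ofReal_mul (by positivity),
      ENNReal.ofReal_mul (by positivity), ENNReal.ofReal_mul (by norm_num),
      ENNReal.ofReal_mul (by norm_num), ENNReal.ofReal_mul (by positivity),
      ofReal_norm_sq, ofReal_norm_sq, ofReal_norm_sq, ENNReal.ofReal_natCast]
    rw [add_assoc]
    refine le_trans (add_le_add ?_ ?_) le_add_self
    · calc ENNReal.ofReal 2 * n * ‖psiHat y 0 u - phiY μX με u‖ₑ ^ 2
          ≤ 2 * n * ‖psiHat y 0 u - phiY μX με u‖ₑ ^ 2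
              * (9 ^ q * fluct μX με y (2 * q) u ^ (1 / 2 : ℝ)) := by
            refine le_trans (by norm_num) (mul_le_mul' le_rfl h2q)
        _ = _ := by ring
    · calc ENNReal.ofReal 8 * n * (‖charFun μX u‖ₑ ^ 2 * ‖charFun με u‖ₑ ^ 2)
          ≤ 8 * n * (‖charFun μX u‖ₑ ^ 2 * ‖charFun με u‖ₑ ^ 2)
              * (9 ^ q * fluct μX με y q u) := by
            refine le_trans (by norm_num) (mul_le_mul' le_rfl hq)
        _ = _ := by ring

end Pointwise

/-! ### Comparison of the integrals and of `G`. -/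

section Bounds

variable {μX με : Measure ℝ} [IsProbabilityMeasure μX] [IsProbabilityMeasure με]

theorem one_le_of_quasiDecreasing {c : ℝ} (h : QuasiDecreasing (charFun με) c) :
    1 ≤ ENNReal.ofReal c := by
  have := h 0 0 le_rfl le_rfl
  simp only [charFun_zero, probReal_univ, ofReal_one, norm_one, mul_one] at this
  exact ENNReal.one_le_ofReal.2 this

theorem enorm_charFun_le_one (μ : Measure ℝ) [IsProbabilityMeasure μ] (u : ℝ) :
    ‖charFun μ u‖ₑ ≤ 1 := by
  rw [← ofReal_norm, ← ENNReal.ofReal_one]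
  exact ENNReal.ofReal_le_ofReal (norm_charFun_le_one u)

theorem one_le_inv_enorm_charFun_pow (μ : Measure ℝ) [IsProbabilityMeasure μ] (u : ℝ) (k : ℕ) :
    1 ≤ (‖charFun μ u‖ₑ ^ k)⁻¹ :=
  ENNReal.one_le_inv.2 (pow_le_one₀ zero_le (enorm_charFun_le_one μ u))

theorem enorm_le_intInvSq (μ : Measure ℝ) [IsProbabilityMeasure μ] (u : ℝ) :
    ‖u‖ₑ ≤ intInvSq (charFun μ) u := by
  calc ‖u‖ₑ = ∫⁻ _ in Set.Icc 0 |u|, 1 := by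
        rw [setLIntegral_one, Real.volume_Icc, sub_zero, ← Real.norm_eq_abs, ofReal_norm]
    _ ≤ _ := lintegral_mono fun z => one_le_inv_enorm_charFun_pow μ z 2

/-- Quasi-monotonicity takes `|φ_ε(u)|` under the integral as `C_ε |φ_ε(z)|`, where it cancels the
factor `φ_ε(z)` of `φ_Y(z)`. -/
theorem enorm_sq_mul_intInvSq_phiY_le (hM : RegularModel μX με) {c : ℝ}
    (h : QuasiDecreasing (charFun με) c) {u : ℝ} (hu : 0 ≤ u) :
    ‖charFun με u‖ₑ ^ 2 * intInvSq (phiY μX με) u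
      ≤ ENNReal.ofReal c ^ 2 * intInvSq (charFun μX) u := by
  have m1 : Measurable fun z => (‖phiY μX με z‖ₑ ^ 2)⁻¹ :=
    (measurable_phiY.enorm.pow_const 2).inv
  have m2 : Measurable fun z => (‖charFun μX z‖ₑ ^ 2)⁻¹ :=
    (continuous_charFun.measurable.enorm.pow_const 2).inv
  rw [intInvSq, intInvSq, abs_of_nonneg hu, ← lintegral_const_mul _ m1, ← lintegral_const_mul _ m2]
  refine setLIntegral_mono (m2.const_mul _) fun z hz => ?_
  have h1 : ‖charFun με u‖ₑ ≤ ENNReal.ofReal c * ‖charFun με z‖ₑ := by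
    have hc : 0 ≤ c := by
      have := one_le_of_quasiDecreasing h
      rw [ENNReal.one_le_ofReal] at this
      linarith
    rw [← ofReal_norm, ← ofReal_norm, ← ENNReal.ofReal_mul hc]
    exact ENNReal.ofReal_le_ofReal (h u z hz.1 hz.2)
  have hz0 := hM.charFun_eps_ne_zero z
  rw [phiY_eq, enorm_mul, mul_pow, ENNReal.mul_inv (Or.inl (enorm_sq_ne_zero
    (hM.charFun_X_ne_zero z))) (Or.inl (by finiteness))]
  calc ‖charFun με u‖ₑ ^ 2 * ((‖charFun μX z‖ₑ ^ 2)⁻¹ * (‖charFun με z‖ₑ ^ 2)⁻¹)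
      ≤ (ENNReal.ofReal c * ‖charFun με z‖ₑ) ^ 2
        * ((‖charFun μX z‖ₑ ^ 2)⁻¹ * (‖charFun με z‖ₑ ^ 2)⁻¹) := by gcongr
    _ = ENNReal.ofReal c ^ 2 * (‖charFun μX z‖ₑ ^ 2)⁻¹
        * (‖charFun με z‖ₑ ^ 2 * (‖charFun με z‖ₑ ^ 2)⁻¹) := by ring
    _ = _ := by
      rw [ENNReal.mul_inv_cancel (enorm_sq_ne_zero hz0) (by finiteness), mul_one]

theorem momentY_rpow_le_G (μX με : Measure ℝ) (n p : ℕ) (u : ℝ) :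
    momentY μX με (2 * p) ^ (1 / 2 : ℝ) ≤ G μX με n p u := le_add_self

theorem lintegral_logDeriv_pow_le_G (hM : RegularModel μX με) (n p : ℕ) {u : ℝ} (hu : 0 ≤ u) :
    (∫⁻ z in Set.Ioc 0 u, ‖deriv (charFun μX) z / charFun μX z‖ₑ ^ 2) ^ p ≤ G μX με n p u := by
  rw [G, lintegral_logDeriv_psi_sq hM hu]
  exact (le_add_self.trans le_self_add).trans le_self_add

theorem G_mono (μX με : Measure ℝ) (n p : ℕ) {u v : ℝ} (hu : 0 ≤ u) (huv : u ≤ v) :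
    G μX με n p u ≤ G μX με n p v := by
  have h : |u| ≤ |v| := by rwa [abs_of_nonneg hu, abs_of_nonneg (hu.trans huv)]
  unfold G
  refine add_le_add (add_le_add (add_le_add le_rfl ?_) ?_) le_rfl
  · exact pow_le_pow_left₀ zero_le
      (lintegral_mono_set (Set.Icc_subset_Icc_right h)) p
  · split_ifs
    · gcongr
    · exact le_rfl

end Bounds

/-- The pointwise bound of the risk of the estimator of `φ_ε`. -/
noncomputable def riskBound (μX με : Measure ℝ) (n q : ℕ) (v u : ℝ) : ℝ≥0∞ :=
  G μX με n 1 v / n * intInvSq (charFun μX) u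
    + G μX με n q v / (n : ℝ≥0∞) ^ (q - 1) * ((‖charFun μX u‖ₑ ^ 2)⁻¹ *
        intInvSq (charFun μX) u * intInvSq (phiY μX με) u ^ (q - 1))
    + G μX με n (2 * q) v ^ (1 / 2 : ℝ) / (n : ℝ≥0∞) ^ q * ((‖charFun μX u‖ₑ ^ 4)⁻¹ *
        intInvSq (phiY μX με) u ^ q)
    + 1 / (n : ℝ≥0∞) ^ 2 * (‖charFun μX u‖ₑ ^ 4)⁻¹

/-- In the bound of `|φ_X(u)|^(-2)` the constant term is paired with the variance bound proportional
to `|u| ≤ ∫_0^u |φ_X|^(-2)`, the integral term with the plain bound `C/n`. -/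
theorem exists_lintegral_inv_mul_psiHat_sub_sq_le : ∃ C : ℝ≥0∞, C ≠ ∞ ∧
    ∀ (μX με : Measure ℝ) [IsProbabilityMeasure μX] [IsProbabilityMeasure με]
      (Ω : Type u) [MeasurableSpace Ω] (P : Measure Ω) [IsProbabilityMeasure P]
      (n : ℕ) (Y : Fin n → Ω → ℝ × ℝ), 0 < n → IsSample P μX με Y → RegularModel μX με →
      ∀ u : ℝ, 0 ≤ u →
        (‖charFun μX u‖ₑ ^ 2)⁻¹ *
          ∫⁻ ω, ‖psiHat (fun j => Y j ω) 0 u - phiY μX με u‖ₑ ^ 2 ∂P ≤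
          C * (G μX με n 1 u / n * intInvSq (charFun μX) u) := by
  obtain ⟨C₁, hC₁, h₁⟩ := exists_lintegral_psiHat_sub_sq_le.{u}
  obtain ⟨C₂, hC₂, h₂⟩ := exists_lintegral_psiHat_sub_le.{u} 1 le_rfl
  refine ⟨4 * (C₁ + C₂), by finiteness, fun μX με _ _ Ω _ P _ n Y hn hY hM u hu => ?_⟩
  have h1 := h₁ μX με Ω P n Y hn hY u
  have h2 := h₂ μX με Ω P n Y hn hY u
  rw [mul_one, pow_one] at h2
  set E := ∫⁻ ω, ‖psiHat (fun j => Y j ω) 0 u - phiY μX με u‖ₑ ^ 2 ∂P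
  set J := intInvSq (charFun μX) u with hJ
  have hL := lintegral_logDeriv_pow_le_G hM n 1 hu
  rw [pow_one] at hL
  have hm := momentY_rpow_le_G μX με n 1 u
  rw [mul_one] at hm
  calc (‖charFun μX u‖ₑ ^ 2)⁻¹ * E
      ≤ 4 * (1 + (∫⁻ z in Set.Ioc 0 u, ‖deriv (charFun μX) z / charFun μX z‖ₑ ^ 2) * J) * E := by
        gcongr
        exact inv_enorm_charFun_sq_le hM hu
    _ ≤ 4 * (1 + G μX με n 1 u * J) * E := by gcongr
    _ = 4 * E + 4 * (G μX με n 1 u * J) * E := by ring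
    _ ≤ 4 * (C₁ * ((n : ℝ≥0∞)⁻¹ * (J * G μX με n 1 u)))
        + 4 * (G μX με n 1 u * J) * (C₂ * (n : ℝ≥0∞)⁻¹) := by
        refine add_le_add (mul_le_mul' le_rfl (h1.trans ?_)) (mul_le_mul' le_rfl h2)
        gcongr
        exact enorm_le_intInvSq μX u
    _ = _ := by
        rw [div_eq_mul_inv]
        ring

theorem natCast_mul_inv_pow {n : ℕ} (hn : 0 < n) {q : ℕ} (hq : 1 ≤ q) :
    (n : ℝ≥0∞) * (n : ℝ≥0∞)⁻¹ ^ q = ((n : ℝ≥0∞) ^ (q - 1))⁻¹ := by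
  obtain ⟨q, rfl⟩ := Nat.exists_eq_add_of_le' hq
  rw [pow_succ', ← mul_assoc, ENNReal.mul_inv_cancel (by exact_mod_cast hn.ne')
    (ENNReal.natCast_ne_top n), one_mul, Nat.add_sub_cancel, ENNReal.inv_pow]

/-- Cauchy-Schwarz in the sample: the fourth moment of `ψ̂ - φ_Y` gives `1/n` after the square root,
cancelling the prefactor `n`. The fluctuation of order `2q` requires `4q` moments of `Y₁`. The
weight `|φ_X|^(-4) ≥ 1` is inserted only to fit the final form. -/
theorem exists_lintegral_psiHat_sub_sq_mul_fluct_le (q : ℕ) (hq : 1 ≤ q) :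
    ∃ C : ℝ≥0∞, C ≠ ∞ ∧
    ∀ (μX με : Measure ℝ) [IsProbabilityMeasure μX] [IsProbabilityMeasure με]
      (Ω : Type u) [MeasurableSpace Ω] (P : Measure Ω) [IsProbabilityMeasure P]
      (n : ℕ) (Y : Fin n → Ω → ℝ × ℝ), 0 < n → IsSample P μX με Y → RegularModel μX με →
      momentY μX με (4 * q) < ∞ → ∀ u : ℝ, 0 ≤ u →
        n * ∫⁻ ω, ‖psiHat (fun j => Y j ω) 0 u - phiY μX με u‖ₑ ^ 2
            * fluct μX με (fun j => Y j ω) (2 * q) u ^ (1 / 2 : ℝ) ∂P ≤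
          C * (G μX με n (2 * q) u ^ (1 / 2 : ℝ) / (n : ℝ≥0∞) ^ q * ((‖charFun μX u‖ₑ ^ 4)⁻¹ *
            intInvSq (phiY μX με) u ^ q)) := by
  obtain ⟨C₁, hC₁, h₁⟩ := exists_lintegral_psiHat_sub_le.{u} 2 (by norm_num)
  obtain ⟨C₂, hC₂, h₂⟩ := exists_lintegral_fluct_le.{u} (2 * q) (by omega)
  refine ⟨(C₁ * C₂) ^ (1 / 2 : ℝ), by finiteness,
    fun μX με _ _ Ω _ P _ n Y hn hY hM hmom u hu => ?_⟩
  have h1 := h₁ μX με Ω P n Y hn hY u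
  have h2 := h₂ μX με Ω P n Y hn hY hM (by rwa [← mul_assoc]) u hu
  set J := intInvSq (phiY μX με) u with hJ
  set g := G μX με n (2 * q) u
  have ms : Measurable fun ω => ‖psiHat (fun j => Y j ω) 0 u - phiY μX με u‖ₑ ^ 2 :=
    (((measurable_psiHat hY.measurable).comp (measurable_prodMk_right (y := u))).sub_const
      _).enorm.pow_const 2
  have mf := measurable_fluct (με := με) hM.memLp_X hY.measurable (2 * q) u
  have hcs := lintegral_mul_sq_le (μ := P) ms.aemeasurable (mf.pow_const (1 / 2 : ℝ)).aemeasurable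
  have e1 : ∀ x : ℝ≥0∞, (x ^ (1 / 2 : ℝ)) ^ 2 = x := fun x => by
    rw [← ENNReal.rpow_natCast, ← ENNReal.rpow_mul]
    norm_num
  simp only [e1, ← pow_mul] at hcs
  have hcs2 := ENNReal.rpow_le_rpow (z := 1 / 2) (hcs.trans (mul_le_mul' h1 h2)) (by norm_num)
  rw [ennreal_sq_rpow_half] at hcs2
  have hn0 : (n : ℝ≥0∞) ≠ 0 := by exact_mod_cast hn.ne'
  have e2 : C₁ * (n : ℝ≥0∞)⁻¹ ^ 2 * (C₂ * ((n : ℝ≥0∞)⁻¹ ^ (2 * q) * J ^ (2 * q) * g))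
      = (C₁ * C₂) * ((n : ℝ≥0∞)⁻¹ * ((n : ℝ≥0∞)⁻¹ ^ q * J ^ q)) ^ 2 * g := by
    ring
  rw [e2, ENNReal.mul_rpow_of_nonneg _ _ (by norm_num),
    ENNReal.mul_rpow_of_nonneg _ _ (by norm_num), ennreal_sq_rpow_half] at hcs2
  calc _ ≤ (n : ℝ≥0∞) * ((C₁ * C₂) ^ (1 / 2 : ℝ) * ((n : ℝ≥0∞)⁻¹ * ((n : ℝ≥0∞)⁻¹ ^ q * J ^ q))
        * g ^ (1 / 2 : ℝ)) := mul_le_mul' le_rfl hcs2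
    _ = (n : ℝ≥0∞) * (n : ℝ≥0∞)⁻¹ * ((C₁ * C₂) ^ (1 / 2 : ℝ)
        * (g ^ (1 / 2 : ℝ) * (n : ℝ≥0∞)⁻¹ ^ q * (1 * J ^ q))) := by ring
    _ ≤ 1 * ((C₁ * C₂) ^ (1 / 2 : ℝ)
        * (g ^ (1 / 2 : ℝ) * (n : ℝ≥0∞)⁻¹ ^ q * ((‖charFun μX u‖ₑ ^ 4)⁻¹ * J ^ q))) := by
        rw [ENNReal.mul_inv_cancel hn0 (ENNReal.natCast_ne_top n)]
        gcongr
        exact one_le_inv_enorm_charFun_pow μX u 4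
    _ = _ := by rw [one_mul, div_eq_mul_inv (g ^ (1 / 2 : ℝ)), ENNReal.inv_pow (a := (n : ℝ≥0∞))]

/-- One of the `q` factors `∫ |φ_Y|^(-2)` is combined with `|φ_ε(u)|²`. The case `q = 1` serves for
small, general `q` for large logarithmic error. -/
theorem exists_lintegral_mul_fluct_le (q : ℕ) (hq : 1 ≤ q) : ∃ C : ℝ≥0∞, C ≠ ∞ ∧
    ∀ (μX με : Measure ℝ) [IsProbabilityMeasure μX] [IsProbabilityMeasure με]
      (Ω : Type u) [MeasurableSpace Ω] (P : Measure Ω) [IsProbabilityMeasure P]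
      (n : ℕ) (Y : Fin n → Ω → ℝ × ℝ), 0 < n → IsSample P μX με Y → RegularModel μX με →
      momentY μX με (2 * q) < ∞ → ∀ c : ℝ, QuasiDecreasing (charFun με) c → ∀ u : ℝ, 0 ≤ u →
        n * (‖charFun με u‖ₑ ^ 2 * ∫⁻ ω, fluct μX με (fun j => Y j ω) q u ∂P) ≤
          C * ENNReal.ofReal c ^ 2 * (G μX με n q u / (n : ℝ≥0∞) ^ (q - 1)
            * (intInvSq (charFun μX) u * intInvSq (phiY μX με) u ^ (q - 1))) := by
  obtain ⟨C, hC, h⟩ := exists_lintegral_fluct_le.{u} q hq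
  refine ⟨C, hC, fun μX με _ _ Ω _ P _ n Y hn hY hM hmom c hc u hu => ?_⟩
  have h1 := h μX με Ω P n Y hn hY hM hmom u hu
  have h2 := enorm_sq_mul_intInvSq_phiY_le hM hc hu
  have e : intInvSq (phiY μX με) u ^ q
      = intInvSq (phiY μX με) u * intInvSq (phiY μX με) u ^ (q - 1) := by
    rw [← pow_succ', Nat.sub_add_cancel hq]
  calc _ ≤ (n : ℝ≥0∞) * (‖charFun με u‖ₑ ^ 2 * (C * ((n : ℝ≥0∞)⁻¹ ^ q
        * intInvSq (phiY μX με) u ^ q * G μX με n q u))) := by gcongr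
    _ = C * (G μX με n q u * ((n : ℝ≥0∞) * (n : ℝ≥0∞)⁻¹ ^ q)
        * ((‖charFun με u‖ₑ ^ 2 * intInvSq (phiY μX με) u)
          * intInvSq (phiY μX με) u ^ (q - 1))) := by rw [e]; ring
    _ ≤ C * (G μX με n q u * ((n : ℝ≥0∞) * (n : ℝ≥0∞)⁻¹ ^ q)
        * ((ENNReal.ofReal c ^ 2 * intInvSq (charFun μX) u)
          * intInvSq (phiY μX με) u ^ (q - 1))) := by gcongr
    _ = _ := by
      rw [natCast_mul_inv_pow hn hq, div_eq_mul_inv]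
      ring

/-- The distinction by `√n |φ_X(u)|` is deterministic, the one by the size of the logarithmic error
is inside the pointwise bound; taking expectations is therefore term by term. -/
theorem exists_lintegral_phiHatEps_sub_sq_le (q : ℕ) (hq : 2 ≤ q) : ∃ C : ℝ≥0∞, C ≠ ∞ ∧
    ∀ (μX με : Measure ℝ) [IsProbabilityMeasure μX] [IsProbabilityMeasure με]
      (Ω : Type u) [MeasurableSpace Ω] (P : Measure Ω) [IsProbabilityMeasure P]
      (n : ℕ) (Y : Fin n → Ω → ℝ × ℝ), 0 < n → IsSample P μX με Y → RegularModel μX με →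
      momentY μX με (4 * q) < ∞ → ∀ c : ℝ, QuasiDecreasing (charFun με) c → ∀ u : ℝ, 0 ≤ u →
        ∫⁻ ω, ‖phiHatEps (fun j => Y j ω) u - charFun με u‖ₑ ^ 2 ∂P ≤
          C * ENNReal.ofReal c ^ 2 * riskBound μX με n q u u := by
  obtain ⟨C₁, hC₁, h₁⟩ := exists_lintegral_inv_mul_psiHat_sub_sq_le.{u}
  obtain ⟨C₂, hC₂, h₂⟩ := exists_lintegral_mul_fluct_le.{u} 1 le_rfl
  obtain ⟨C₃, hC₃, h₃⟩ := exists_lintegral_psiHat_sub_sq_mul_fluct_le.{u} q (by omega)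
  obtain ⟨C₄, hC₄, h₄⟩ := exists_lintegral_mul_fluct_le.{u} q (by omega)
  obtain ⟨C₅, hC₅, h₅⟩ := exists_lintegral_psiHat_sub_le.{u} 1 le_rfl
  refine ⟨(18 * C₁ + 2592 * C₂) + 2 * 9 ^ q * C₃ + 8 * 9 ^ q * C₄ + 81 * (2 * C₅ + 32),
    by finiteness, fun μX με _ _ Ω _ P _ n Y hn hY hM hmom c hc u hu => ?_⟩
  have hmom2 : momentY μX με 2 < ∞ := momentY_lt_top_of_le (by norm_num) (by omega) hmom
  have hmomq : momentY μX με (2 * q) < ∞ := momentY_lt_top_of_le (by omega) (by omega) hmom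
  -- Since `φ_ε(0) = 1`, quasi-monotonicity forces `c ≥ 1`, so every term may carry the factor `c²`.
  have hc1 : 1 ≤ ENNReal.ofReal c ^ 2 := one_le_pow₀ (one_le_of_quasiDecreasing hc)
  have hn0 : (n : ℝ≥0∞) ≠ 0 := by exact_mod_cast hn.ne'
  have hnt : (n : ℝ≥0∞) ≠ ∞ := ENNReal.natCast_ne_top n
  have hX0 := hM.charFun_X_ne_zero u
  have ms : Measurable fun ω => ‖psiHat (fun j => Y j ω) 0 u - phiY μX με u‖ₑ ^ 2 :=
    (((measurable_psiHat hY.measurable).comp (measurable_prodMk_right (y := u))).sub_const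
      _).enorm.pow_const 2
  rcases lt_or_ge (Real.sqrt n * ‖charFun μX u‖) 3 with h3 | h3
  · have h5 := h₅ μX με Ω P n Y hn hY u
    rw [mul_one, pow_one] at h5
    -- `√n |φ_X| < 3` means `n² |φ_X|⁴ ≤ 3⁴`, so in this regime a constant is dominated by the last
    -- term of the bound.
    have hb : 1 ≤ 81 * (1 / (n : ℝ≥0∞) ^ 2 * (‖charFun μX u‖ₑ ^ 4)⁻¹) := by
      have hr : (n : ℝ) ^ 2 * ‖charFun μX u‖ ^ 4 ≤ 81 := by
        have hsq : Real.sqrt n ^ 2 = n := Real.sq_sqrt (Nat.cast_nonneg n)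
        calc (n : ℝ) ^ 2 * ‖charFun μX u‖ ^ 4 = (Real.sqrt n * ‖charFun μX u‖) ^ 4 := by
              rw [← hsq]
              simp only [hsq]
              rw [mul_pow, show Real.sqrt n ^ 4 = (Real.sqrt n ^ 2) ^ 2 by ring, hsq]
          _ ≤ 3 ^ 4 := pow_le_pow_left₀ (by positivity) h3.le 4
          _ = 81 := by norm_num
      have hr' : (n : ℝ≥0∞) ^ 2 * ‖charFun μX u‖ₑ ^ 4 ≤ 81 := by
        have := ENNReal.ofReal_le_ofReal hr
        rw [ENNReal.ofReal_mul (by positivity), ENNReal.ofReal_pow (by positivity),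
          ENNReal.ofReal_pow (by positivity), ENNReal.ofReal_natCast, ofReal_norm] at this
        simpa using this
      have hne : (n : ℝ≥0∞) ^ 2 * ‖charFun μX u‖ₑ ^ 4 ≠ 0 :=
        mul_ne_zero (pow_ne_zero _ hn0) (pow_ne_zero _ (by simpa using hX0))
      rw [one_div, ← ENNReal.mul_inv (Or.inl (pow_ne_zero _ hn0)) (Or.inl (by finiteness))]
      calc (1 : ℝ≥0∞) = ((n : ℝ≥0∞) ^ 2 * ‖charFun μX u‖ₑ ^ 4)
            * ((n : ℝ≥0∞) ^ 2 * ‖charFun μX u‖ₑ ^ 4)⁻¹ :=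
            (ENNReal.mul_inv_cancel hne (by finiteness)).symm
        _ ≤ _ := by gcongr
    calc ∫⁻ ω, ‖phiHatEps (fun j => Y j ω) u - charFun με u‖ₑ ^ 2 ∂P
        ≤ ∫⁻ ω, (2 * n * ‖psiHat (fun j => Y j ω) 0 u - phiY μX με u‖ₑ ^ 2 + 32) ∂P :=
          lintegral_mono fun ω => enorm_phiHatEps_sub_sq_le_of_lt hn _ h3
      _ = 2 * n * ∫⁻ ω, ‖psiHat (fun j => Y j ω) 0 u - phiY μX με u‖ₑ ^ 2 ∂P + 32 := by
          rw [lintegral_add_right _ measurable_const, lintegral_const_mul _ ms]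
          simp
      _ ≤ 2 * n * (C₅ * (n : ℝ≥0∞)⁻¹) + 32 := by gcongr
      _ = 2 * C₅ * ((n : ℝ≥0∞) * (n : ℝ≥0∞)⁻¹) + 32 := by ring
      _ = (2 * C₅ + 32) * 1 * 1 := by
          rw [ENNReal.mul_inv_cancel hn0 hnt]
          ring
      _ ≤ (2 * C₅ + 32) * ENNReal.ofReal c ^ 2
          * (81 * (1 / (n : ℝ≥0∞) ^ 2 * (‖charFun μX u‖ₑ ^ 4)⁻¹)) := by gcongr
      _ = 81 * (2 * C₅ + 32) * ENNReal.ofReal c ^ 2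
          * (1 / (n : ℝ≥0∞) ^ 2 * (‖charFun μX u‖ₑ ^ 4)⁻¹) := by ring
      _ ≤ _ := by
          refine mul_le_mul' (mul_le_mul' le_add_self le_rfl) ?_
          exact le_add_self
  · have h1 := h₁ μX με Ω P n Y hn hY hM u hu
    have h2 := h₂ μX με Ω P n Y hn hY hM hmom2 c hc u hu
    have h3' := h₃ μX με Ω P n Y hn hY hM hmom u hu
    have h4 := h₄ μX με Ω P n Y hn hY hM hmomq c hc u hu
    simp only [tsub_self, pow_zero, div_one, mul_one] at h2
    have mf := fun p => measurable_fluct (με := με) hM.memLp_X hY.measurable p u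
    have m3 : Measurable fun ω => ‖psiHat (fun j => Y j ω) 0 u - phiY μX με u‖ₑ ^ 2
        * fluct μX με (fun j => Y j ω) (2 * q) u ^ (1 / 2 : ℝ) :=
      ms.mul ((mf (2 * q)).pow_const _)
    set s : Ω → ℝ≥0∞ := fun ω => ‖psiHat (fun j => Y j ω) 0 u - phiY μX με u‖ₑ ^ 2 with hs
    set f : ℕ → Ω → ℝ≥0∞ := fun p ω => fluct μX με (fun j => Y j ω) p u with hf
    set J := intInvSq (charFun μX) u
    set J' := intInvSq (phiY μX με) u
    have hstep : ∫⁻ ω, ‖phiHatEps (fun j => Y j ω) u - charFun με u‖ₑ ^ 2 ∂P ≤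
        18 * ((‖charFun μX u‖ₑ ^ 2)⁻¹ * ∫⁻ ω, s ω ∂P)
          + 2592 * (‖charFun με u‖ₑ ^ 2 * ∫⁻ ω, f 1 ω ∂P)
          + 2 * 9 ^ q * n * ∫⁻ ω, s ω * f (2 * q) ω ^ (1 / 2 : ℝ) ∂P
          + 8 * 9 ^ q * n * (‖charFun μX u‖ₑ ^ 2 * ‖charFun με u‖ₑ ^ 2 * ∫⁻ ω, f q ω ∂P) := by
      refine (lintegral_mono fun ω => enorm_phiHatEps_sub_sq_le hM hn _ q hu h3).trans
        (le_of_eq ?_)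
      have a1 : Measurable fun ω => 18 * ((‖charFun μX u‖ₑ ^ 2)⁻¹ * s ω) :=
        (ms.const_mul _).const_mul _
      have a2 : Measurable fun ω => 2592 * (‖charFun με u‖ₑ ^ 2 * f 1 ω) :=
        ((mf 1).const_mul _).const_mul _
      have a3 : Measurable fun ω => 2 * 9 ^ q * (n : ℝ≥0∞) * (s ω * f (2 * q) ω ^ (1 / 2 : ℝ)) :=
        m3.const_mul _
      have a12 : Measurable fun ω => 18 * ((‖charFun μX u‖ₑ ^ 2)⁻¹ * s ω)
        + 2592 * (‖charFun με u‖ₑ ^ 2 * f 1 ω) := a1.add a2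
      have a123 : Measurable fun ω => 18 * ((‖charFun μX u‖ₑ ^ 2)⁻¹ * s ω)
        + 2592 * (‖charFun με u‖ₑ ^ 2 * f 1 ω)
        + 2 * 9 ^ q * (n : ℝ≥0∞) * (s ω * f (2 * q) ω ^ (1 / 2 : ℝ)) := a12.add a3
      rw [lintegral_add_left a123, lintegral_add_left a12, lintegral_add_left a1,
        lintegral_const_mul _ (ms.const_mul _), lintegral_const_mul _ ms,
        lintegral_const_mul _ ((mf 1).const_mul _), lintegral_const_mul _ (mf 1),
        lintegral_const_mul _ m3, lintegral_const_mul _ ((mf q).const_mul _),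
        lintegral_const_mul _ (mf q)]
    refine hstep.trans ?_
    have b2 : ‖charFun με u‖ₑ ^ 2 * ∫⁻ ω, f 1 ω ∂P
        ≤ C₂ * ENNReal.ofReal c ^ 2 * (G μX με n 1 u / n * J) := by
      have := mul_le_mul' (le_refl (n : ℝ≥0∞)⁻¹) h2
      rw [← mul_assoc, ENNReal.inv_mul_cancel hn0 hnt, one_mul] at this
      refine this.trans (le_of_eq ?_)
      rw [div_eq_mul_inv]
      ring
    have b4 : n * (‖charFun μX u‖ₑ ^ 2 * ‖charFun με u‖ₑ ^ 2 * ∫⁻ ω, f q ω ∂P)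
        ≤ C₄ * ENNReal.ofReal c ^ 2 * (G μX με n q u / (n : ℝ≥0∞) ^ (q - 1)
          * ((‖charFun μX u‖ₑ ^ 2)⁻¹ * J * J' ^ (q - 1))) := by
      -- A deliberate loss, to arrive at the weight `|φ_X|^(-2)` of the stated bound.
      have hle : ‖charFun μX u‖ₑ ^ 2 ≤ (‖charFun μX u‖ₑ ^ 2)⁻¹ :=
        (pow_le_one₀ zero_le (enorm_charFun_le_one μX u)).trans
          (one_le_inv_enorm_charFun_pow μX u 2)
      calc _ = ‖charFun μX u‖ₑ ^ 2 * (n * (‖charFun με u‖ₑ ^ 2 * ∫⁻ ω, f q ω ∂P)) := by ring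
        _ ≤ (‖charFun μX u‖ₑ ^ 2)⁻¹ * (C₄ * ENNReal.ofReal c ^ 2
            * (G μX με n q u / (n : ℝ≥0∞) ^ (q - 1) * (J * J' ^ (q - 1)))) :=
            mul_le_mul' hle h4
        _ = _ := by ring
    rw [riskBound]
    set R₁ := G μX με n 1 u / n * J
    set R₂ := G μX με n q u / (n : ℝ≥0∞) ^ (q - 1)
          * ((‖charFun μX u‖ₑ ^ 2)⁻¹ * J * J' ^ (q - 1))
    set R₃ := G μX με n (2 * q) u ^ (1 / 2 : ℝ) / (n : ℝ≥0∞) ^ q * ((‖charFun μX u‖ₑ ^ 4)⁻¹ *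
        J' ^ q)
    set κ := ENNReal.ofReal c ^ 2
    calc 18 * ((‖charFun μX u‖ₑ ^ 2)⁻¹ * ∫⁻ ω, s ω ∂P)
          + 2592 * (‖charFun με u‖ₑ ^ 2 * ∫⁻ ω, f 1 ω ∂P)
          + 2 * 9 ^ q * n * ∫⁻ ω, s ω * f (2 * q) ω ^ (1 / 2 : ℝ) ∂P
          + 8 * 9 ^ q * n * (‖charFun μX u‖ₑ ^ 2 * ‖charFun με u‖ₑ ^ 2 * ∫⁻ ω, f q ω ∂P)
        ≤ 18 * (C₁ * R₁) + 2592 * (C₂ * κ * R₁) + 2 * 9 ^ q * (C₃ * R₃)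
          + 8 * 9 ^ q * (C₄ * κ * R₂) := by
          rw [mul_assoc (2 * 9 ^ q : ℝ≥0∞), mul_assoc (8 * 9 ^ q : ℝ≥0∞)]
          gcongr
      _ = (18 * C₁) * 1 * R₁ + (2592 * C₂) * κ * R₁ + (2 * 9 ^ q * C₃) * 1 * R₃
          + (8 * 9 ^ q * C₄) * κ * R₂ := by ring
      _ ≤ (18 * C₁) * κ * R₁ + (2592 * C₂) * κ * R₁ + (2 * 9 ^ q * C₃) * κ * R₃
          + (8 * 9 ^ q * C₄) * κ * R₂ := by gcongr
      _ = (18 * C₁ + 2592 * C₂) * κ * R₁ + (8 * 9 ^ q * C₄) * κ * R₂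
          + (2 * 9 ^ q * C₃) * κ * R₃ := by ring
      _ ≤ _ := by
          rw [mul_add _ _ (1 / (n : ℝ≥0∞) ^ 2 * (‖charFun μX u‖ₑ ^ 4)⁻¹)]
          refine le_trans ?_ le_self_add
          rw [mul_add, mul_add]
          refine add_le_add (add_le_add ?_ ?_) ?_ <;>
            refine mul_le_mul' (mul_le_mul' ?_ le_rfl) le_rfl
          · exact (le_self_add.trans le_self_add).trans le_self_add
          · exact le_add_self.trans le_self_add
          · exact (le_add_self.trans le_self_add).trans le_self_add

/-! ### Symmetry of the estimator -/

section Symmetry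

open scoped ComplexConjugate

theorem regularize_conj (n : ℕ) (z : ℂ) : regularize n (conj z) = conj (regularize n z) := by
  simp only [regularize, norm_conj, map_div₀, conj_ofReal]

variable {n : ℕ} (y : Fin n → ℝ × ℝ) (u : ℝ)

theorem exp_I_mul_neg (a b : ℝ) :
    exp (I * ((0 : ℝ) * a + (-u : ℝ) * b)) = conj (exp (I * ((0 : ℝ) * a + u * b))) := by
  rw [← Complex.exp_conj]
  congr 1
  simp

theorem psiHat_neg : psiHat y 0 (-u) = conj (psiHat y 0 u) := by
  simp only [psiHat, map_mul, map_div₀, map_sum, map_one, map_natCast, exp_I_mul_neg]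

theorem dpsiHat_neg : dpsiHat y 0 (-u) = -conj (dpsiHat y 0 u) := by
  simp only [dpsiHat, map_mul, map_div₀, map_sum, map_one, map_natCast, exp_I_mul_neg, conj_I,
    conj_ofReal, neg_mul, Finset.sum_neg_distrib, mul_neg, neg_neg]

theorem psiTilde_neg : psiTilde y (-u) = conj (psiTilde y u) := by
  rw [psiTilde, psiHat_neg, regularize_conj, psiTilde]

theorem phiMod_neg : phiMod y (-u) = conj (phiMod y u) := by
  have h := intervalIntegral.integral_comp_neg (a := 0) (b := u)
    fun z => dpsiHat y 0 z / psiTilde y z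
  simp only [dpsiHat_neg, psiTilde_neg, neg_div, ← map_div₀, neg_zero] at h
  rw [intervalIntegral.integral_neg, intervalIntegral.intervalIntegral_conj] at h
  rw [phiMod, phiMod, ← Complex.exp_conj, intervalIntegral.integral_symm, ← h, neg_neg]

theorem phiHatX_neg : phiHatX y (-u) = conj (phiHatX y u) := by
  simp only [phiHatX, phiMod_neg, norm_conj, map_div₀, conj_ofReal]

theorem phiHatEps_neg : phiHatEps y (-u) = conj (phiHatEps y u) := by
  simp only [phiHatEps, phiTildeX, phiHatX_neg, regularize_conj, psiHat_neg, map_div₀]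

/-- Both functions are Hermitian, so the bounds proved for `u ≥ 0` cover negative frequencies. -/
theorem enorm_phiHatEps_sub_abs (με : Measure ℝ) :
    ‖phiHatEps y |u| - charFun με |u|‖ₑ = ‖phiHatEps y u - charFun με u‖ₑ := by
  rcases abs_choice u with h | h
  · rw [h]
  · rw [h, phiHatEps_neg, charFun_neg, ← map_sub, ← ofReal_norm, norm_conj, ofReal_norm]

theorem enorm_charFun_abs (μ : Measure ℝ) : ‖charFun μ |u|‖ₑ = ‖charFun μ u‖ₑ := by
  rcases abs_choice u with h | h
  · rw [h]
  · rw [h, charFun_neg, ← ofReal_norm, norm_conj, ofReal_norm]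

theorem intInvSq_abs (φ : ℝ → ℂ) : intInvSq φ |u| = intInvSq φ u := by
  rw [intInvSq, intInvSq, abs_abs]

theorem riskBound_abs (μX με : Measure ℝ) (n q : ℕ) (v : ℝ) :
    riskBound μX με n q v |u| = riskBound μX με n q v u := by
  simp only [riskBound, intInvSq_abs, enorm_charFun_abs]

end Symmetry

/-- The argument of `G` is kept separate from the frequency so that it can be enlarged to `1/h` and
`G` taken out of the integral over `u`. -/
theorem riskBound_mono (μX με : Measure ℝ) (n q : ℕ) {v w : ℝ} (hv : 0 ≤ v) (hvw : v ≤ w)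
    (u : ℝ) : riskBound μX με n q v u ≤ riskBound μX με n q w u := by
  have hG := fun p => G_mono μX με n p hv hvw
  unfold riskBound
  refine add_le_add (add_le_add (add_le_add ?_ ?_) ?_) le_rfl <;> refine mul_le_mul' ?_ le_rfl
  · exact ENNReal.div_le_div_right (hG 1) _
  · exact ENNReal.div_le_div_right (hG q) _
  · exact ENNReal.div_le_div_right (ENNReal.rpow_le_rpow (hG (2 * q)) (by norm_num)) _

/-! ### Measurability and boundedness of the estimator -/

section Estimator

variable {Ω : Type*} [MeasurableSpace Ω] {n : ℕ} {Y : Fin n → Ω → ℝ × ℝ}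

theorem measurable_phiMod (hn : 0 < n) (hY : ∀ j, Measurable (Y j)) :
    Measurable fun a : Ω × ℝ => phiMod (fun j => Y j a.1) a.2 := by
  have hF : Measurable (Function.uncurry fun (ω : Ω) (z : ℝ) =>
      dpsiHat (fun j => Y j ω) 0 z / psiTilde (fun j => Y j ω) z) :=
    (measurable_dpsiHat hY).div (measurable_psiTilde hY)
  have h1 : Measurable (Function.uncurry fun (u : ℝ) (ω : Ω) =>
      ∫ z in (0 : ℝ)..u, dpsiHat (fun j => Y j ω) 0 z / psiTilde (fun j => Y j ω) z) := by
    -- Joint measurability in the sense of Carathéodory: the primitive is continuous in its end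
    -- point and measurable in the sample.
    refine measurable_uncurry_of_continuous_of_measurable (fun ω => ?_) fun u => ?_
    · exact intervalIntegral.continuous_primitive
        (fun a b => intervalIntegrable_dpsiHat_div hn (fun j => Y j ω) a b) 0
    · unfold intervalIntegral
      exact (hF.stronglyMeasurable.integral_prod_right.measurable).sub
        (hF.stronglyMeasurable.integral_prod_right.measurable)
  exact Complex.measurable_exp.comp (h1.comp measurable_swap)

theorem measurable_phiHatEps (hn : 0 < n) (hY : ∀ j, Measurable (Y j)) :
    Measurable fun a : Ω × ℝ => phiHatEps (fun j => Y j a.1) a.2 := by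
  have h1 := measurable_phiMod hn hY
  have h2 : Measurable fun a : Ω × ℝ => phiHatX (fun j => Y j a.1) a.2 :=
    h1.div (Complex.measurable_ofReal.comp (measurable_const.max h1.norm))
  exact (measurable_psiHat hY).div ((measurable_regularize n).comp h2)

theorem norm_psiHat_le_one (hn : 0 < n) (y : Fin n → ℝ × ℝ) (u : ℝ) : ‖psiHat y 0 u‖ ≤ 1 := by
  have hn' : (0 : ℝ) < n := by exact_mod_cast hn
  rw [psiHat, norm_mul, norm_div, norm_one, norm_natCast, div_mul_eq_mul_div, one_mul,
    div_le_one hn']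
  refine (norm_sum_le _ _).trans ?_
  refine (Finset.sum_le_card_nsmul _ _ 1 fun j _ => ?_).trans (by simp)
  exact (norm_exp_I_mul _ (by simp)).le

theorem norm_phiHatEps_le (hn : 0 < n) (y : Fin n → ℝ × ℝ) (u : ℝ) :
    ‖phiHatEps y u‖ ≤ Real.sqrt n := by
  rw [phiHatEps, div_eq_mul_one_div, norm_mul]
  calc _ ≤ 1 * Real.sqrt n := mul_le_mul (norm_psiHat_le_one hn y u)
        (norm_inv_regularize_le hn _) (norm_nonneg _) zero_le_one
    _ = _ := one_mul _

end Estimator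

/-! ### Densities -/

section Density

variable {f : ℝ → ℝ} {μ : Measure ℝ} [IsProbabilityMeasure μ]

theorem RepeatedDeconv.IsSqIntegrableDensity.integrable (hf : IsSqIntegrableDensity f μ) :
    Integrable f := by
  refine ⟨hf.measurable.aestronglyMeasurable, ?_⟩
  rw [hasFiniteIntegral_iff_ofReal (Filter.Eventually.of_forall hf.nonneg)]
  have h : μ Set.univ = 1 := measure_univ
  rw [hf.withDensity, withDensity_apply _ MeasurableSet.univ, setLIntegral_univ] at h
  rw [h]
  exact ENNReal.one_lt_top

theorem RepeatedDeconv.IsSqIntegrableDensity.charFun_eq (hf : IsSqIntegrableDensity f μ) (u : ℝ) :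
    charFun μ u = ∫ t : ℝ, exp (I * u * t) * f t := by
  rw [charFun_apply_real, hf.withDensity, integral_withDensity_eq_integral_toReal_smul
    hf.measurable.ennreal_ofReal (Filter.Eventually.of_forall fun _ => ENNReal.ofReal_lt_top)]
  refine integral_congr_ae (Filter.Eventually.of_forall fun t => ?_)
  simp only [ENNReal.toReal_ofReal (hf.nonneg t), real_smul]
  rw [mul_comm]
  congr 2
  ring

end Density

/-! ### From the pointwise risk of `φ̂_ε` to the risk of the density estimator. -/

theorem eLpNorm_two_sq {α E : Type*} [MeasurableSpace α] [NormedAddCommGroup E] {μ : Measure α}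
    (f : α → E) : eLpNorm f 2 μ ^ 2 = ∫⁻ x, ‖f x‖ₑ ^ 2 ∂μ := by
  have := eLpNorm_nnreal_pow_eq_lintegral (μ := μ) (f := f) (p := 2) (by norm_num)
  simpa using this

theorem eLpNorm_add_sq_le {α E : Type*} [MeasurableSpace α] [NormedAddCommGroup E]
    {μ : Measure α} {f : α → E} (hf : AEStronglyMeasurable f μ) (g : α → E) :
    eLpNorm (fun x => f x + g x) 2 μ ^ 2 ≤ 2 * eLpNorm f 2 μ ^ 2 + 2 * eLpNorm g 2 μ ^ 2 := by
  rw [eLpNorm_two_sq, eLpNorm_two_sq, eLpNorm_two_sq, ← lintegral_const_mul' _ _ (by simp),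
    ← lintegral_const_mul' _ _ (by simp),
    ← lintegral_add_left' ((hf.enorm.pow_const 2).const_mul _)]
  refine lintegral_mono fun x => ?_
  have h : ‖f x + g x‖ ^ 2 ≤ 2 * ‖f x‖ ^ 2 + 2 * ‖g x‖ ^ 2 := by
    refine (pow_le_pow_left₀ (norm_nonneg _) (norm_add_le _ _) 2).trans ?_
    nlinarith [sq_nonneg (‖f x‖ - ‖g x‖)]
  have := ENNReal.ofReal_le_ofReal h
  rw [ENNReal.ofReal_add (by positivity) (by positivity), ENNReal.ofReal_mul (by norm_num),
    ENNReal.ofReal_mul (by norm_num), ENNReal.ofReal_pow (norm_nonneg _),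
    ENNReal.ofReal_pow (norm_nonneg _), ENNReal.ofReal_pow (norm_nonneg _), ofReal_norm,
    ofReal_norm, ofReal_norm] at this
  simpa using this

theorem aestronglyMeasurable_smooth {K f : ℝ → ℝ} (hK : MemLp K 2 volume) (hf : Measurable f)
    {h : ℝ} (hh : 0 < h) : AEStronglyMeasurable (smooth K h f) volume := by
  have hk := (memLp_scaleKernel hK hh).1
  have : AEStronglyMeasurable (fun z : ℝ × ℝ => scaleKernel K h z.2 * f (z.1 - z.2))
      (volume.prod volume) :=
    hk.comp_snd.mul (by fun_prop : Measurable fun z : ℝ × ℝ => f (z.1 - z.2)).aestronglyMeasurable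
  exact this.integral_prod_right'

theorem measurable_intInvSq (φ : ℝ → ℂ) : Measurable (intInvSq φ) := by
  have hmono : Monotone fun v : ℝ => ∫⁻ z in Set.Icc 0 v, (‖φ z‖ₑ ^ 2)⁻¹ :=
    fun a b hab => lintegral_mono_set (Set.Icc_subset_Icc_right hab)
  exact hmono.measurable.comp measurable_norm

theorem enorm_fourierL2_scaleKernel_le {K : ℝ → ℝ} (hK : MemLp K 2 volume) {h : ℝ} (hh : 0 < h) :
    ∀ᵐ u, ‖fourierL2 (scaleKernel K h) u‖ₑ ≤ eLpNorm (fourierL2 K) ∞ volume := by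
  rw [eLpNorm_exponent_top]
  filter_upwards [fourierL2_scaleKernel hK hh,
    ae_comp_mul_left (ae_le_eLpNormEssSup (f := fourierL2 K)) hh.ne'] with u h1 h2
  rwa [h1]

theorem fourierL2_scaleKernel_eq_zero {K : ℝ → ℝ} (hK : MemLp K 2 volume)
    (hsupp : ∀ᵐ u, u ∉ Set.Icc (-1 : ℝ) 1 → fourierL2 K u = 0) {h : ℝ} (hh : 0 < h) :
    ∀ᵐ u, u ∉ Set.Icc (-(1 / h)) (1 / h) → fourierL2 (scaleKernel K h) u = 0 := by
  filter_upwards [fourierL2_scaleKernel hK hh, ae_comp_mul_left hsupp hh.ne'] with u h1 h2 hu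
  rw [h1]
  refine h2 fun hu' => hu ⟨?_, ?_⟩
  · rw [← neg_div, div_le_iff₀ hh]
    linarith [hu'.1]
  · rw [le_div_iff₀ hh]
    linarith [hu'.2]

theorem lintegral_riskBound {μX με : Measure ℝ} [IsProbabilityMeasure μX]
    [IsProbabilityMeasure με] (n q : ℕ) (v : ℝ) (s : Set ℝ) :
    ∫⁻ u in s, riskBound μX με n q v u =
      G μX με n 1 v / n * (∫⁻ u in s, intInvSq (charFun μX) u)
        + G μX με n q v / (n : ℝ≥0∞) ^ (q - 1) * (∫⁻ u in s, (‖charFun μX u‖ₑ ^ 2)⁻¹ *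
          intInvSq (charFun μX) u * intInvSq (phiY μX με) u ^ (q - 1))
        + G μX με n (2 * q) v ^ (1 / 2 : ℝ) / (n : ℝ≥0∞) ^ q *
          (∫⁻ u in s, (‖charFun μX u‖ₑ ^ 4)⁻¹ * intInvSq (phiY μX με) u ^ q)
        + 1 / (n : ℝ≥0∞) ^ 2 * ∫⁻ u in s, (‖charFun μX u‖ₑ ^ 4)⁻¹ := by
  have mJ := measurable_intInvSq (charFun μX)
  have mJ' := measurable_intInvSq (phiY μX με)
  have mi : ∀ k : ℕ, Measurable fun u => (‖charFun μX u‖ₑ ^ k)⁻¹ := fun k =>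
    (continuous_charFun.measurable.enorm.pow_const k).inv
  have m2 : Measurable fun u => (‖charFun μX u‖ₑ ^ 2)⁻¹ *
      intInvSq (charFun μX) u * intInvSq (phiY μX με) u ^ (q - 1) :=
    ((mi 2).mul mJ).mul (mJ'.pow_const _)
  have m3 : Measurable fun u => (‖charFun μX u‖ₑ ^ 4)⁻¹ * intInvSq (phiY μX με) u ^ q :=
    (mi 4).mul (mJ'.pow_const _)
  simp only [riskBound]
  rw [lintegral_add_right _ ((mi 4).const_mul _), lintegral_add_right _ (m3.const_mul _),
    lintegral_add_right _ (m2.const_mul _), lintegral_const_mul _ mJ, lintegral_const_mul _ m2,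
    lintegral_const_mul _ m3, lintegral_const_mul _ (mi 4)]

/-- Insert `K_h * f`: the first difference is the bias, the second is treated by Plancherel, for
which the bound `|φ̂_ε| ≤ √n` supplies the integrability. -/
theorem eLpNorm_sub_fHatEps_sq_le {μ : Measure ℝ} [IsProbabilityMeasure μ] {f K : ℝ → ℝ}
    (hf : IsSqIntegrableDensity f μ) (hK : MemLp K 2 volume)
    (hsupp : ∀ᵐ u, u ∉ Set.Icc (-1 : ℝ) 1 → fourierL2 K u = 0) {h : ℝ} (hh : 0 < h)
    {n : ℕ} (hn : 0 < n) {y : Fin n → ℝ × ℝ} (hm : Measurable fun u => phiHatEps y u) :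
    eLpNorm (fun x => (f x : ℂ) - fHatEps K h y x) 2 volume ^ 2 ≤
      2 * eLpNorm (fun x => f x - smooth K h f x) 2 volume ^ 2
      + 2 * (eLpNorm (fourierL2 K) ∞ volume ^ 2 *
        ∫⁻ u in Set.Icc (-(1 / h)) (1 / h), ‖phiHatEps y u - charFun μ u‖ₑ ^ 2) := by
  have h1 := eLpNorm_smooth_sub_inversion_sq_le (memLp_scaleKernel hK hh) hf.integrable hf.memLp
    (fourierL2_scaleKernel_eq_zero hK hsupp hh) hf.charFun_eq continuous_charFun.measurable hm
    (M := max 1 (Real.sqrt n)) (fun u => (norm_charFun_le_one u).trans (le_max_left _ _))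
    (fun u => (norm_phiHatEps_le hn y u).trans (le_max_right _ _))
  have h2 : ∫⁻ u in Set.Icc (-(1 / h)) (1 / h), ‖phiHatEps y u - charFun μ u‖ₑ ^ 2
        * ‖fourierL2 (scaleKernel K h) u‖ₑ ^ 2
      ≤ eLpNorm (fourierL2 K) ∞ volume ^ 2 *
        ∫⁻ u in Set.Icc (-(1 / h)) (1 / h), ‖phiHatEps y u - charFun μ u‖ₑ ^ 2 := by
    have hme : Measurable fun u => ‖phiHatEps y u - charFun μ u‖ₑ ^ 2 :=
      (hm.sub continuous_charFun.measurable).enorm.pow_const 2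
    rw [← lintegral_const_mul _ hme]
    refine lintegral_mono_ae ?_
    filter_upwards [ae_restrict_of_ae (enorm_fourierL2_scaleKernel_le hK hh)] with u hu
    rw [mul_comm]
    gcongr
  have hsub : AEStronglyMeasurable (fun x => ((f x - smooth K h f x : ℝ) : ℂ)) volume :=
    Complex.continuous_ofReal.comp_aestronglyMeasurable
      (hf.measurable.aestronglyMeasurable.sub (aestronglyMeasurable_smooth hK hf.measurable hh))
  have h3 := eLpNorm_add_sq_le hsub fun x => (smooth K h f x : ℂ) - fHatEps K h y x
  have e1 : eLpNorm (fun x => ((f x - smooth K h f x : ℝ) : ℂ)) 2 volume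
      = eLpNorm (fun x => f x - smooth K h f x) 2 volume :=
    eLpNorm_congr_norm_ae (Filter.Eventually.of_forall fun x => norm_real _)
  have e2 : ∀ x, ((f x - smooth K h f x : ℝ) : ℂ) + ((smooth K h f x : ℂ) - fHatEps K h y x)
      = (f x : ℂ) - fHatEps K h y x := fun x => by
    push_cast
    ring
  simp only [e1, e2] at h3
  exact h3.trans (add_le_add le_rfl (mul_le_mul' le_rfl (h1.trans h2)))

theorem lintegral_eLpNorm_sub_fHatEps_sq_le {μ : Measure ℝ} [IsProbabilityMeasure μ]
    {f K : ℝ → ℝ} (hf : IsSqIntegrableDensity f μ) (hK : MemLp K 2 volume)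
    (hsupp : ∀ᵐ u, u ∉ Set.Icc (-1 : ℝ) 1 → fourierL2 K u = 0) {h : ℝ} (hh : 0 < h)
    {Ω : Type*} [MeasurableSpace Ω] {P : Measure Ω} [IsProbabilityMeasure P]
    {n : ℕ} (hn : 0 < n) {Y : Fin n → Ω → ℝ × ℝ} (hY : ∀ j, Measurable (Y j)) {b : ℝ → ℝ≥0∞}
    (hb : ∀ u ∈ Set.Icc (-(1 / h)) (1 / h),
      ∫⁻ ω, ‖phiHatEps (fun j => Y j ω) u - charFun μ u‖ₑ ^ 2 ∂P ≤ b u) :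
    ∫⁻ ω, eLpNorm (fun x => (f x : ℂ) - fHatEps K h (fun j => Y j ω) x) 2 volume ^ 2 ∂P ≤
      2 * eLpNorm (fun x => f x - smooth K h f x) 2 volume ^ 2
      + 2 * (eLpNorm (fourierL2 K) ∞ volume ^ 2 *
        ∫⁻ u in Set.Icc (-(1 / h)) (1 / h), b u) := by
  have hmeas := measurable_phiHatEps hn hY
  have hm : ∀ ω, Measurable fun u => phiHatEps (fun j => Y j ω) u := fun ω => by
    have := hmeas.comp (measurable_prodMk_left (x := ω))
    simpa only [Function.comp_def] using this
  have hφ : Measurable fun a : Ω × ℝ => charFun μ a.2 :=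
    continuous_charFun.measurable.comp measurable_snd
  have hjoint : Measurable fun a : Ω × ℝ =>
      ‖phiHatEps (fun j => Y j a.1) a.2 - charFun μ a.2‖ₑ ^ 2 :=
    (hmeas.sub hφ).enorm.pow_const 2
  refine (lintegral_mono fun ω => eLpNorm_sub_fHatEps_sq_le hf hK hsupp hh hn (hm ω)).trans ?_
  have hin : Measurable fun ω => ∫⁻ u in Set.Icc (-(1 / h)) (1 / h),
      ‖phiHatEps (fun j => Y j ω) u - charFun μ u‖ₑ ^ 2 := hjoint.lintegral_prod_right
  rw [lintegral_add_left measurable_const, lintegral_const, measure_univ, mul_one,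
    lintegral_const_mul _ (hin.const_mul _), lintegral_const_mul _ hin,
    lintegral_lintegral_swap hjoint.aemeasurable]
  exact add_le_add le_rfl (mul_le_mul' le_rfl (mul_le_mul' le_rfl
    (setLIntegral_mono' measurableSet_Icc hb)))

theorem theorem3p2 (q : ℕ) (hq : 2 ≤ q) :
    ∃ C : ℝ, 0 < C ∧
      ∀ (μX με : Measure ℝ) [IsProbabilityMeasure μX] [IsProbabilityMeasure με]
        (fX fε K : ℝ → ℝ) (CX Cε : ℝ),
        IsSqIntegrableDensity fX μX →
        IsSqIntegrableDensity fε με →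
        (∀ u, charFun μX u ≠ 0) →
        (∀ u, charFun με u ≠ 0) →
        Integrable (fun e : ℝ => e) με →
        ∫ e, e ∂με = 0 →
        0 < CX →
        QuasiDecreasing (charFun μX) CX →
        0 < Cε →
        QuasiDecreasing (charFun με) Cε →
        momentY μX με (4 * q) < ∞ →
        MemLp K 2 volume →
        (∀ᵐ u, u ∉ Set.Icc (-1 : ℝ) 1 → fourierL2 K u = 0) →
        ∀ (Ω : Type*) [MeasurableSpace Ω] (P : Measure Ω) [IsProbabilityMeasure P]
          (n : ℕ) (Y : Fin n → Ω → ℝ × ℝ) (h : ℝ),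
          0 < n →
          IsSample P μX με Y →
          0 < h →
          ∫⁻ ω, eLpNorm (fun x => (fε x : ℂ) - fHatEps K h (fun j => Y j ω) x) 2 volume ^ 2 ∂P ≤
            2 * eLpNorm (fun x => fε x - smooth K h fε x) 2 volume ^ 2
            + ENNReal.ofReal (C * Cε ^ 2) * eLpNorm (fourierL2 K) ∞ volume ^ 2 *
              (G μX με n 1 (1 / h) / n *
                  (∫⁻ u in Set.Icc (-(1 / h)) (1 / h), intInvSq (charFun μX) u)
                + G μX με n q (1 / h) / (n : ℝ≥0∞) ^ (q - 1) *
                  (∫⁻ u in Set.Icc (-(1 / h)) (1 / h), (‖charFun μX u‖ₑ ^ 2)⁻¹ *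
                    intInvSq (charFun μX) u * intInvSq (phiY μX με) u ^ (q - 1))
                + G μX με n 2 (1 / h) ^ (1 / 2 : ℝ) / (n : ℝ≥0∞) ^ 2 *
                  (∫⁻ u in Set.Icc (-(1 / h)) (1 / h), (‖charFun μX u‖ₑ ^ 2)⁻¹ *
                    intInvSq (phiY μX με) u)
                + G μX με n (2 * q) (1 / h) ^ (1 / 2 : ℝ) / (n : ℝ≥0∞) ^ q *
                  (∫⁻ u in Set.Icc (-(1 / h)) (1 / h), (‖charFun μX u‖ₑ ^ 4)⁻¹ *
                    intInvSq (phiY μX με) u ^ q)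
                + 1 / (n : ℝ≥0∞) ^ 2 *
                  ∫⁻ u in Set.Icc (-(1 / h)) (1 / h), (‖charFun μX u‖ₑ ^ 4)⁻¹) := by
  obtain ⟨C, hC, key⟩ := exists_lintegral_phiHatEps_sub_sq_le q hq
  have hC0 : 0 ≤ C.toReal := ENNReal.toReal_nonneg
  -- The factor `2` is that of the stochastic term in `(a + b)² ≤ 2a² + 2b²`; the added `1` ensures
  -- positivity.
  refine ⟨2 * C.toReal + 1, by linarith, ?_⟩
  intro μX με _ _ fX fε K CX Cε hfX hfε hX0 hε0 _ hε1 _ _ hCε hε hmom hK hsupp Ω _ P _ n Y h hn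
    hY hh
  have hM : RegularModel μX με := by
    obtain ⟨h1, h2⟩ := memLp_id_of_momentY_lt_top (by omega) hmom
    have h24 : (2 : ℝ≥0∞) ≤ ((4 * q : ℕ) : ℝ≥0∞) := by exact_mod_cast (by omega : 2 ≤ 4 * q)
    exact ⟨h1.mono_exponent h24, h2.mono_exponent h24, hε1, hX0, hε0⟩
  have hconst : 2 * (C * ENNReal.ofReal Cε ^ 2)
      ≤ ENNReal.ofReal ((2 * C.toReal + 1) * Cε ^ 2) := by
    rw [ENNReal.ofReal_mul (by linarith), ENNReal.ofReal_pow hCε.le, ← mul_assoc]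
    refine mul_le_mul' ?_ le_rfl
    calc 2 * C = ENNReal.ofReal (2 * C.toReal) := by
          rw [ENNReal.ofReal_mul (by norm_num), ENNReal.ofReal_toReal hC]
          norm_num
      _ ≤ _ := ENNReal.ofReal_le_ofReal (by linarith)
  have hpoint : ∀ u ∈ Set.Icc (-(1 / h)) (1 / h),
      ∫⁻ ω, ‖phiHatEps (fun j => Y j ω) u - charFun με u‖ₑ ^ 2 ∂P
        ≤ C * ENNReal.ofReal Cε ^ 2 * riskBound μX με n q (1 / h) u := by
    intro u hu
    -- The bound is applied at `|u|`, transferred to `u` by symmetry, and `G` is then enlarged from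
    -- `|u|` to `1/h`.
    have := key μX με Ω P n Y hn hY hM hmom Cε hε |u| (abs_nonneg u)
    simp only [enorm_phiHatEps_sub_abs, riskBound_abs] at this
    exact this.trans (mul_le_mul' le_rfl
      (riskBound_mono μX με n q (abs_nonneg u) (abs_le.2 hu) u))
  refine (lintegral_eLpNorm_sub_fHatEps_sq_le hfε hK hsupp hh hn hY.measurable hpoint).trans ?_
  rw [lintegral_const_mul' _ _ (by finiteness), mul_left_comm, ← mul_assoc 2, mul_left_comm,
    ← mul_assoc, lintegral_riskBound]
  refine add_le_add le_rfl (mul_le_mul' (mul_le_mul' hconst le_rfl) ?_)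
  -- The argument does not produce the term with `G(X, ε, 2, 1/h)`; it is added as a nonnegative
  -- summand.
  exact add_le_add (add_le_add le_self_add le_rfl) le_rfl
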